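/- Let $\mathbb{C}^{2,1}$ be $\mathbb{C}^3$ with the Hermitian form $\langle v,w\rangle=v_1\bar w_1+v_2\bar w_2-v_3\bar w_3$, let $\mathbb{CH}^2$ and $\mathbb{C}\mathrm{dS}^2$ be the sets of negative and of positive lines in $\mathbb{C}^{2,1}$, and let $PU(2,1)=U(2,1)/\text{centre}$ act on them. At a line $\ell$ of either kind the holomorphic tangent space is $T'_\ell=\operatorname{Hom}(\ell,\ell^\perp)$, with the (pseudo-)Hermitian metric $h(A,B)=\langle A\sigma,B\sigma\rangle$, where $\sigma\in\ell$ and $\langle\sigma,\sigma\rangle=\pm1$; and $T''_\ell=\operatorname{Hom}(\ell^\perp,\ell)$. For a map $\varphi$ from the unit disc $\mathcal{D}$ with coordinate $z$, put $Z=\partial/\partial z$; $\partial\varphi'(Z)$ and $\bar\partial\varphi'(\bar Z)$ are the $T'$-parts of the derivatives of $\varphi$ along $Z$ and $\bar Z$, and $\partial\varphi''(Z)$ is the $T''$-part of the derivative along $Z$. Let $\Gamma$ act on $\mathcal{D}$ as a Fuchsian group, i.e. by holomorphic automorphisms, freely, properly discontinuously and cocompactly (so $\Gamma=\pi_1\Sigma$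 for the closed surface $\Sigma=\mathcal{D}/\Gamma$ of genus at least two), let $\rho:\Gamma\to PU(2,1)$ be a homomorphism, and let $f:\mathcal{D}\to\mathbb{CH}^2$ be a $\rho$-equivariant minimal immersion, possibly branched, i.e. a smooth weakly conformal harmonic map. Suppose that $f$ is neither holomorphic nor anti-holomorphic. Let $\mathcal{Q}=Q\,dz^3$, $Q=h(\nabla_Z\partial f'(Z),\bar\partial f'(\bar Z))$, be its cubic differential, with $\nabla$ the Levi-Civita connexion of $\mathbb{CH}^2$, and let $D_2$ be the divisor of complex points, i.e. of zeros of $\partial f''$, which has finite multiplicities. Then there is exactly one continuous map $\varphi_2:\mathcal{D}\to\mathbb{C}\mathrm{dS}^2$ (the $\bar\partial$-Gauss transform of $f$) such that the line $\varphi_2(z)$ is the image of $\bar\partial f'(\bar Z)$ at every $z$ where $\bar\partial f'\neq0$, and: 1. $\mathcal{Q}=0$ if and only if $\varphi_2$ is holomorphic, $\rho$-equivariant and timelike, where timelike means that the zeros of $d\varphi_2$ (branch points) are isolated and that away from them the induced metric $\operatorname{Re}h(d\varphi_2',d\varphi_2')$ is negative definite. 2. If $\mathcal{Q}=0$, then the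 branch divisor of $\varphi_2$ is $D_2$: at each point of $\mathcal{D}$ the order of vanishing of $\partial\varphi_2'$ equals that of $\partial f''$, and it is finite. -/

import Mathlib

open scoped LinearAlgebra.Projectivization Complex.UnitDisc ContDiff Topology ComplexConjugate
open scoped Asymptotics

noncomputable section

namespace CHMinimal

/-! ### The indefinite Hermitian space `ℂ^{2,1}` and its projective space -/

/-- The vector space underlying `ℂ^{2,1}`. -/
abbrev C21 : Type := Fin 3 → ℂ

/-- The projective plane of lines in `ℂ^{2,1}`. -/
abbrev P21 : Type := ℙ ℂ C21

/-- `w` fixed, the linear form `v ↦ ⟨v, w⟩ = v₁ w̄₁ + v₂ w̄₂ - v₃ w̄₃`. -/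
def hermForm (w : C21) : C21 →ₗ[ℂ] ℂ where
  toFun v := v 0 * conj (w 0) + v 1 * conj (w 1) - v 2 * conj (w 2)
  map_add' u v := by simp only [Pi.add_apply]; ring
  map_smul' c v := by simp only [Pi.smul_apply, smul_eq_mul, RingHom.id_apply]; ring

/-- The indefinite Hermitian metric, complex linear in the first entry. -/
def herm (v w : C21) : ℂ := hermForm w v

/-- Complex hyperbolic plane: the negative lines. -/
def CH2 : Set P21 := {ℓ | (herm ℓ.rep ℓ.rep).re < 0}

/-- Complex de Sitter space: the positive lines. -/
def CdS2 : Set P21 := {ℓ | 0 < (herm ℓ.rep ℓ.rep).re}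

/-! ### The group `PU(2,1)` -/

/-- `U(2,1)`: the linear automorphisms preserving the Hermitian metric. -/
def U21 : Subgroup (C21 ≃ₗ[ℂ] C21) where
  carrier := {g | ∀ v w, herm (g v) (g w) = herm v w}
  mul_mem' {a b} ha hb v w := by
    change herm (a (b v)) (a (b w)) = _
    rw [ha, hb]
  one_mem' _ _ := rfl
  inv_mem' {a} ha v w := by
    have h := ha (a⁻¹ v) (a⁻¹ w)
    have e : ∀ x, a (a⁻¹ x) = x := fun x => a.apply_symm_apply x
    rw [e, e] at h
    exact h.symm

/-- `PU(2,1) = U(2,1) / centre`. -/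
abbrev PU21 : Type := U21 ⧸ Subgroup.center U21

theorem herm_add_left (u v w : C21) : herm (u + v) w = herm u w + herm v w :=
  map_add _ _ _

theorem herm_smul_left (c : ℂ) (v w : C21) : herm (c • v) w = c * herm v w :=
  map_smul (hermForm w) c v

theorem herm_conj (v w : C21) : conj (herm v w) = herm w v := by
  simp only [herm, hermForm, LinearMap.coe_mk, AddHom.coe_mk, map_sub, map_add, map_mul,
    Complex.conj_conj]
  ring

theorem herm_add_right (u v w : C21) : herm w (u + v) = herm w u + herm w v := by
  rw [← herm_conj, herm_add_left, map_add, herm_conj, herm_conj]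

theorem herm_smul_right (c : ℂ) (v w : C21) : herm w (c • v) = conj c * herm w v := by
  rw [← herm_conj, herm_smul_left, map_mul, herm_conj]

/-- The reflection in a vector `u` that is not null. -/
def reflFun (u : C21) : C21 →ₗ[ℂ] C21 :=
  LinearMap.id - (2 / herm u u) • (hermForm u).smulRight u

theorem reflFun_apply (u v : C21) :
    reflFun u v = v + (-(2 / herm u u * herm v u)) • u := by
  simp [reflFun, herm, sub_eq_add_neg, smul_smul]

theorem reflFun_invol {u : C21} (hu : herm u u ≠ 0) (v : C21) :
    reflFun u (reflFun u v) = v := by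
  rw [reflFun_apply, reflFun_apply, herm_add_left, herm_smul_left, add_assoc, ← add_smul]
  have : -(2 / herm u u * herm v u) +
      -(2 / herm u u * (herm v u + -(2 / herm u u * herm v u) * herm u u)) = 0 := by
    field_simp
    ring
  rw [this, zero_smul, add_zero]

/-- The reflection as an element of `U(2,1)`. -/
def refl21 (u : C21) (hu : herm u u ≠ 0) : U21 :=
  ⟨LinearEquiv.ofInvolutive (reflFun u) (reflFun_invol hu), by
    intro v w
    change herm (reflFun u v) (reflFun u w) = _
    have hr : conj (herm u u) = herm u u := herm_conj u u
    rw [reflFun_apply, reflFun_apply]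
    simp only [herm_add_left, herm_add_right, herm_smul_left, herm_smul_right, map_neg, map_mul,
      map_div₀, herm_conj, map_ofNat]
    field_simp
    ring⟩

theorem center_eigen {g : U21} (hg : g ∈ Subgroup.center U21) (u : C21) (hu : herm u u ≠ 0) :
    ∃ a : ℂ, (g : C21 ≃ₗ[ℂ] C21) u = a • u := by
  have h := Subgroup.mem_center_iff.1 hg (refl21 u hu)
  have h' : reflFun u ((g : C21 ≃ₗ[ℂ] C21) u) = (g : C21 ≃ₗ[ℂ] C21) (reflFun u u) :=
    congrArg (fun k : U21 => (k : C21 ≃ₗ[ℂ] C21) u) h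
  set x := (g : C21 ≃ₗ[ℂ] C21) u with hx
  have e : reflFun u u = -u := by
    rw [reflFun_apply, div_mul_cancel₀ _ hu]
    module
  rw [e, map_neg, ← hx, reflFun_apply] at h'
  refine ⟨herm x u / herm u u, ?_⟩
  have h2 : (2 : ℂ) • x = (2 : ℂ) • ((herm x u / herm u u) • u) := by
    calc (2 : ℂ) • x = (x + -(2 / herm u u * herm x u) • u) + x
          + (2 / herm u u * herm x u) • u := by module
      _ = (2 / herm u u * herm x u) • u := by rw [h']; module
      _ = _ := by rw [smul_smul]; congr 1; ring
  exact smul_right_injective _ two_ne_zero h2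

theorem center_scalar {g : U21} (hg : g ∈ Subgroup.center U21) :
    ∃ a : ℂ, ∀ v, (g : C21 ≃ₗ[ℂ] C21) v = a • v := by
  obtain ⟨a, ha⟩ := center_eigen hg ![1, 0, 0] (by simp [herm, hermForm])
  obtain ⟨b, hb⟩ := center_eigen hg ![0, 1, 0] (by simp [herm, hermForm])
  obtain ⟨c, hc⟩ := center_eigen hg ![0, 0, 1] (by simp [herm, hermForm])
  obtain ⟨d, hd⟩ := center_eigen hg ![1, 1, 0] (by simp [herm, hermForm])
  obtain ⟨e, he⟩ := center_eigen hg ![2, 0, 1] (by simp [herm, hermForm, map_ofNat]; norm_num)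
  have s1 : (![1, 1, 0] : C21) = ![1, 0, 0] + ![0, 1, 0] := by simp
  have s2 : (![2, 0, 1] : C21) = (2 : ℂ) • ![1, 0, 0] + ![0, 0, 1] := by simp
  rw [s1, map_add, ha, hb] at hd
  rw [s2, map_add, map_smul, ha, hc] at he
  have d0 := congrFun hd 0
  have d1 := congrFun hd 1
  have e0 := congrFun he 0
  have e2 := congrFun he 2
  simp at d0 d1 e0 e2
  have hab : b = a := by rw [d0, d1]
  have hca : c = a := by
    rw [e2]
    have : (2 : ℂ) * a = 2 * e := by rw [e0]; ring
    exact (mul_left_cancel₀ two_ne_zero this).symm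
  refine ⟨a, fun v => ?_⟩
  have hv : v = v 0 • ![1, 0, 0] + v 1 • ![0, 1, 0] + v 2 • ![0, 0, 1] := by
    ext i; fin_cases i <;> simp
  rw [hv]
  simp only [map_add, map_smul, ha, hb, hc, hab, hca]
  module

/-- The centre of `U(2,1)` acts trivially on lines. -/
theorem center_le_ker :
    Subgroup.center U21 ≤ (MulAction.toPermHom U21 P21).ker := by
  intro g hg
  obtain ⟨a, ha⟩ := center_scalar hg
  rw [MonoidHom.mem_ker]
  ext ℓ
  change g • ℓ = ℓ
  induction ℓ using Projectivization.ind with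
  | h v hv =>
    change (g : C21 ≃ₗ[ℂ] C21) • Projectivization.mk ℂ v hv = _
    rw [Projectivization.smul_mk, Projectivization.mk_eq_mk_iff']
    exact ⟨a, (ha v).symm⟩

/-- The action of `PU(2,1)` on lines. -/
instance : MulAction PU21 P21 :=
  MulAction.compHom P21 (QuotientGroup.lift (Subgroup.center U21)
    (MulAction.toPermHom U21 P21) center_le_ker)

/-! ### Maps from the disc into the projective plane -/

/-- A map from the disc to the projective plane is of class `C^n` if near every point it has a
nowhere zero lift to `ℂ³` of class `C^n` (in the real sense). -/
def IsContDiff (n : WithTop ℕ∞) (φ : 𝔻 → P21) : Prop :=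
  ∀ z : 𝔻, ∃ σ : ℂ → C21, ContDiffAt ℝ n σ (z : ℂ) ∧
    ∀ᶠ w : 𝔻 in 𝓝 z, σ (w : ℂ) ≠ 0 ∧ σ (w : ℂ) ∈ (φ w).submodule

/-- The orthogonal projection `π_ℓ` of `ℂ^{2,1}` onto a line `ℓ` that is not null. -/
def lineProj (ℓ : P21) : C21 →L[ℂ] C21 :=
  LinearMap.toContinuousLinearMap
    ((herm ℓ.rep ℓ.rep)⁻¹ • (hermForm ℓ.rep).smulRight ℓ.rep)

/-- The projections `π_{φ(z)}`, as a function of the complex coordinate of the disc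
(extended by zero outside the disc). -/
def projAlong (φ : 𝔻 → P21) (z : ℂ) : C21 →L[ℂ] C21 :=
  if h : ‖z‖ < 1 then lineProj (φ (Complex.UnitDisc.mk z h)) else 0

/-- The operator `Z = ∂/∂z`. -/
def dZ {E : Type*} [NormedAddCommGroup E] [NormedSpace ℂ E] (F : ℂ → E) (z : ℂ) : E :=
  (1 / 2 : ℂ) • (fderiv ℝ F z 1 - Complex.I • fderiv ℝ F z Complex.I)

/-- The operator `Z̄ = ∂/∂z̄`. -/
def dZbar {E : Type*} [NormedAddCommGroup E] [NormedSpace ℂ E] (F : ℂ → E) (z : ℂ) : E :=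
  (1 / 2 : ℂ) • (fderiv ℝ F z 1 + Complex.I • fderiv ℝ F z Complex.I)

/-- The part of an endomorphism in `T'_ℓ = Hom(ℓ, ℓ^⊥)`, where `P = π_ℓ`. -/
def homPart (P A : C21 →L[ℂ] C21) : C21 →L[ℂ] C21 := (1 - P) * A * P

/-- The part of an endomorphism in `T''_ℓ = Hom(ℓ^⊥, ℓ)`, where `P = π_ℓ`. -/
def homPart' (P A : C21 →L[ℂ] C21) : C21 →L[ℂ] C21 := P * A * (1 - P)

/-- `dφ'(X)` for a real tangent vector `X`. If `σ` is a local section of the line bundle `φ` then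
differentiating `π_φ σ = σ` gives `dφ'(X) σ = π_φ^⊥ (X σ)`. -/
def dPrime (φ : 𝔻 → P21) (z : ℂ) (X : ℂ) : C21 →L[ℂ] C21 :=
  homPart (projAlong φ z) (fderiv ℝ (projAlong φ) z X)

/-- `∂φ'(Z)`; it sends a local section `σ` of `φ` to `π_φ^⊥ (Z σ)`. -/
def delPrime (φ : 𝔻 → P21) (z : ℂ) : C21 →L[ℂ] C21 :=
  homPart (projAlong φ z) (dZ (projAlong φ) z)

/-- `∂̄φ'(Z̄)`; it sends a local section `σ` of `φ` to `π_φ^⊥ (Z̄ σ)`. -/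
def delbarPrime (φ : 𝔻 → P21) (z : ℂ) : C21 →L[ℂ] C21 :=
  homPart (projAlong φ z) (dZbar (projAlong φ) z)

/-- `∂φ''(Z)`; it sends a local section `τ` of `φ^⊥` to `π_φ (Z τ)`, and differentiating
`π_φ τ = 0` gives `π_φ (Z τ) = -(Z π_φ) τ`. -/
def delSecond (φ : 𝔻 → P21) (z : ℂ) : C21 →L[ℂ] C21 :=
  -homPart' (projAlong φ z) (dZ (projAlong φ) z)

/-- The Hermitian metric on `T'_ℓ = Hom(ℓ, ℓ^⊥)`: `h(A, B) = ⟨A σ, B σ⟩` for `σ ∈ ℓ` with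
`⟨σ, σ⟩ = ±1`. It is positive definite on `CH2` and has signature `(1,1)` on `CdS2`. -/
def tangentMetric (ℓ : P21) (A B : C21 →L[ℂ] C21) : ℂ :=
  herm (A ℓ.rep) (B ℓ.rep) / (|(herm ℓ.rep ℓ.rep).re| : ℝ)

/-- `φ` is holomorphic: it is smooth and `dφ` maps `T^{1,0}` into `T'`, i.e. `∂̄φ' = 0`. -/
def IsHolomorphic (φ : 𝔻 → P21) : Prop :=
  IsContDiff ∞ φ ∧ ∀ z : 𝔻, delbarPrime φ z = 0

/-- `φ` is anti-holomorphic: it is smooth and `∂φ' = 0`. -/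
def IsAntiholomorphic (φ : 𝔻 → P21) : Prop :=
  IsContDiff ∞ φ ∧ ∀ z : 𝔻, delPrime φ z = 0

/-! ### Minimal surfaces in the complex hyperbolic plane -/

/-- Branched minimal maps, i.e. smooth weakly conformal harmonic maps. The Levi-Civita connexion
on `T' = Hom(ℓ, ℓ^⊥)` and `T'' = Hom(ℓ^⊥, ℓ)` is the one induced by the orthogonal projections of
the flat connexion: differentiate in `End ℂ³` and project back. -/
structure IsBranchedMinimal (f : 𝔻 → CH2) : Prop where
  smooth : IsContDiff ∞ (fun z => (f z : P21))
  harmonic : ∀ z : 𝔻,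
    homPart (lineProj (f z)) (dZbar (delPrime (fun w => (f w : P21))) z) = 0 ∧
    homPart' (lineProj (f z)) (dZbar (delSecond (fun w => (f w : P21))) z) = 0
  conformal : ∀ z : 𝔻,
    tangentMetric (f z) (delPrime (fun w => (f w : P21)) z)
      (delbarPrime (fun w => (f w : P21)) z) = 0

/-- The coefficient `Q` of the cubic differential `Q dz³`,
`Q = h(∇_Z ∂f'(Z), ∂̄f'(Z̄))`. -/
def cubicQ (f : 𝔻 → CH2) (z : 𝔻) : ℂ :=
  tangentMetric (f z)
    (homPart (lineProj (f z)) (dZ (delPrime (fun w => (f w : P21))) z))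
    (delbarPrime (fun w => (f w : P21)) z)

/-- `φ` is the `∂̄`-Gauss transform of `f`: the continuous family of lines which is the image of
`∂̄f' : ℓ₀ → ℓ₀^⊥` wherever `∂̄f'` does not vanish. -/
def IsDelbarGaussTransform (f : 𝔻 → CH2) (φ : 𝔻 → CdS2) : Prop :=
  IsContDiff 0 (fun z => (φ z : P21)) ∧
  ∀ z : 𝔻, delbarPrime (fun w => (f w : P21)) z ≠ 0 →
    LinearMap.range (delbarPrime (fun w => (f w : P21)) z : C21 →ₗ[ℂ] C21) =
      (φ z : P21).submodule

/-- The induced metric `γ(X, X) = Re h(dφ'(X), dφ'(X))` of a map `φ`. -/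
def inducedMetric (φ : 𝔻 → P21) (z : 𝔻) (X : ℂ) : ℝ :=
  (tangentMetric (φ z) (dPrime φ z X) (dPrime φ z X)).re

/-- A branch point: the differential vanishes. -/
def IsBranchPoint (φ : 𝔻 → P21) (z : 𝔻) : Prop := ∀ X : ℂ, dPrime φ z X = 0

/-- A map into complex de Sitter space is timelike if its branch points are isolated and away
from them the induced metric is negative definite. -/
def IsTimelike (φ : 𝔻 → CdS2) : Prop :=
  (∀ z : 𝔻, ∀ᶠ w in 𝓝[≠] z, ¬ IsBranchPoint (fun w => (φ w : P21)) w) ∧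
  ∀ z : 𝔻, ¬ IsBranchPoint (fun w => (φ w : P21)) z →
    ∀ X : ℂ, X ≠ 0 → inducedMetric (fun w => (φ w : P21)) z X < 0

/-- The order of vanishing at `z`: the supremum of the `n` with `A(w) = O(|w - z|^n)`. -/
def vanishingOrder (A : ℂ → C21 →L[ℂ] C21) (z : ℂ) : ℕ∞ :=
  ⨆ (n : ℕ) (_ : A =O[𝓝 z] fun w => ‖w - z‖ ^ n), (n : ℕ∞)

/-- The multiplicity of `z` in the divisor `D₂` of complex points: the order of `∂f''` at `z`. -/
def complexPointOrder (f : 𝔻 → CH2) (z : 𝔻) : ℕ∞ :=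
  vanishingOrder (delSecond (fun w => (f w : P21))) z

/-- The multiplicity of `z` in the branch divisor of a holomorphic map `φ`: the order at `z` of
its differential `∂φ'`. -/
def branchOrder (φ : 𝔻 → P21) (z : 𝔻) : ℕ∞ := vanishingOrder (delPrime φ) z

/-! ### Fuchsian groups and equivariance -/

/-- `δ` is a Fuchsian representation of the fundamental group of a closed hyperbolic surface:
`Γ` acts on the disc by holomorphic automorphisms, freely, properly discontinuously and
cocompactly, so that `Γ` is the fundamental group of the closed surface `𝔻 / Γ`. -/
structure IsFuchsian {Γ : Type*} [Group Γ] (δ : Γ →* Equiv.Perm 𝔻) : Prop where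
  holomorphic : ∀ γ, ∃ F : ℂ → ℂ, DifferentiableOn ℂ F (Metric.ball 0 1) ∧
    ∀ z : 𝔻, ((δ γ z : 𝔻) : ℂ) = F z
  free : ∀ γ z, δ γ z = z → γ = 1
  properly_discontinuous : ∀ K : Set 𝔻, IsCompact K → {γ | (δ γ '' K ∩ K).Nonempty}.Finite
  cocompact : ∃ K : Set 𝔻, IsCompact K ∧ ∀ z, ∃ γ, δ γ z ∈ K

/-- `φ` intertwines the actions of `Γ` on the disc and, through `ρ`, on the projective plane. -/
def IsEquivariant {Γ : Type*} [Group Γ] (δ : Γ →* Equiv.Perm 𝔻) (ρ : Γ →* PU21)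
    (φ : 𝔻 → P21) : Prop :=
  ∀ γ z, φ (δ γ z) = ρ γ • φ z

end CHMinimal

end

/-! Everything is computed in `End ℂ³`. Let `P`, `R` be the projections onto `f`, `φ₂`, and write `A
= ∂f'(Z)`, `B = ∂̄f'(Z̄)`, `S = ∂f''(Z)`. Harmonicity becomes `∂̄A = [A, ∂̄P]` and `∂̄S = [∂̄P, S]`
(`IsBranchedMinimal.structureEquations`), linear systems of the form `∂̄F = L F`. Since `f` is
neither holomorphic nor anti-holomorphic, `S` and `A` are not identically zero, so their zeros are
isolated, with a leading term `(w - z)^k a` (`exists_leading_of_preconnected`). As `L` is merely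
smooth, this rests on strong unique continuation, obtained from a Carleman inequality for `∂̄`.

`B` is minus the Hermitian adjoint of `S` (`adj_delSecond`). Near a zero it is therefore a power of
`conj (w - z)` times a map with a non-zero limit, and its image line extends continuously; that line
is orthogonal to the negative line `f`, hence positive. Isolated zeros make the extension unique,
and uniqueness makes it equivariant.

Conformality reads `S A = 0`, equivalently `R A = 0` where `B` does not vanish. Where neither `A`
nor `B` vanishes, `f`, `φ₂` and the image of `A` form an orthogonal frame. Differentiating `R A = 0`
along `Z` shows that `Q = 0` is the same as `(ZR) A = 0`; by adjunction, `Z̄R` then has no component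
along the image of `A`. Its component along `f` on `φ₂` vanishes by the adjoint of `R A = 0`, so
`∂̄φ₂' = 0`. The structure equation of `A` gives `(Z̄R) A = 0` in the same way, so only the `f`
component of `∂φ₂'` survives, and it is `S` (`gauss_deriv_of_cubicQ_eq_zero`). A removable
singularity argument carries both identities across the isolated zeros
(`contDiffAt_projAlong_of_punctured`).

From `∂φ₂' = S` the branch divisor is `D₂`, and `φ₂` is timelike because `S` takes values in the
negative line `f`. Conversely, if `φ₂` is holomorphic then `ZR = (ZR) R` kills `A`, whence `Q = 0`.
-/

namespace CHMinimal

open MeasureTheory Filter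

/-! ### Wirtinger calculus -/

section Wirtinger

variable {E F G : Type*} [NormedAddCommGroup E] [NormedSpace ℂ E] [NormedAddCommGroup F]
  [NormedSpace ℂ F] [NormedAddCommGroup G] [NormedSpace ℂ G]

theorem fderiv_eq_dZ_add_dZbar (u : ℂ → E) (z X : ℂ) :
    fderiv ℝ u z X = X • dZ u z + conj X • dZbar u z := by
  have hX : fderiv ℝ u z X
      = (X.re : ℂ) • fderiv ℝ u z 1 + (X.im : ℂ) • fderiv ℝ u z Complex.I := by
    conv_lhs => rw [← Complex.re_add_im X, ← smul_eq_mul, ← mul_one (X.re : ℂ), ← smul_eq_mul]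
    rw [map_add, Complex.coe_smul, Complex.coe_smul, map_smul, map_smul, Complex.coe_smul,
      Complex.coe_smul]
  rw [hX, dZ, dZbar]
  have h1 : conj X = (X.re : ℂ) - X.im * Complex.I := by
    apply Complex.ext <;> simp
  have h2 : X = (X.re : ℂ) + X.im * Complex.I := (Complex.re_add_im X).symm
  rw [h1]
  nth_rw 3 [h2]
  match_scalars
  · ring
  · linear_combination (X.im : ℂ) * Complex.I_mul_I

theorem dZ_congr {u v : ℂ → E} {z : ℂ} (h : u =ᶠ[𝓝 z] v) : dZ u z = dZ v z := by
  simp only [dZ, h.fderiv_eq]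

theorem dZbar_congr {u v : ℂ → E} {z : ℂ} (h : u =ᶠ[𝓝 z] v) : dZbar u z = dZbar v z := by
  simp only [dZbar, h.fderiv_eq]

theorem dZ_eventuallyEq {u v : ℂ → E} {z : ℂ} (h : u =ᶠ[𝓝 z] v) : dZ u =ᶠ[𝓝 z] dZ v :=
  h.eventuallyEq_nhds.mono fun _ hw => dZ_congr hw

theorem dZbar_eventuallyEq {u v : ℂ → E} {z : ℂ} (h : u =ᶠ[𝓝 z] v) :
    dZbar u =ᶠ[𝓝 z] dZbar v :=
  h.eventuallyEq_nhds.mono fun _ hw => dZbar_congr hw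

@[simp] theorem dZ_const (c : E) (z : ℂ) : dZ (fun _ => c) z = 0 := by simp [dZ]

@[simp] theorem dZbar_const (c : E) (z : ℂ) : dZbar (fun _ => c) z = 0 := by simp [dZbar]

theorem dZ_add {u v : ℂ → E} {z : ℂ} (hu : DifferentiableAt ℝ u z)
    (hv : DifferentiableAt ℝ v z) : dZ (fun w => u w + v w) z = dZ u z + dZ v z := by
  simp only [dZ, fderiv_fun_add hu hv, add_apply]
  module

theorem dZbar_add {u v : ℂ → E} {z : ℂ} (hu : DifferentiableAt ℝ u z)
    (hv : DifferentiableAt ℝ v z) : dZbar (fun w => u w + v w) z = dZbar u z + dZbar v z := by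
  simp only [dZbar, fderiv_fun_add hu hv, add_apply]
  module

theorem dZ_sub {u v : ℂ → E} {z : ℂ} (hu : DifferentiableAt ℝ u z)
    (hv : DifferentiableAt ℝ v z) : dZ (fun w => u w - v w) z = dZ u z - dZ v z := by
  simp only [dZ, fderiv_fun_sub hu hv, sub_apply]
  module

theorem dZbar_sub {u v : ℂ → E} {z : ℂ} (hu : DifferentiableAt ℝ u z)
    (hv : DifferentiableAt ℝ v z) : dZbar (fun w => u w - v w) z = dZbar u z - dZbar v z := by
  simp only [dZbar, fderiv_fun_sub hu hv, sub_apply]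
  module

theorem dZbar_clm (L : E →L[ℂ] F) {u : ℂ → E} {z : ℂ} (hu : DifferentiableAt ℝ u z) :
    dZbar (fun w => L (u w)) z = L (dZbar u z) := by
  have : HasFDerivAt (fun w => L (u w)) ((L.restrictScalars ℝ).comp (fderiv ℝ u z)) z :=
    (L.restrictScalars ℝ).hasFDerivAt.comp z hu.hasFDerivAt
  simp [dZbar, this.fderiv]

/-- Moving `i` through a conjugate linear map changes its sign, which exchanges the two Wirtinger
operators. It serves both complex conjugation on `ℂ` and the adjoint `adj` on endomorphisms. -/
theorem dZ_conjLinear (L : E →L[ℝ] F) (hL : ∀ (c : ℂ) x, L (c • x) = conj c • L x)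
    {u : ℂ → E} {z : ℂ} (hu : DifferentiableAt ℝ u z) :
    dZ (fun w => L (u w)) z = L (dZbar u z) := by
  have : HasFDerivAt (fun w => L (u w)) (L.comp (fderiv ℝ u z)) z :=
    L.hasFDerivAt.comp z hu.hasFDerivAt
  simp [dZ, dZbar, this.fderiv, hL, sub_eq_add_neg, map_ofNat]

theorem dZbar_conjLinear (L : E →L[ℝ] F) (hL : ∀ (c : ℂ) x, L (c • x) = conj c • L x)
    {u : ℂ → E} {z : ℂ} (hu : DifferentiableAt ℝ u z) :
    dZbar (fun w => L (u w)) z = L (dZ u z) := by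
  have : HasFDerivAt (fun w => L (u w)) (L.comp (fderiv ℝ u z)) z :=
    L.hasFDerivAt.comp z hu.hasFDerivAt
  simp [dZ, dZbar, this.fderiv, hL, sub_eq_add_neg, map_ofNat]

theorem fderiv_bilin (B : E →L[ℂ] F →L[ℂ] G) {u : ℂ → E} {v : ℂ → F} {z : ℂ}
    (hu : DifferentiableAt ℝ u z) (hv : DifferentiableAt ℝ v z) (X : ℂ) :
    fderiv ℝ (fun w => B (u w) (v w)) z X
      = B (fderiv ℝ u z X) (v z) + B (u z) (fderiv ℝ v z X) := by
  -- `B` is complex bilinear but the derivative is a real one, so its real bilinearity has to be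
  -- extracted.
  have hB : IsBoundedBilinearMap ℝ fun p : E × F => B p.1 p.2 :=
    { add_left := by simp
      smul_left := by
        intro c x y
        rw [← Complex.coe_smul, map_smul, smul_apply, Complex.coe_smul]
      add_right := by simp
      smul_right := by
        intro c x y
        rw [← Complex.coe_smul, map_smul, Complex.coe_smul]
      bound := B.isBoundedBilinearMap.bound }
  have h := (hB.hasFDerivAt (u z, v z)).comp z (hu.hasFDerivAt.prodMk hv.hasFDerivAt)
  have h' : HasFDerivAt (fun w => B (u w) (v w)) _ z := h
  rw [h'.fderiv]
  simp [add_comm]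

theorem dZ_bilin (B : E →L[ℂ] F →L[ℂ] G) {u : ℂ → E} {v : ℂ → F} {z : ℂ}
    (hu : DifferentiableAt ℝ u z) (hv : DifferentiableAt ℝ v z) :
    dZ (fun w => B (u w) (v w)) z = B (dZ u z) (v z) + B (u z) (dZ v z) := by
  simp only [dZ, fderiv_bilin B hu hv, map_smul, map_sub, smul_apply,
    sub_apply]
  module

theorem dZbar_bilin (B : E →L[ℂ] F →L[ℂ] G) {u : ℂ → E} {v : ℂ → F} {z : ℂ}
    (hu : DifferentiableAt ℝ u z) (hv : DifferentiableAt ℝ v z) :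
    dZbar (fun w => B (u w) (v w)) z = B (dZbar u z) (v z) + B (u z) (dZbar v z) := by
  simp only [dZbar, fderiv_bilin B hu hv, map_smul, map_add, smul_apply,
    add_apply]
  module

section Ring

variable {𝔸 : Type*} [NormedRing 𝔸] [NormedAlgebra ℂ 𝔸]

theorem dZ_mul {u v : ℂ → 𝔸} {z : ℂ} (hu : DifferentiableAt ℝ u z)
    (hv : DifferentiableAt ℝ v z) :
    dZ (fun w => u w * v w) z = dZ u z * v z + u z * dZ v z := by
  simpa using dZ_bilin (ContinuousLinearMap.mul ℂ 𝔸) hu hv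

theorem dZbar_mul {u v : ℂ → 𝔸} {z : ℂ} (hu : DifferentiableAt ℝ u z)
    (hv : DifferentiableAt ℝ v z) :
    dZbar (fun w => u w * v w) z = dZbar u z * v z + u z * dZbar v z := by
  simpa using dZbar_bilin (ContinuousLinearMap.mul ℂ 𝔸) hu hv

end Ring

theorem dZbar_smul {c : ℂ → ℂ} {v : ℂ → E} {z : ℂ} (hc : DifferentiableAt ℝ c z)
    (hv : DifferentiableAt ℝ v z) :
    dZbar (fun w => c w • v w) z = dZbar c z • v z + c z • dZbar v z := by
  simpa using dZbar_bilin (ContinuousLinearMap.lsmul ℂ ℂ) hc hv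

theorem dZ_of_hasDerivAt {u : ℂ → E} {u' : E} {z : ℂ} (h : HasDerivAt u u' z) :
    dZ u z = u' := by
  have : HasFDerivAt u _ z := h.hasFDerivAt.restrictScalars ℝ
  simp only [dZ, this.fderiv]
  simp [smul_smul]
  module

theorem dZbar_of_hasDerivAt {u : ℂ → E} {u' : E} {z : ℂ} (h : HasDerivAt u u' z) :
    dZbar u z = 0 := by
  have : HasFDerivAt u _ z := h.hasFDerivAt.restrictScalars ℝ
  simp only [dZbar, this.fderiv]
  simp [smul_smul]

theorem differentiableAt_of_dZbar_eq_zero {u : ℂ → E} {z : ℂ} (hu : DifferentiableAt ℝ u z)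
    (h : dZbar u z = 0) : DifferentiableAt ℂ u z := by
  have h1 : HasFDerivAt u (ContinuousLinearMap.toSpanSingleton ℂ (dZ u z)) z := by
    refine hasFDerivAt_of_restrictScalars ℝ hu.hasFDerivAt ?_
    ext X
    simp [fderiv_eq_dZ_add_dZbar, h]
  exact h1.differentiableAt

/-- The differential of `g` is multiplication by `g'`, so only the conjugate of `g'` meets the `Z̄`
part. It is used to rescale cut-offs and to transport `∂̄f'` under automorphisms of the disc. -/
theorem dZbar_comp_holomorphic {u : ℂ → E} {g : ℂ → ℂ} {g' z : ℂ} (hg : HasDerivAt g g' z)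
    (hu : DifferentiableAt ℝ u (g z)) :
    dZbar (fun w => u (g w)) z = conj g' • dZbar u (g z) := by
  have h := hu.hasFDerivAt.comp z (hg.hasFDerivAt.restrictScalars ℝ)
  have h' : HasFDerivAt (fun w => u (g w)) _ z := h
  simp only [dZbar, h'.fderiv]
  simp only [ContinuousLinearMap.comp_apply, ContinuousLinearMap.coe_restrictScalars',
    ContinuousLinearMap.toSpanSingleton_apply, fderiv_eq_dZ_add_dZbar]
  simp only [smul_eq_mul, map_mul, Complex.conj_I, map_one]
  match_scalars
  · linear_combination ((1 / 2) * (g' - conj g')) * Complex.I_mul_I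
  · ring

theorem contDiffAt_dZ {u : ℂ → E} {z : ℂ} {m n : WithTop ℕ∞} (hu : ContDiffAt ℝ n u z)
    (hmn : m + 1 ≤ n) : ContDiffAt ℝ m (dZ u) z := by
  have h := hu.fderiv_right hmn
  exact ((h.clm_apply contDiffAt_const).sub
    ((h.clm_apply contDiffAt_const).const_smul Complex.I)).const_smul (1 / 2 : ℂ)

theorem contDiffAt_dZbar {u : ℂ → E} {z : ℂ} {m n : WithTop ℕ∞} (hu : ContDiffAt ℝ n u z)
    (hmn : m + 1 ≤ n) : ContDiffAt ℝ m (dZbar u) z := by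
  have h := hu.fderiv_right hmn
  exact ((h.clm_apply contDiffAt_const).add
    ((h.clm_apply contDiffAt_const).const_smul Complex.I)).const_smul (1 / 2 : ℂ)

/-- Both sides are a quarter of the Laplacian, the mixed terms cancelling by symmetry of the second
derivative. -/
theorem dZ_dZbar_comm {u : ℂ → E} {z : ℂ} (hu : ContDiffAt ℝ 2 u z) :
    dZ (dZbar u) z = dZbar (dZ u) z := by
  have hs : IsSymmSndFDerivAt ℝ u z := hu.isSymmSndFDerivAt (by simp)
  have h : DifferentiableAt ℝ (fderiv ℝ u) z :=
    (hu.fderiv_right (m := 1) (by norm_num)).differentiableAt (by norm_num)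
  have e : ∀ a X : ℂ, fderiv ℝ (fun w => fderiv ℝ u w a) z X = fderiv ℝ (fderiv ℝ u) z X a := by
    intro a X
    rw [fderiv_clm_apply h (differentiableAt_const a)]
    simp
  have d : ∀ a : ℂ, DifferentiableAt ℝ (fun w => fderiv ℝ u w a) z := fun a =>
    h.clm_apply (differentiableAt_const a)
  have e1 : ∀ X, fderiv ℝ (dZbar u) z X = (1 / 2 : ℂ) • (fderiv ℝ (fderiv ℝ u) z X 1
      + Complex.I • fderiv ℝ (fderiv ℝ u) z X Complex.I) := by
    intro X
    have : fderiv ℝ (dZbar u) z = _ := fderiv_fun_const_smul (c := (1 / 2 : ℂ))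
      ((d 1).add ((d Complex.I).const_smul Complex.I))
    rw [this, smul_apply]
    have h2 := fderiv_fun_add (d 1) ((d Complex.I).fun_const_smul Complex.I)
    erw [h2]
    rw [add_apply, fderiv_fun_const_smul (d Complex.I),
      smul_apply, e, e]
  have e2 : ∀ X, fderiv ℝ (dZ u) z X = (1 / 2 : ℂ) • (fderiv ℝ (fderiv ℝ u) z X 1
      - Complex.I • fderiv ℝ (fderiv ℝ u) z X Complex.I) := by
    intro X
    have : fderiv ℝ (dZ u) z = _ := fderiv_fun_const_smul (c := (1 / 2 : ℂ))
      ((d 1).sub ((d Complex.I).const_smul Complex.I))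
    rw [this, smul_apply]
    have h2 := fderiv_fun_sub (d 1) ((d Complex.I).fun_const_smul Complex.I)
    erw [h2]
    rw [sub_apply, fderiv_fun_const_smul (d Complex.I),
      smul_apply, e, e]
  rw [dZ, dZbar, e1, e1, e2, e2, hs.eq 1 Complex.I]
  module

end Wirtinger

/-! ### A Carleman inequality for `∂̄` -/

/-- Integration by parts against the constant function `1`. -/
theorem integral_fderiv_eq_zero_of_hasCompactSupport {g : ℂ → ℂ} (hg : ContDiff ℝ 1 g)
    (hc : HasCompactSupport g) (X : ℂ) : ∫ z, fderiv ℝ g z X = 0 := by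
  have hcont : Continuous fun z => fderiv ℝ g z X :=
    (hg.continuous_fderiv one_ne_zero).clm_apply continuous_const
  have hc' : HasCompactSupport fun z => fderiv ℝ g z X := hc.fderiv_apply (𝕜 := ℝ) X
  have h := integral_smul_fderiv_eq_neg_fderiv_smul_of_integrable (𝕜 := ℝ) (μ := volume)
    (f := fun _ : ℂ => (1 : ℝ)) (g := g) (v := X) (by simp)
    (by simpa using hcont.integrable_of_hasCompactSupport hc')
    (by simpa using hg.continuous.integrable_of_hasCompactSupport hc)
    (fun _ _ => differentiableAt_const _)
    (fun z _ => hg.contDiffAt.differentiableAt one_ne_zero)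
  simpa using h

theorem integral_dZ_eq_zero {g : ℂ → ℂ} (hg : ContDiff ℝ 1 g) (hc : HasCompactSupport g) :
    ∫ z, dZ g z = 0 := by
  have hi : ∀ X, Integrable fun z => fderiv ℝ g z X := fun X =>
    ((hg.continuous_fderiv one_ne_zero).clm_apply
      continuous_const).integrable_of_hasCompactSupport (hc.fderiv_apply (𝕜 := ℝ) X)
  simp only [dZ]
  have hI : Integrable fun z => Complex.I • fderiv ℝ g z Complex.I := (hi Complex.I).smul Complex.I
  rw [integral_smul, integral_sub (hi _) hI, integral_smul,
    integral_fderiv_eq_zero_of_hasCompactSupport hg hc,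
    integral_fderiv_eq_zero_of_hasCompactSupport hg hc]
  simp

theorem integral_dZbar_eq_zero {g : ℂ → ℂ} (hg : ContDiff ℝ 1 g) (hc : HasCompactSupport g) :
    ∫ z, dZbar g z = 0 := by
  have hi : ∀ X, Integrable fun z => fderiv ℝ g z X := fun X =>
    ((hg.continuous_fderiv one_ne_zero).clm_apply
      continuous_const).integrable_of_hasCompactSupport (hc.fderiv_apply (𝕜 := ℝ) X)
  simp only [dZbar]
  have hI : Integrable fun z => Complex.I • fderiv ℝ g z Complex.I := (hi Complex.I).smul Complex.I
  rw [integral_smul, integral_add (hi _) hI, integral_smul,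
    integral_fderiv_eq_zero_of_hasCompactSupport hg hc,
    integral_fderiv_eq_zero_of_hasCompactSupport hg hc]
  simp

theorem dZ_conj {u : ℂ → ℂ} {z : ℂ} (hu : DifferentiableAt ℝ u z) :
    dZ (fun w => conj (u w)) z = conj (dZbar u z) :=
  dZ_conjLinear (Complex.conjCLE : ℂ →L[ℝ] ℂ) (by simp) hu

theorem dZbar_conj {u : ℂ → ℂ} {z : ℂ} (hu : DifferentiableAt ℝ u z) :
    dZbar (fun w => conj (u w)) z = conj (dZ u z) :=
  dZbar_conjLinear (Complex.conjCLE : ℂ →L[ℝ] ℂ) (by simp) hu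

theorem dZ_id (z : ℂ) : dZ (fun w => w) z = 1 := dZ_of_hasDerivAt (hasDerivAt_id z)

theorem dZbar_id (z : ℂ) : dZbar (fun w => w) z = 0 := dZbar_of_hasDerivAt (hasDerivAt_id z)

/-- The Gaussian weight `exp (τ |z|²)`. -/
noncomputable def gaussWeight (τ : ℝ) (z : ℂ) : ℂ := Complex.exp (τ * (z * conj z))

theorem gaussWeight_eq (τ : ℝ) (z : ℂ) : gaussWeight τ z = (Real.exp (τ * ‖z‖ ^ 2) : ℝ) := by
  rw [gaussWeight, Complex.mul_conj, Complex.normSq_eq_norm_sq]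
  push_cast
  rfl

theorem contDiff_conj {n : WithTop ℕ∞} : ContDiff ℝ n (fun z : ℂ => conj z) :=
  Complex.conjCLE.contDiff

theorem contDiff_gaussWeight (τ : ℝ) {n : WithTop ℕ∞} : ContDiff ℝ n (gaussWeight τ) :=
  (contDiff_const.mul (contDiff_id.mul contDiff_conj)).cexp

theorem dZ_gaussWeight (τ : ℝ) (z : ℂ) : dZ (gaussWeight τ) z = τ * conj z * gaussWeight τ z := by
  have h1 : HasDerivAt (fun w => Complex.exp w) (Complex.exp (τ * (z * conj z)))
    (τ * (z * conj z)) := Complex.hasDerivAt_exp _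
  have hz : DifferentiableAt ℝ (fun w : ℂ => w) z := differentiableAt_id
  have hcz : DifferentiableAt ℝ (fun w : ℂ => conj w) z :=
    (contDiff_conj (n := 1)).differentiable one_ne_zero z
  have hin : DifferentiableAt ℝ (fun w : ℂ => (τ : ℂ) * (w * conj w)) z :=
    (hz.fun_mul hcz).const_mul _
  have h2 := (h1.hasFDerivAt.restrictScalars ℝ).comp z hin.hasFDerivAt
  have h3 : HasFDerivAt (gaussWeight τ) _ z := h2
  have h4 : dZ (gaussWeight τ) z
      = gaussWeight τ z * dZ (fun w : ℂ => (τ : ℂ) * (w * conj w)) z := by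
    simp [dZ, h3.fderiv, gaussWeight]
    ring
  rw [h4, dZ_mul (differentiableAt_const _) (hz.fun_mul hcz), dZ_mul hz hcz, dZ_conj hz, dZ_id,
    dZbar_id]
  simp
  ring

theorem dZbar_gaussWeight (τ : ℝ) (z : ℂ) :
    dZbar (gaussWeight τ) z = τ * z * gaussWeight τ z := by
  have hW : gaussWeight τ = fun w => conj (gaussWeight τ w) := by
    ext w
    rw [gaussWeight_eq, Complex.conj_ofReal]
  rw [hW, dZbar_conj ((contDiff_gaussWeight τ (n := 1)).differentiable one_ne_zero z),
    dZ_gaussWeight]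
  simp

/-- The pointwise identity behind the Carleman inequality: up to divergences,
`|∂̄u|² W - τ |u|² W` is a square. -/
theorem carleman_identity {u : ℂ → ℂ} (hu : ContDiff ℝ 2 u) (τ : ℝ) (z : ℂ) :
    dZbar (fun w => u w * conj (dZbar u w) * gaussWeight τ w) z
      - dZ (fun w => gaussWeight τ w * u w * conj (dZ u w + τ * conj w * u w)) z
    = dZbar u z * conj (dZbar u z) * gaussWeight τ z
      - (dZ u z + τ * conj z * u z) * conj (dZ u z + τ * conj z * u z) * gaussWeight τ z
      - τ * (u z * conj (u z)) * gaussWeight τ z := by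
  have du : DifferentiableAt ℝ u z := hu.differentiable two_ne_zero z
  have d1 : DifferentiableAt ℝ (dZ u) z :=
    (contDiffAt_dZ hu.contDiffAt (m := 1) (by norm_num)).differentiableAt one_ne_zero
  have d2 : DifferentiableAt ℝ (dZbar u) z :=
    (contDiffAt_dZbar hu.contDiffAt (m := 1) (by norm_num)).differentiableAt one_ne_zero
  have dW : DifferentiableAt ℝ (gaussWeight τ) z :=
    (contDiff_gaussWeight τ (n := 1)).differentiable one_ne_zero z
  have hz : DifferentiableAt ℝ (fun w : ℂ => w) z := differentiableAt_id
  have hcz : DifferentiableAt ℝ (fun w : ℂ => conj w) z :=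
    (contDiff_conj (n := 1)).differentiable one_ne_zero z
  have conjd : ∀ {v : ℂ → ℂ}, DifferentiableAt ℝ v z →
      DifferentiableAt ℝ (fun w => conj (v w)) z := fun hv =>
    (Complex.conjCLE : ℂ →L[ℝ] ℂ).differentiableAt.comp z hv
  have ht : DifferentiableAt ℝ (fun w : ℂ => (τ : ℂ) * conj w) z := hcz.const_mul _
  have e1 : dZbar (fun w => dZ u w + τ * conj w * u w) z
      = dZbar (dZ u) z + τ * (u z + conj z * dZbar u z) := by
    rw [dZbar_add d1 (ht.fun_mul du), dZbar_mul ht du, dZbar_mul (differentiableAt_const _) hcz,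
      dZbar_conj hz, dZ_id]
    simp
    ring
  rw [dZbar_mul (du.fun_mul (conjd d2)) dW, dZbar_mul du (conjd d2), dZbar_conj d2,
    dZ_mul (dW.fun_mul du) (conjd (d1.fun_add (ht.fun_mul du))), dZ_mul dW du,
    dZ_conj (d1.fun_add (ht.fun_mul du)), dZ_gaussWeight, dZbar_gaussWeight, e1,
    dZ_dZbar_comm hu.contDiffAt]
  simp only [map_add, map_mul, Complex.conj_conj, Complex.conj_ofReal]
  ring

/-- Integrate `carleman_identity`: both divergences have compact support and contribute nothing, and
the square `‖∂u + τ z̄ u‖²` is discarded with the favourable sign. The gain `τ` is `∂∂̄` of the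
exponent `τ |z|²`. -/
theorem carleman {u : ℂ → ℂ} (hu : ContDiff ℝ 2 u) (hc : HasCompactSupport u) (τ : ℝ) :
    τ * ∫ z, ‖u z‖ ^ 2 * Real.exp (τ * ‖z‖ ^ 2)
      ≤ ∫ z, ‖dZbar u z‖ ^ 2 * Real.exp (τ * ‖z‖ ^ 2) := by
  have c0 : ContDiff ℝ 1 u := hu.of_le (by norm_num)
  have c1 : ContDiff ℝ 1 (dZ u) := contDiff_iff_contDiffAt.2 fun z =>
    contDiffAt_dZ hu.contDiffAt (by norm_num)
  have c2 : ContDiff ℝ 1 (dZbar u) := contDiff_iff_contDiffAt.2 fun z =>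
    contDiffAt_dZbar hu.contDiffAt (by norm_num)
  have cW : ContDiff ℝ 1 (gaussWeight τ) := contDiff_gaussWeight τ
  have conjc : ∀ {v : ℂ → ℂ}, ContDiff ℝ 1 v → ContDiff ℝ 1 (fun w => conj (v w)) := fun hv =>
    contDiff_conj.comp hv
  have cD : ContDiff ℝ 1 (fun w => dZ u w + τ * conj w * u w) :=
    c1.add ((contDiff_const.mul contDiff_conj).mul c0)
  have g1 : ContDiff ℝ 1 (fun w => u w * conj (dZbar u w) * gaussWeight τ w) :=
    (c0.mul (conjc c2)).mul cW
  have g2 : ContDiff ℝ 1 (fun w => gaussWeight τ w * u w * conj (dZ u w + τ * conj w * u w)) :=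
    (cW.mul c0).mul (conjc cD)
  have s1 : HasCompactSupport (fun w => u w * conj (dZbar u w) * gaussWeight τ w) :=
    hc.mul_right.mul_right
  have s2 : HasCompactSupport
      (fun w => gaussWeight τ w * u w * conj (dZ u w + τ * conj w * u w)) :=
    hc.mul_left.mul_right
  have sZ : HasCompactSupport (dZ u) := by
    refine hc.mono' fun z hz => ?_
    by_contra h
    have : u =ᶠ[𝓝 z] fun _ => 0 := notMem_tsupport_iff_eventuallyEq.1 h
    exact hz (by rw [dZ_congr this, dZ_const])
  have sZb : HasCompactSupport (dZbar u) := by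
    refine hc.mono' fun z hz => ?_
    by_contra h
    have : u =ᶠ[𝓝 z] fun _ => 0 := notMem_tsupport_iff_eventuallyEq.1 h
    exact hz (by rw [dZbar_congr this, dZbar_const])
  have sD : HasCompactSupport (fun w => dZ u w + τ * conj w * u w) := sZ.add hc.mul_left
  have cE : Continuous fun z : ℂ => Real.exp (τ * ‖z‖ ^ 2) := by fun_prop
  have int : ∀ {v : ℂ → ℂ}, Continuous v → HasCompactSupport v →
      Integrable fun z => ‖v z‖ ^ 2 * Real.exp (τ * ‖z‖ ^ 2) := by
    intro v hv hs
    refine ((hv.norm.pow 2).mul cE).integrable_of_hasCompactSupport ?_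
    refine HasCompactSupport.mul_right (hs.mono fun z hz => ?_)
    simpa using hz
  have key : ∀ z, ((‖dZbar u z‖ ^ 2 * Real.exp (τ * ‖z‖ ^ 2)
      - ‖dZ u z + τ * conj z * u z‖ ^ 2 * Real.exp (τ * ‖z‖ ^ 2)
      - τ * (‖u z‖ ^ 2 * Real.exp (τ * ‖z‖ ^ 2)) : ℝ) : ℂ)
      = dZbar (fun w => u w * conj (dZbar u w) * gaussWeight τ w) z
      - dZ (fun w => gaussWeight τ w * u w * conj (dZ u w + τ * conj w * u w)) z := by
    intro z
    rw [carleman_identity hu, Complex.mul_conj, Complex.mul_conj, Complex.mul_conj,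
      Complex.normSq_eq_norm_sq, Complex.normSq_eq_norm_sq, Complex.normSq_eq_norm_sq,
      gaussWeight_eq]
    push_cast
    ring
  have i1 : Integrable (dZbar (fun w => u w * conj (dZbar u w) * gaussWeight τ w)) := by
    refine Continuous.integrable_of_hasCompactSupport
      (contDiff_iff_contDiffAt.2 fun z => contDiffAt_dZbar g1.contDiffAt
        (m := 0) (by norm_num)).continuous (s1.mono' fun z hz => ?_)
    by_contra h
    exact hz (by rw [dZbar_congr (notMem_tsupport_iff_eventuallyEq.1 h)]; exact dZbar_const 0 z)
  have i2 : Integrable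
      (dZ (fun w => gaussWeight τ w * u w * conj (dZ u w + τ * conj w * u w))) := by
    refine Continuous.integrable_of_hasCompactSupport
      (contDiff_iff_contDiffAt.2 fun z => contDiffAt_dZ g2.contDiffAt
        (m := 0) (by norm_num)).continuous (s2.mono' fun z hz => ?_)
    by_contra h
    exact hz (by rw [dZ_congr (notMem_tsupport_iff_eventuallyEq.1 h)]; exact dZ_const 0 z)
  have h0 : ∫ z, (‖dZbar u z‖ ^ 2 * Real.exp (τ * ‖z‖ ^ 2)
      - ‖dZ u z + τ * conj z * u z‖ ^ 2 * Real.exp (τ * ‖z‖ ^ 2)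
      - τ * (‖u z‖ ^ 2 * Real.exp (τ * ‖z‖ ^ 2))) = 0 := by
    rw [← Complex.ofReal_eq_zero, ← integral_complex_ofReal]
    simp_rw [key]
    rw [integral_sub i1 i2, integral_dZ_eq_zero g2 s2, integral_dZbar_eq_zero g1 s1, sub_zero]
  have j1 := int c2.continuous sZb
  have j2 := int cD.continuous sD
  have j3 := (int c0.continuous hc).const_mul τ
  have j12 : Integrable fun z => ‖dZbar u z‖ ^ 2 * Real.exp (τ * ‖z‖ ^ 2)
      - ‖dZ u z + τ * conj z * u z‖ ^ 2 * Real.exp (τ * ‖z‖ ^ 2) := j1.sub j2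
  rw [integral_sub j12 j3, integral_sub j1 j2, integral_const_mul] at h0
  have : 0 ≤ ∫ z, ‖dZ u z + τ * conj z * u z‖ ^ 2 * Real.exp (τ * ‖z‖ ^ 2) :=
    integral_nonneg fun z => by positivity
  linarith

/-! ### Strong unique continuation -/

theorem dZbar_eq_zero_of_notMem_tsupport {E : Type*} [NormedAddCommGroup E] [NormedSpace ℂ E]
    {u : ℂ → E} {z : ℂ} (h : z ∉ tsupport u) : dZbar u z = 0 := by
  have : u =ᶠ[𝓝 z] fun _ => 0 := notMem_tsupport_iff_eventuallyEq.1 h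
  rw [dZbar_congr this, dZbar_const]

theorem hasCompactSupport_dZbar {u : ℂ → ℂ} (h : HasCompactSupport u) :
    HasCompactSupport (dZbar u) :=
  h.mono' fun _ hz => by_contra fun h' => hz (dZbar_eq_zero_of_notMem_tsupport h')

/-- The Carleman inequality applied to a cut-off of a solution of `|∂̄F|² ≤ C |F|²`. -/
theorem carleman_multiplier {ι : Type*} [Fintype ι] {F : ι → ℂ → ℂ} {U : Set ℂ} {C : ℝ}
    (hF : ∀ i, ∀ z ∈ U, ContDiffAt ℝ 2 (F i) z)
    (hC : ∀ z ∈ U, ∑ i, ‖dZbar (F i) z‖ ^ 2 ≤ C * ∑ i, ‖F i z‖ ^ 2)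
    {q : ℂ → ℂ} (hq : ContDiff ℝ 2 q) (hqc : HasCompactSupport q) (hqU : tsupport q ⊆ U) :
    Integrable (fun z => ‖q z‖ ^ 2 * (∑ i, ‖F i z‖ ^ 2) * Real.exp ((2 * C + 1) * ‖z‖ ^ 2)) ∧
    Integrable (fun z => 2 * (‖dZbar q z‖ ^ 2 * (∑ i, ‖F i z‖ ^ 2))
        * Real.exp ((2 * C + 1) * ‖z‖ ^ 2)) ∧
    ∫ z, ‖q z‖ ^ 2 * (∑ i, ‖F i z‖ ^ 2) * Real.exp ((2 * C + 1) * ‖z‖ ^ 2)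
      ≤ ∫ z, 2 * (‖dZbar q z‖ ^ 2 * (∑ i, ‖F i z‖ ^ 2))
        * Real.exp ((2 * C + 1) * ‖z‖ ^ 2) := by
  set W : ℂ → ℝ := fun z => Real.exp ((2 * C + 1) * ‖z‖ ^ 2) with hW
  have cW : Continuous W := by fun_prop
  set u : ι → ℂ → ℂ := fun i z => q z * F i z with hu
  have cu : ∀ i, ContDiff ℝ 2 (u i) := by
    intro i
    refine contDiff_iff_contDiffAt.2 fun z => ?_
    by_cases hz : z ∈ tsupport q
    · exact hq.contDiffAt.mul (hF i z (hqU hz))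
    · have : u i =ᶠ[𝓝 z] fun _ => 0 := by
        filter_upwards [notMem_tsupport_iff_eventuallyEq.1 hz] with w hw
        simp [hu, hw]
      exact contDiffAt_const.congr_of_eventuallyEq this
  have su : ∀ i, HasCompactSupport (u i) := fun i => hqc.mul_right
  have du : ∀ i z, dZbar (u i) z = dZbar q z * F i z + q z * dZbar (F i) z := by
    intro i z
    by_cases hz : z ∈ tsupport q
    · exact dZbar_mul (hq.differentiable two_ne_zero z)
        ((hF i z (hqU hz)).differentiableAt two_ne_zero)
    · have h1 : u i =ᶠ[𝓝 z] fun _ => 0 := by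
        filter_upwards [notMem_tsupport_iff_eventuallyEq.1 hz] with w hw
        simp [hu, hw]
      rw [dZbar_congr h1, dZbar_const, dZbar_eq_zero_of_notMem_tsupport hz,
        image_eq_zero_of_notMem_tsupport hz]
      simp
  have cdu : ∀ i, Continuous (dZbar (u i)) := fun i =>
    (contDiff_iff_contDiffAt.2 fun z => contDiffAt_dZbar (m := 1) (cu i).contDiffAt
      (by norm_num)).continuous
  have cdq : Continuous (dZbar q) :=
    (contDiff_iff_contDiffAt.2 fun z => contDiffAt_dZbar (m := 1) hq.contDiffAt
      (by norm_num)).continuous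
  have int : ∀ {v : ℂ → ℂ}, Continuous v → HasCompactSupport v →
      Integrable fun z => ‖v z‖ ^ 2 * W z := by
    intro v hv hs
    refine ((hv.norm.pow 2).mul cW).integrable_of_hasCompactSupport ?_
    exact HasCompactSupport.mul_right (hs.mono fun z hz => by simpa using hz)
  have sdq := hasCompactSupport_dZbar hqc
  have cdqF : ∀ i, Continuous fun z => dZbar q z * F i z := by
    intro i
    refine continuous_iff_continuousAt.2 fun z => ?_
    by_cases hz : z ∈ tsupport q
    · exact cdq.continuousAt.mul (hF i z (hqU hz)).continuousAt
    · have : (fun z => dZbar q z * F i z) =ᶠ[𝓝 z] fun _ => 0 := by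
        have h := dZbar_eventuallyEq (notMem_tsupport_iff_eventuallyEq.1 hz)
        filter_upwards [h] with w hw
        rw [hw]
        simp [show (0 : ℂ → ℂ) = fun _ => 0 from rfl]
      exact continuousAt_const.congr this.symm
  -- The parameter is `τ = 2C + 1`: the equation contributes `2C ∑ ‖u i‖² W` on the right, and after
  -- absorbing it exactly one copy of `∑ ‖u i‖² W` is left.
  have car : ∑ i, (2 * C + 1) * ∫ z, ‖u i z‖ ^ 2 * W z
      ≤ ∑ i, ∫ z, ‖dZbar (u i) z‖ ^ 2 * W z :=
    Finset.sum_le_sum fun i _ => carleman (cu i) (su i) _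
  have iu := fun i => int (cu i).continuous (su i)
  have idu := fun i => int (cdu i) (hasCompactSupport_dZbar (su i))
  have iqF := fun i => int (cdqF i) (sdq.mul_right)
  rw [← Finset.mul_sum, ← integral_finsetSum _ fun i _ => iu i,
    ← integral_finsetSum _ fun i _ => idu i] at car
  have e1 : ∀ z, ‖q z‖ ^ 2 * (∑ i, ‖F i z‖ ^ 2) * W z = ∑ i, ‖u i z‖ ^ 2 * W z := by
    intro z
    simp only [hu, norm_mul, mul_pow, Finset.mul_sum, Finset.sum_mul]
  have e2 : ∀ z, 2 * (‖dZbar q z‖ ^ 2 * (∑ i, ‖F i z‖ ^ 2)) * W z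
      = 2 * ∑ i, ‖dZbar q z * F i z‖ ^ 2 * W z := by
    intro z
    simp only [norm_mul, mul_pow, Finset.mul_sum, Finset.sum_mul]
    exact Finset.sum_congr rfl fun i _ => by ring
  -- By Leibniz `∂̄(qF) = (∂̄q) F + q ∂̄F`; use `(a + b)² ≤ 2a² + 2b²` and bound the second term by
  -- the differential inequality.
  have hle : ∀ z, ∑ i, ‖dZbar (u i) z‖ ^ 2 * W z
      ≤ 2 * (∑ i, ‖dZbar q z * F i z‖ ^ 2 * W z) + 2 * C * ∑ i, ‖u i z‖ ^ 2 * W z := by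
    intro z
    have hWz : 0 ≤ W z := (Real.exp_pos _).le
    rw [← Finset.sum_mul, ← Finset.sum_mul, ← Finset.sum_mul]
    have h1 : ∀ i, ‖dZbar (u i) z‖ ^ 2
        ≤ 2 * ‖dZbar q z * F i z‖ ^ 2 + 2 * (‖q z‖ ^ 2 * ‖dZbar (F i) z‖ ^ 2) := by
      intro i
      rw [du, ← mul_pow, ← norm_mul]
      have := norm_add_le (dZbar q z * F i z) (q z * dZbar (F i) z)
      have h2 := pow_le_pow_left₀ (norm_nonneg _) this 2
      nlinarith [sq_nonneg (‖dZbar q z * F i z‖ - ‖q z * dZbar (F i) z‖)]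
    have h2 : ‖q z‖ ^ 2 * ∑ i, ‖dZbar (F i) z‖ ^ 2 ≤ C * ∑ i, ‖u i z‖ ^ 2 := by
      simp only [hu, norm_mul, mul_pow, ← Finset.mul_sum]
      by_cases hz : z ∈ tsupport q
      · have := mul_le_mul_of_nonneg_left (hC z (hqU hz)) (sq_nonneg ‖q z‖)
        linarith
      · simp [image_eq_zero_of_notMem_tsupport hz]
    have h3 := Finset.sum_le_sum fun i (_ : i ∈ Finset.univ) => h1 i
    rw [Finset.sum_add_distrib, ← Finset.mul_sum, ← Finset.mul_sum, ← Finset.mul_sum] at h3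
    have h4 : ∑ i, ‖dZbar (u i) z‖ ^ 2
        ≤ 2 * ∑ i, ‖dZbar q z * F i z‖ ^ 2 + 2 * (C * ∑ i, ‖u i z‖ ^ 2) := by linarith
    have h5 := mul_le_mul_of_nonneg_right h4 hWz
    linarith
  have Iu : Integrable fun z => ∑ i, ‖u i z‖ ^ 2 * W z := integrable_finsetSum _ fun i _ => iu i
  have Iq : Integrable fun z => ∑ i, ‖dZbar q z * F i z‖ ^ 2 * W z :=
    integrable_finsetSum _ fun i _ => iqF i
  have Idu : Integrable fun z => ∑ i, ‖dZbar (u i) z‖ ^ 2 * W z :=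
    integrable_finsetSum _ fun i _ => idu i
  have h6 := integral_mono Idu ((Iq.const_mul 2).add (Iu.const_mul (2 * C))) hle
  have h7 : ∫ z, (2 * (∑ i, ‖dZbar q z * F i z‖ ^ 2 * W z)
      + 2 * C * ∑ i, ‖u i z‖ ^ 2 * W z)
      = 2 * (∫ z, ∑ i, ‖dZbar q z * F i z‖ ^ 2 * W z)
        + 2 * C * ∫ z, ∑ i, ‖u i z‖ ^ 2 * W z := by
    rw [integral_add (Iq.const_mul 2) (Iu.const_mul (2 * C)), integral_const_mul,
      integral_const_mul]
  have h8 := h6.trans_eq h7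
  refine ⟨Iu.congr (.of_forall fun z => (e1 z).symm),
    (Iq.const_mul 2).congr (.of_forall fun z => (e2 z).symm), ?_⟩
  refine (integral_congr_ae (.of_forall e1)).le.trans
    (le_trans ?_ (integral_congr_ae (.of_forall e2)).ge)
  rw [integral_const_mul]
  linarith

/-- A cut-off of `(w - z₀)⁻ⁿ`, vanishing near `z₀` and away from `z₀`. -/
theorem exists_singular_multiplier (z₀ : ℂ) {R : ℝ} (hR : 0 < R) :
    ∃ K : ℝ, 0 ≤ K ∧ ∀ (n : ℕ) (ε : ℝ), 0 < ε → ε < R / 4 → ∃ q : ℂ → ℂ, ContDiff ℝ 2 q ∧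
      tsupport q ⊆ Metric.closedBall z₀ R ∧
      (∀ w, 2 * ε ≤ ‖w - z₀‖ → ‖w - z₀‖ ≤ R / 2 → ‖q w‖ = (‖w - z₀‖⁻¹) ^ n) ∧
      (∀ w, ‖w - z₀‖ ≤ 2 * ε → ‖dZbar q w‖ ≤ K / ε * (‖w - z₀‖⁻¹) ^ n) ∧
      (∀ w, 2 * ε < ‖w - z₀‖ → ‖dZbar q w‖ ≤ K * (2 / R) ^ n) := by
  -- `χ` is the outer cut-off, `1` within `R / 2` and `0` beyond `R`. `β`, rescaled by `ε⁻¹` around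
  -- `z₀`, removes the pole: it is `1` within `ε` and `0` beyond `2ε`.
  let χ : ContDiffBump z₀ := ⟨R / 2, R, by positivity, by linarith⟩
  let β : ContDiffBump (0 : ℂ) := ⟨1, 2, by positivity, by norm_num⟩
  have χc : ContDiff ℝ 2 (fun z => (χ z : ℂ)) := Complex.ofRealCLM.contDiff.comp χ.contDiff
  have βc : ContDiff ℝ 2 (fun z => (β z : ℂ)) := Complex.ofRealCLM.contDiff.comp β.contDiff
  have bdd : ∀ {v : ℂ → ℂ}, ContDiff ℝ 2 v → HasCompactSupport v → ∃ K, ∀ z, ‖dZbar v z‖ ≤ K :=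
    fun hv hs => (hasCompactSupport_dZbar hs).exists_bound_of_continuous
      (contDiff_iff_contDiffAt.2 fun z => contDiffAt_dZbar (m := 1) hv.contDiffAt
        (by norm_num)).continuous
  obtain ⟨K₁, hK₁⟩ := bdd χc (χ.hasCompactSupport.comp_left Complex.ofReal_zero)
  obtain ⟨K₂, hK₂⟩ := bdd βc (β.hasCompactSupport.comp_left Complex.ofReal_zero)
  have hK₁' : 0 ≤ K₁ := (norm_nonneg _).trans (hK₁ 0)
  have hK₂' : 0 ≤ K₂ := (norm_nonneg _).trans (hK₂ 0)
  refine ⟨K₁ + K₂, by positivity, fun n ε hε hεR => ?_⟩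
  set b : ℂ → ℂ := fun w => (β ((w - z₀) * (ε : ℂ)⁻¹) : ℂ) with hb
  have hnorm : ∀ w, ‖(w - z₀) * (ε : ℂ)⁻¹‖ = ‖w - z₀‖ / ε := by
    intro w
    rw [norm_mul, norm_inv, Complex.norm_real, Real.norm_of_nonneg hε.le, div_eq_mul_inv]
  have hin : ∀ w, HasDerivAt (fun w : ℂ => (w - z₀) * (ε : ℂ)⁻¹) (ε : ℂ)⁻¹ w := by
    intro w
    simpa using ((hasDerivAt_id w).sub_const z₀).mul_const (ε : ℂ)⁻¹
  have bc : ContDiff ℝ 2 b := βc.comp ((contDiff_id.sub contDiff_const).mul contDiff_const)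
  have db : ∀ w, ‖dZbar b w‖ ≤ K₂ / ε := by
    intro w
    have := dZbar_comp_holomorphic (hin w) (βc.differentiable two_ne_zero _)
    rw [hb, this, norm_smul, Complex.norm_conj, norm_inv, Complex.norm_real,
      Real.norm_of_nonneg hε.le, inv_mul_eq_div]
    gcongr
    exact hK₂ _
  set ψ : ℂ → ℂ := fun w => (χ w : ℂ) - b w with hψ
  have ψc : ContDiff ℝ 2 ψ := χc.sub bc
  have dψ : ∀ w, dZbar ψ w = dZbar (fun z => (χ z : ℂ)) w - dZbar b w := fun w =>
    dZbar_sub (χc.differentiable two_ne_zero w) (bc.differentiable two_ne_zero w)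
  have χ1 : ∀ w, ‖w - z₀‖ < R / 2 → (fun z => (χ z : ℂ)) =ᶠ[𝓝 w] fun _ => 1 := by
    intro w hw
    have : w ∈ Metric.ball z₀ (R / 2) := by rwa [mem_ball_iff_norm]
    filter_upwards [χ.eventuallyEq_one_of_mem_ball this] with x hx
    simp [hx]
  have b1 : ∀ w, ‖w - z₀‖ < ε → b w = 1 := by
    intro w hw
    have : β ((w - z₀) * (ε : ℂ)⁻¹) = 1 := by
      refine β.one_of_mem_closedBall ?_
      rw [mem_closedBall_zero_iff, hnorm]
      exact ((div_lt_one hε).2 hw).le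
    simp [hb, this]
  have b0 : ∀ w, 2 * ε ≤ ‖w - z₀‖ → b w = 0 := by
    intro w hw
    have : β ((w - z₀) * (ε : ℂ)⁻¹) = 0 := by
      refine β.zero_of_le_dist ?_
      rw [dist_zero_right, hnorm]
      exact (le_div_iff₀ hε).2 hw
    simp [hb, this]
  have ψ0 : ψ =ᶠ[𝓝 z₀] fun _ => 0 := by
    filter_upwards [χ1 z₀ (by simpa using hR), Metric.ball_mem_nhds z₀ hε] with w hw hw'
    rw [mem_ball_iff_norm] at hw'
    simp only [hψ, b1 w hw']
    rw [hw]
    simp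
  set q : ℂ → ℂ := fun w => ψ w * ((w - z₀)⁻¹) ^ n with hq
  have mc : ∀ w, w ≠ z₀ → HasDerivAt (fun w : ℂ => ((w - z₀)⁻¹) ^ n)
      (deriv (fun w : ℂ => ((w - z₀)⁻¹) ^ n) w) w := by
    intro w hw
    have : w - z₀ ≠ 0 := sub_ne_zero.2 hw
    exact DifferentiableAt.hasDerivAt (by fun_prop (disch := assumption))
  have q0 : q =ᶠ[𝓝 z₀] fun _ => 0 := by
    filter_upwards [ψ0] with w hw
    simp [hq, hw]
  -- Off `z₀` the power is holomorphic, so `∂̄` falls on the cut-off alone; near `z₀` both sides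
  -- vanish.
  have dq : ∀ w, dZbar q w = dZbar ψ w * ((w - z₀)⁻¹) ^ n := by
    intro w
    by_cases hw : w = z₀
    · rw [hw, dZbar_congr q0, dZbar_congr ψ0]
      simp
    · rw [hq, dZbar_mul (ψc.differentiable two_ne_zero w)
        ((mc w hw).differentiableAt.restrictScalars ℝ), dZbar_of_hasDerivAt (mc w hw)]
      simp
  refine ⟨q, ?_, ?_, ?_, ?_, ?_⟩
  · refine contDiff_iff_contDiffAt.2 fun w => ?_
    by_cases hw : w = z₀
    · rw [hw]
      exact contDiffAt_const.congr_of_eventuallyEq q0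
    · exact ψc.contDiffAt.mul
        (((contDiffAt_id.sub contDiffAt_const).inv (sub_ne_zero.2 hw)).pow n)
  · refine closure_minimal (fun w hw => ?_) Metric.isClosed_closedBall
    by_contra h
    rw [mem_closedBall_iff_norm, not_le] at h
    apply hw
    have : χ w = 0 := χ.zero_of_le_dist (by rw [dist_eq_norm]; exact h.le)
    simp [hq, hψ, this, b0 w (by linarith)]
  · intro w h1 h2
    have : χ w = 1 := χ.one_of_mem_closedBall (by rwa [mem_closedBall_iff_norm])
    simp [hq, hψ, this, b0 w h1]
  · intro w hw
    rw [dq, norm_mul, norm_pow, norm_inv]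
    gcongr
    rw [dψ, dZbar_congr (χ1 w (by linarith)), dZbar_const, zero_sub, norm_neg]
    refine (db w).trans ?_
    gcongr
    linarith
  · intro w hw
    have hb0 : b =ᶠ[𝓝 w] fun _ => 0 := by
      have : ∀ᶠ x in 𝓝 w, 2 * ε < ‖x - z₀‖ :=
        (continuous_id.sub continuous_const).norm.continuousAt.eventually
          (lt_mem_nhds hw)
      filter_upwards [this] with x hx using b0 x hx.le
    rw [dq, dψ, dZbar_congr hb0, dZbar_const, sub_zero, norm_mul, norm_pow, norm_inv]
    by_cases hw2 : ‖w - z₀‖ < R / 2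
    · rw [dZbar_congr (χ1 w hw2), dZbar_const]
      simp
      positivity
    · rw [not_lt] at hw2
      have : ‖w - z₀‖⁻¹ ≤ 2 / R := by
        rw [← inv_div]
        exact inv_anti₀ (by positivity) hw2
      gcongr
      exact (hK₁ w).trans (by linarith)

/-- Test the Carleman estimate on `F` times a cut-off of `(w - z₀)⁻ⁿ`. The inner cut-off is harmless
because `F` is flat at `z₀`, and the outer one lives where `|w - z₀| ≥ R / 2`, so the right side is
`O((2/R)^(2n))`. If `F z₁ ≠ 0` with `|z₁ - z₀| < R / 4`, the left side is at least a positive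
constant times `(4/R)^(2n)`, which is impossible for large `n`. -/
theorem eq_zero_of_dZbar_le_of_flat_family {ι : Type*} [Fintype ι] {F : ι → ℂ → ℂ} {z₀ : ℂ}
    {R R' C : ℝ} (hR : 0 < R) (hRR' : R < R') (hC0 : 0 ≤ C)
    (hF : ∀ i, ∀ z ∈ Metric.ball z₀ R', ContDiffAt ℝ 2 (F i) z)
    (hC : ∀ z ∈ Metric.ball z₀ R', ∑ i, ‖dZbar (F i) z‖ ^ 2 ≤ C * ∑ i, ‖F i z‖ ^ 2)
    (hflat : ∀ i (k : ℕ), F i =O[𝓝 z₀] fun w => ‖w - z₀‖ ^ k) {z₁ : ℂ} (hz₁ : z₁ ≠ z₀)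
    (hz₁R : ‖z₁ - z₀‖ < R / 4) : ∑ i, ‖F i z₁‖ ^ 2 = 0 := by
  set N : ℂ → ℝ := fun z => ∑ i, ‖F i z‖ ^ 2 with hN
  have N0 : ∀ z, 0 ≤ N z := fun z => Finset.sum_nonneg fun i _ => sq_nonneg _
  have Nc : ∀ z ∈ Metric.ball z₀ R', ContinuousAt N z := fun z hz =>
    tendsto_finsetSum _ fun i _ => ((hF i z hz).continuousAt.norm.pow 2)
  have Nflat : ∀ k : ℕ, N =O[𝓝 z₀] fun w => ‖w - z₀‖ ^ (k + k) := by
    intro k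
    refine Asymptotics.IsBigO.fun_sum fun i _ => ?_
    have := ((hflat i k).norm_left.mul (hflat i k).norm_left)
    simpa only [← pow_two, pow_add] using this
  by_contra hne
  have hpos : 0 < N z₁ := lt_of_le_of_ne (N0 _) (Ne.symm hne)
  set d := ‖z₁ - z₀‖ / 2 with hd
  have hz₁' : 0 < ‖z₁ - z₀‖ := norm_pos_iff.2 (sub_ne_zero.2 hz₁)
  have hsub : Continuous fun w : ℂ => ‖w - z₀‖ := by fun_prop
  have hnear : ∀ᶠ w in 𝓝 z₁, N z₁ / 2 < N w ∧ ‖w - z₀‖ < R / 4 ∧ d < ‖w - z₀‖ := by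
    refine ((Nc z₁ ?_).eventually (lt_mem_nhds (by linarith))).and
      ((hsub.continuousAt.eventually (gt_mem_nhds hz₁R)).and
        (hsub.continuousAt.eventually (lt_mem_nhds (by rw [hd]; linarith))))
    rw [mem_ball_iff_norm]
    linarith
  obtain ⟨ρ, hρ, hV⟩ := Metric.eventually_nhds_iff_ball.1 hnear
  obtain ⟨M, hM⟩ := (isCompact_closedBall z₀ R).exists_bound_of_continuousOn
    (f := N) fun z hz => (Nc z (Metric.closedBall_subset_ball hRR' hz)).continuousWithinAt
  have hM0 : 0 ≤ M := (norm_nonneg _).trans (hM z₀ (Metric.mem_closedBall_self hR.le))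
  obtain ⟨K, hK0, hK⟩ := exists_singular_multiplier z₀ hR
  set W : ℂ → ℝ := fun z => Real.exp ((2 * C + 1) * ‖z‖ ^ 2) with hW
  set Wm : ℝ := Real.exp ((2 * C + 1) * (‖z₀‖ + R) ^ 2) with hWm
  have W1 : ∀ z, 1 ≤ W z := fun z => Real.one_le_exp (by positivity)
  have WWm : ∀ z ∈ Metric.closedBall z₀ R, W z ≤ Wm := by
    intro z hz
    rw [mem_closedBall_iff_norm] at hz
    have : ‖z‖ ≤ ‖z₀‖ + R := by
      have := norm_add_le z₀ (z - z₀)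
      rw [add_sub_cancel] at this
      linarith
    simp only [hW, hWm]
    gcongr
  have main : ∀ n : ℕ, N z₁ / 2 * (4 / R) ^ (n + n) * volume.real (Metric.ball z₁ ρ)
      ≤ 2 * ((K ^ 2 * M + 1) * (2 / R) ^ (n + n)) * Wm
        * volume.real (Metric.closedBall z₀ R) := by
    intro n
    -- Flatness to order `2(n + 2)` cancels the pole `‖w - z₀‖^(-2n)` and leaves a fourth power,
    -- which beats the factor `ε⁻²` from the derivative of the inner cut-off: the inner contribution
    -- is at most `(K/ε)² A (2ε)⁴ = 16 K² A ε²`.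
    obtain ⟨A, hA0, hA⟩ := (Nflat (n + 2)).exists_pos
    obtain ⟨r, hr, hAr⟩ := Metric.eventually_nhds_iff_ball.1 hA.bound
    have hev : ∀ᶠ ε in 𝓝[>] (0 : ℝ), 16 * K ^ 2 * A * ε ^ 2 < (2 / R) ^ (n + n) ∧
        ε < R / 4 ∧ ε < d / 2 ∧ ε < r / 2 ∧ 0 < ε := by
      have c : Continuous fun ε : ℝ => 16 * K ^ 2 * A * ε ^ 2 := by fun_prop
      have h1 : ∀ᶠ ε in 𝓝 (0 : ℝ), 16 * K ^ 2 * A * ε ^ 2 < (2 / R) ^ (n + n) :=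
        c.continuousAt.eventually (gt_mem_nhds (by simp; positivity))
      filter_upwards [nhdsWithin_le_nhds h1,
        nhdsWithin_le_nhds (gt_mem_nhds (show 0 < R / 4 by positivity)),
        nhdsWithin_le_nhds (gt_mem_nhds (show 0 < d / 2 by positivity)),
        nhdsWithin_le_nhds (gt_mem_nhds (show 0 < r / 2 by positivity)),
        self_mem_nhdsWithin] with ε a b c d e using ⟨a, b, c, d, e⟩
    obtain ⟨ε, hε1, hεR, hεd, hεr, hε⟩ := hev.exists
    obtain ⟨q, qc, qs, q1, q2, q3⟩ := hK n ε hε hεR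
    obtain ⟨I1, I2, hle⟩ := carleman_multiplier hF hC qc
      ((isCompact_closedBall z₀ R).of_isClosed_subset (isClosed_tsupport _) qs)
      (qs.trans (Metric.closedBall_subset_ball hRR'))
    have lower : N z₁ / 2 * (4 / R) ^ (n + n) * volume.real (Metric.ball z₁ ρ)
        ≤ ∫ z, ‖q z‖ ^ 2 * N z * W z := by
      calc N z₁ / 2 * (4 / R) ^ (n + n) * volume.real (Metric.ball z₁ ρ)
          = ∫ z in Metric.ball z₁ ρ, N z₁ / 2 * (4 / R) ^ (n + n) := by
            rw [setIntegral_const, smul_eq_mul, mul_comm]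
        _ ≤ ∫ z in Metric.ball z₁ ρ, ‖q z‖ ^ 2 * N z * W z := by
            refine setIntegral_mono_on (integrableOn_const measure_ball_lt_top.ne) I1.integrableOn
              measurableSet_ball fun z hz => ?_
            obtain ⟨a1, a2, a3⟩ := hV z hz
            rw [q1 z (by linarith) (by linarith)]
            have hpos' : 0 < ‖z - z₀‖ := lt_trans (by positivity) a3
            have h4 : 4 / R ≤ ‖z - z₀‖⁻¹ := by
              rw [← inv_div]
              exact inv_anti₀ hpos' a2.le
            calc N z₁ / 2 * (4 / R) ^ (n + n) = (4 / R) ^ (n + n) * (N z₁ / 2) * 1 := by ring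
              _ ≤ ((‖z - z₀‖⁻¹) ^ n) ^ 2 * N z * W z := by
                  rw [← pow_mul, mul_two]
                  have := N0 z
                  gcongr
                  exact W1 z
        _ ≤ ∫ z, ‖q z‖ ^ 2 * N z * W z := by
            refine setIntegral_le_integral I1 (.of_forall fun z => ?_)
            have := N0 z
            have := (W1 z).trans' zero_le_one
            positivity
    have upper : ∫ z, 2 * (‖dZbar q z‖ ^ 2 * N z) * W z
        ≤ 2 * ((K ^ 2 * M + 1) * (2 / R) ^ (n + n)) * Wm
          * volume.real (Metric.closedBall z₀ R) := by
      have e : ∫ z, 2 * (‖dZbar q z‖ ^ 2 * N z) * W z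
          = ∫ z in Metric.closedBall z₀ R, 2 * (‖dZbar q z‖ ^ 2 * N z) * W z := by
        refine (setIntegral_eq_integral_of_forall_compl_eq_zero fun z hz => ?_).symm
        rw [dZbar_eq_zero_of_notMem_tsupport fun h => hz (qs h)]
        simp
      have e2 : 2 * ((K ^ 2 * M + 1) * (2 / R) ^ (n + n)) * Wm
          * volume.real (Metric.closedBall z₀ R)
          = ∫ z in Metric.closedBall z₀ R,
            2 * ((K ^ 2 * M + 1) * (2 / R) ^ (n + n)) * Wm := by
        rw [setIntegral_const, smul_eq_mul, mul_comm]
      rw [e, e2]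
      refine setIntegral_mono_on I2.integrableOn (integrableOn_const measure_closedBall_lt_top.ne)
        measurableSet_closedBall fun z hz => ?_
      have hWz := WWm z hz
      have hW0 : 0 ≤ W z := (W1 z).trans' zero_le_one
      have hb : ‖dZbar q z‖ ^ 2 * N z ≤ (K ^ 2 * M + 1) * (2 / R) ^ (n + n) := by
        have hp : 0 ≤ (2 / R) ^ (n + n) := by positivity
        by_cases hz2 : ‖z - z₀‖ ≤ 2 * ε
        · have hNz : N z ≤ A * ‖z - z₀‖ ^ (n + 2 + (n + 2)) := by
            have := hAr z (by rw [mem_ball_iff_norm]; linarith)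
            rwa [Real.norm_of_nonneg (N0 z), Real.norm_of_nonneg (by positivity)] at this
          have hx : (‖z - z₀‖⁻¹) ^ (n + n) * ‖z - z₀‖ ^ (n + n) ≤ 1 := by
            rw [← mul_pow]
            exact pow_le_one₀ (by positivity) inv_mul_le_one
          calc ‖dZbar q z‖ ^ 2 * N z
              ≤ (K / ε * (‖z - z₀‖⁻¹) ^ n) ^ 2 * (A * ‖z - z₀‖ ^ (n + 2 + (n + 2))) := by
                have := N0 z
                gcongr
                exact q2 z hz2
            _ = (K / ε) ^ 2 * A * ((‖z - z₀‖⁻¹) ^ (n + n) * ‖z - z₀‖ ^ (n + n))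
                  * ‖z - z₀‖ ^ 4 := by ring
            _ ≤ (K / ε) ^ 2 * A * 1 * (2 * ε) ^ 4 := by gcongr
            _ = 16 * K ^ 2 * A * ε ^ 2 := by field_simp; ring
            _ ≤ (K ^ 2 * M + 1) * (2 / R) ^ (n + n) := by
                have : 0 ≤ K ^ 2 * M * (2 / R) ^ (n + n) := by positivity
                linarith
        · have hNz : N z ≤ M := (le_abs_self _).trans (hM z hz)
          calc ‖dZbar q z‖ ^ 2 * N z ≤ (K * (2 / R) ^ n) ^ 2 * M := by
                have := N0 z
                gcongr
                exact q3 z (not_le.1 hz2)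
            _ = K ^ 2 * M * (2 / R) ^ (n + n) := by ring
            _ ≤ _ := by linarith
      have := N0 z
      gcongr
    exact lower.trans (hle.trans upper)
  set c := N z₁ / 2 * volume.real (Metric.ball z₁ ρ) with hc
  have hcpos : 0 < c := mul_pos (by linarith) 
    (ENNReal.toReal_pos (Metric.measure_ball_pos volume _ hρ).ne' measure_ball_lt_top.ne)
  -- The two rates differ by the factor `4 ^ n`, since `(4/R)^(2n) = 4^n (2/R)^(2n)`.
  obtain ⟨n, hn⟩ := pow_unbounded_of_one_lt
    (2 * (K ^ 2 * M + 1) * Wm * volume.real (Metric.closedBall z₀ R) / c)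
    (show (1 : ℝ) < 4 by norm_num)
  rw [div_lt_iff₀ hcpos] at hn
  have hp : 0 < (2 / R) ^ (n + n) := by positivity
  have h2 : (4 / R) ^ (n + n) = 4 ^ n * (2 / R) ^ (n + n) := by
    rw [show (4 : ℝ) / R = 2 * (2 / R) by ring, mul_pow, ← two_mul, pow_mul 2 2 n]
    norm_num
  have h3 := main n
  rw [h2] at h3
  have h4 := mul_lt_mul_of_pos_right hn hp
  rw [hc] at h4
  linarith

/-! ### Leading terms of solutions of `∂̄F = L F` -/

section Flat

variable {E : Type*} [NormedAddCommGroup E] [NormedSpace ℂ E]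

/-- All derivatives of order `< k` vanish at `z₀`. -/
def FlatAt (z₀ : ℂ) : ℕ → (ℂ → E) → Prop
  | 0, _ => True
  | k + 1, F => F z₀ = 0 ∧ FlatAt z₀ k (dZ F) ∧ FlatAt z₀ k (dZbar F)

variable {z₀ : ℂ} {F G : ℂ → E} {k : ℕ}

theorem contDiffAt_dZ_infty (hF : ContDiffAt ℝ ∞ F z₀) : ContDiffAt ℝ ∞ (dZ F) z₀ :=
  contDiffAt_dZ hF (by norm_cast)

theorem contDiffAt_dZbar_infty (hF : ContDiffAt ℝ ∞ F z₀) : ContDiffAt ℝ ∞ (dZbar F) z₀ :=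
  contDiffAt_dZbar hF (by norm_cast)

/-- `C^∞` at a point provides a neighbourhood for each finite order, not a common one; order two is
all that the Wirtinger identities need nearby. -/
theorem eventually_contDiffAt_two (hF : ContDiffAt ℝ ∞ F z₀) :
    ∀ᶠ w in 𝓝 z₀, ContDiffAt ℝ 2 F w :=
  (hF.of_le (WithTop.coe_le_coe.2 le_top)).eventually (by simp)

theorem eventually_differentiableAt (hF : ContDiffAt ℝ ∞ F z₀) :
    ∀ᶠ w in 𝓝 z₀, DifferentiableAt ℝ F w :=
  (eventually_contDiffAt_two hF).mono fun _ h => h.differentiableAt two_ne_zero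

theorem FlatAt.congr : ∀ {k : ℕ} {F G : ℂ → E}, FlatAt z₀ k F → F =ᶠ[𝓝 z₀] G → FlatAt z₀ k G
  | 0, _, _, _, _ => trivial
  | _ + 1, _, _, ⟨h0, h1, h2⟩, h =>
    ⟨h.eq_of_nhds ▸ h0, h1.congr (dZ_eventuallyEq h), h2.congr (dZbar_eventuallyEq h)⟩

theorem FlatAt.of_succ : ∀ {k : ℕ} {F : ℂ → E}, FlatAt z₀ (k + 1) F → FlatAt z₀ k F
  | 0, _, _ => trivial
  | _ + 1, _, ⟨h0, h1, h2⟩ => ⟨h0, h1.of_succ, h2.of_succ⟩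

theorem FlatAt.add : ∀ {k : ℕ} {F G : ℂ → E}, ContDiffAt ℝ ∞ F z₀ → ContDiffAt ℝ ∞ G z₀ →
    FlatAt z₀ k F → FlatAt z₀ k G → FlatAt z₀ k (fun w => F w + G w)
  | 0, _, _, _, _, _, _ => trivial
  | k + 1, F, G, hF, hG, ⟨a0, a1, a2⟩, ⟨b0, b1, b2⟩ => by
    refine ⟨by simp [a0, b0], ?_, ?_⟩
    · refine (FlatAt.add (contDiffAt_dZ_infty hF) (contDiffAt_dZ_infty hG) a1 b1).congr ?_
      filter_upwards [eventually_differentiableAt hF, eventually_differentiableAt hG] with w h h'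
        using (dZ_add h h').symm
    · refine (FlatAt.add (contDiffAt_dZbar_infty hF) (contDiffAt_dZbar_infty hG) a2 b2).congr ?_
      filter_upwards [eventually_differentiableAt hF, eventually_differentiableAt hG] with w h h'
        using (dZbar_add h h').symm

theorem FlatAt.clm_apply : ∀ {k : ℕ} {L : ℂ → E →L[ℂ] E} {F : ℂ → E}, ContDiffAt ℝ ∞ L z₀ →
    ContDiffAt ℝ ∞ F z₀ → FlatAt z₀ k F → FlatAt z₀ k (fun w => L w (F w))
  | 0, _, _, _, _, _ => trivial
  | k + 1, L, F, hL, hF, hflat => by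
    obtain ⟨a0, a1, a2⟩ := id hflat
    have ap : ∀ {L : ℂ → E →L[ℂ] E} {F : ℂ → E}, ContDiffAt ℝ ∞ L z₀ → ContDiffAt ℝ ∞ F z₀ →
        ContDiffAt ℝ ∞ (fun w => L w (F w)) z₀ := fun {L F} hL hF =>
      (((ContinuousLinearMap.restrictScalarsL ℂ E E ℝ ℝ).contDiff.contDiffAt.comp z₀ hL).clm_apply
        hF :)
    refine ⟨by simp [a0], ?_, ?_⟩
    · refine (FlatAt.add (ap (contDiffAt_dZ_infty hL) hF) (ap hL (contDiffAt_dZ_infty hF))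
        (FlatAt.clm_apply (contDiffAt_dZ_infty hL) hF hflat.of_succ)
        (FlatAt.clm_apply hL (contDiffAt_dZ_infty hF) a1)).congr ?_
      filter_upwards [eventually_differentiableAt hL, eventually_differentiableAt hF] with w h h'
      exact (dZ_bilin (.id ℂ (E →L[ℂ] E)) h h').symm
    · refine (FlatAt.add (ap (contDiffAt_dZbar_infty hL) hF) (ap hL (contDiffAt_dZbar_infty hF))
        (FlatAt.clm_apply (contDiffAt_dZbar_infty hL) hF hflat.of_succ)
        (FlatAt.clm_apply hL (contDiffAt_dZbar_infty hF) a2)).congr ?_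
      filter_upwards [eventually_differentiableAt hL, eventually_differentiableAt hF] with w h h'
      exact (dZbar_bilin (.id ℂ (E →L[ℂ] E)) h h').symm

/-- Taylor's estimate by induction: the mean value inequality on the closed ball through `w` turns
bounds of order `k` on both Wirtinger derivatives into one of order `k + 1` on `F`. -/
theorem FlatAt.isBigO : ∀ {k : ℕ} {F : ℂ → E}, ContDiffAt ℝ ∞ F z₀ → FlatAt z₀ k F →
    F =O[𝓝 z₀] fun w => ‖w - z₀‖ ^ k
  | 0, F, hF, _ => by simpa using hF.continuousAt.norm.isBoundedUnder_le.isBigO_one ℝ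
  | k + 1, F, hF, ⟨h0, h1, h2⟩ => by
    obtain ⟨C₁, hC₁, b₁⟩ := (h1.isBigO (contDiffAt_dZ_infty hF)).exists_pos
    obtain ⟨C₂, hC₂, b₂⟩ := (h2.isBigO (contDiffAt_dZbar_infty hF)).exists_pos
    obtain ⟨r, hr, H⟩ := Metric.eventually_nhds_iff_ball.1
      (b₁.bound.and (b₂.bound.and (eventually_differentiableAt hF)))
    refine Asymptotics.IsBigO.of_bound (C₁ + C₂) (Metric.eventually_nhds_iff_ball.2
      ⟨r, hr, fun w hw => ?_⟩)
    have hsub : ∀ x ∈ Metric.closedBall z₀ ‖w - z₀‖, x ∈ Metric.ball z₀ r := fun x hx => by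
      rw [mem_ball_iff_norm] at hw ⊢
      exact (mem_closedBall_iff_norm.1 hx).trans_lt hw
    have := (convex_closedBall z₀ ‖w - z₀‖).norm_image_sub_le_of_norm_fderiv_le (𝕜 := ℝ) (f := F)
      (C := (C₁ + C₂) * ‖w - z₀‖ ^ k) (fun x hx => (H x (hsub x hx)).2.2) (fun x hx => ?_)
      (Metric.mem_closedBall_self (norm_nonneg _)) (mem_closedBall_iff_norm.2 le_rfl)
    · rw [h0, sub_zero] at this
      rw [Real.norm_of_nonneg (by positivity), pow_succ, ← mul_assoc]
      exact this
    · refine ContinuousLinearMap.opNorm_le_bound _ (by positivity) fun X => ?_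
      obtain ⟨e1, e2, -⟩ := H x (hsub x hx)
      rw [Real.norm_of_nonneg (by positivity)] at e1 e2
      have hx' : ‖x - z₀‖ ^ k ≤ ‖w - z₀‖ ^ k :=
        pow_le_pow_left₀ (norm_nonneg _) (mem_closedBall_iff_norm.1 hx) _
      rw [fderiv_eq_dZ_add_dZbar]
      calc _ ≤ ‖X • dZ F x‖ + ‖conj X • dZbar F x‖ := norm_add_le _ _
        _ = ‖X‖ * ‖dZ F x‖ + ‖X‖ * ‖dZbar F x‖ := by rw [norm_smul, norm_smul, Complex.norm_conj]
        _ ≤ ‖X‖ * (C₁ * ‖w - z₀‖ ^ k) + ‖X‖ * (C₂ * ‖w - z₀‖ ^ k) := by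
          gcongr
          · exact e1.trans (by gcongr)
          · exact e2.trans (by gcongr)
        _ = _ := by ring

theorem hasDerivAt_sub_pow_smul (z₀ : ℂ) (k : ℕ) (a : E) (w : ℂ) :
    HasDerivAt (fun w => (w - z₀) ^ (k + 1) • a) ((w - z₀) ^ k • ((k + 1 : ℂ) • a)) w := by
  have := ((((hasDerivAt_id w).sub_const z₀).pow (k + 1)).smul_const a)
  simp only [id, Nat.cast_add, Nat.cast_one, add_tsub_cancel_right, mul_one] at this
  rwa [smul_smul, mul_comm]

theorem contDiff_sub_pow_smul (z₀ : ℂ) (k : ℕ) (a : E) {n : WithTop ℕ∞} :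
    ContDiff ℝ n (fun w : ℂ => (w - z₀) ^ k • a) :=
  ((contDiff_id.sub contDiff_const).pow k).smul contDiff_const

/-- The first non-trivial Taylor term of `F` is homogeneous of degree `k`. As `∂̄F` is flat to order
`k`, every monomial containing `conj (w - z₀)` drops out and only `(w - z₀)^k` remains. The
induction takes the leading term of `∂F` and integrates it, whence the division by `k + 1`. -/
theorem FlatAt.exists_leading : ∀ {k : ℕ} {F : ℂ → E}, ContDiffAt ℝ ∞ F z₀ → FlatAt z₀ k F →
    FlatAt z₀ k (dZbar F) → ∃ a : E, FlatAt z₀ (k + 1) (fun w => F w - (w - z₀) ^ k • a)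
  | 0, F, hF, _, _ => ⟨F z₀, by simp [FlatAt]⟩
  | k + 1, F, hF, ⟨h0, h1, h2⟩, h5 => by
    obtain ⟨-, h4, -⟩ := id h5
    have hcomm : dZ (dZbar F) =ᶠ[𝓝 z₀] dZbar (dZ F) :=
      (eventually_contDiffAt_two hF).mono fun _ h => dZ_dZbar_comm h
    obtain ⟨a, ha⟩ := FlatAt.exists_leading (contDiffAt_dZ_infty hF) h1 (h4.congr hcomm)
    have hk : (k + 1 : ℂ) ≠ 0 := by exact_mod_cast k.succ_ne_zero
    have hd : ∀ w, HasDerivAt (fun w => (w - z₀) ^ (k + 1) • ((k + 1 : ℂ)⁻¹ • a))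
        ((w - z₀) ^ k • a) w := by
      intro w
      have := hasDerivAt_sub_pow_smul z₀ k ((k + 1 : ℂ)⁻¹ • a) w
      rwa [smul_inv_smul₀ hk] at this
    refine ⟨(k + 1 : ℂ)⁻¹ • a, by simp [h0], ha.congr ?_, ?_⟩
    · filter_upwards [eventually_differentiableAt hF] with w hw
      rw [dZ_sub hw ((hd w).differentiableAt.restrictScalars ℝ), dZ_of_hasDerivAt (hd w)]
    · refine h5.congr ?_
      filter_upwards [eventually_differentiableAt hF] with w hw
      rw [dZbar_sub hw ((hd w).differentiableAt.restrictScalars ℝ), dZbar_of_hasDerivAt (hd w),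
        sub_zero]

/-- Strong unique continuation for `∂̄F = L F`. -/
theorem eventually_eq_zero_of_flat [FiniteDimensional ℂ E] {L : ℂ → E →L[ℂ] E}
    (hF : ContDiffAt ℝ ∞ F z₀) (hL : ContinuousAt L z₀)
    (hLF : ∀ᶠ w in 𝓝 z₀, dZbar F w = L w (F w))
    (hflat : ∀ k : ℕ, F =O[𝓝 z₀] fun w => ‖w - z₀‖ ^ k) : ∀ᶠ w in 𝓝 z₀, F w = 0 := by
  -- Coordinates in a basis turn `F` into a finite family of scalar functions, at the price of
  -- constants comparing the norms.
  let b := Module.finBasis ℂ E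
  let l : Fin (Module.finrank ℂ E) → E →L[ℂ] ℂ := fun i =>
    LinearMap.toContinuousLinearMap (b.coord i)
  set M := ‖L z₀‖ + 1 with hM
  have hbd : ∀ᶠ w in 𝓝 z₀, ‖L w‖ < M := hL.norm.eventually (gt_mem_nhds (by simp [hM]))
  have hM0 : 0 ≤ M := by positivity
  obtain ⟨r, hr, H⟩ := Metric.eventually_nhds_iff_ball.1
    (hLF.and (hbd.and (eventually_contDiffAt_two hF)))
  have hx : ∀ x : E, ‖x‖ ^ 2 ≤ (∑ i, ‖b i‖ ^ 2) * ∑ i, ‖l i x‖ ^ 2 := by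
    intro x
    have h1 : ‖x‖ ≤ ∑ i, ‖b i‖ * ‖l i x‖ := by
      conv_lhs => rw [← b.sum_repr x]
      refine (norm_sum_le _ _).trans (Finset.sum_le_sum fun i _ => ?_)
      rw [norm_smul, mul_comm]
      rfl
    exact (pow_le_pow_left₀ (norm_nonneg _) h1 2).trans (Finset.sum_mul_sq_le_sq_mul_sq _ _ _)
  have hFl : ∀ i, ∀ z ∈ Metric.ball z₀ r, ContDiffAt ℝ 2 (fun w => l i (F w)) z := fun i z hz =>
    ((l i).restrictScalars ℝ).contDiff.contDiffAt.comp z (H z hz).2.2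
  have hC : ∀ z ∈ Metric.ball z₀ r, ∑ i, ‖dZbar (fun w => l i (F w)) z‖ ^ 2
      ≤ ((∑ i, ‖l i‖ ^ 2) * M ^ 2 * ∑ i, ‖b i‖ ^ 2) * ∑ i, ‖l i (F z)‖ ^ 2 := by
    intro z hz
    obtain ⟨a1, a2, a3⟩ := H z hz
    calc ∑ i, ‖dZbar (fun w => l i (F w)) z‖ ^ 2
        ≤ ∑ i, ‖l i‖ ^ 2 * (M ^ 2 * ‖F z‖ ^ 2) := by
          refine Finset.sum_le_sum fun i _ => ?_
          rw [dZbar_clm _ (a3.differentiableAt two_ne_zero), a1, ← mul_pow, ← mul_pow]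
          gcongr
          refine ((l i).le_opNorm _).trans ?_
          gcongr
          exact ((L z).le_opNorm _).trans (by gcongr)
      _ = (∑ i, ‖l i‖ ^ 2) * M ^ 2 * ‖F z‖ ^ 2 := by rw [← Finset.sum_mul, mul_assoc]
      _ ≤ (∑ i, ‖l i‖ ^ 2) * M ^ 2 * ((∑ i, ‖b i‖ ^ 2) * ∑ i, ‖l i (F z)‖ ^ 2) := by
          gcongr
          exact hx _
      _ = _ := by ring
  have hfl : ∀ i (k : ℕ), (fun w => l i (F w)) =O[𝓝 z₀] fun w => ‖w - z₀‖ ^ k := fun i k =>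
    ((l i).isBigO_comp F (𝓝 z₀)).trans (hflat k)
  -- The Carleman argument excludes the centre, where flatness of order one suffices.
  have h0 : F z₀ = 0 := by
    have := (hflat 1).eq_zero_of_norm_pow (n := 1) one_ne_zero
    simpa using this
  filter_upwards [Metric.ball_mem_nhds z₀ (show 0 < r / 2 / 4 by positivity)] with w hw
  by_cases hwz : w = z₀
  · rw [hwz, h0]
  · have := eq_zero_of_dZbar_le_of_flat_family (half_pos hr) (half_lt_self hr)
      (by positivity) hFl hC hfl hwz (mem_ball_iff_norm.1 hw)
    have h2 := hx (F w)
    rw [this, mul_zero] at h2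
    exact norm_eq_zero.1 (pow_eq_zero_iff two_ne_zero |>.1 (le_antisymm h2 (sq_nonneg _)))

/-- If every derivative vanishes, strong unique continuation applies. Otherwise take the first order
at which flatness fails; it is a successor `k + 1` because order `0` is no condition. Then `∂̄F = L
F` is as flat as `F`, so `FlatAt.exists_leading` gives a leading term, non-zero by the choice of
`k`. -/
theorem eventually_zero_or_leading [FiniteDimensional ℂ E] {L : ℂ → E →L[ℂ] E}
    (hF : ContDiffAt ℝ ∞ F z₀) (hL : ContDiffAt ℝ ∞ L z₀)
    (hLF : ∀ᶠ w in 𝓝 z₀, dZbar F w = L w (F w)) :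
    (∀ᶠ w in 𝓝 z₀, F w = 0) ∨ ∃ (k : ℕ) (a : E), a ≠ 0 ∧
      (fun w => F w - (w - z₀) ^ k • a) =O[𝓝 z₀] fun w => ‖w - z₀‖ ^ (k + 1) := by
  by_cases hall : ∀ k, FlatAt z₀ k F
  · exact .inl (eventually_eq_zero_of_flat hF hL.continuousAt hLF fun k => (hall k).isBigO hF)
  · right
    classical
    have hex := not_forall.1 hall
    obtain ⟨k, hk⟩ : ∃ k, Nat.find hex = k + 1 :=
      Nat.exists_eq_succ_of_ne_zero fun h => (h ▸ Nat.find_spec hex) trivial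
    have h1 : ¬ FlatAt z₀ (k + 1) F := hk ▸ Nat.find_spec hex
    have h2 : FlatAt z₀ k F := not_not.1 (Nat.find_min hex (hk ▸ k.lt_succ_self))
    have h3 : FlatAt z₀ k (dZbar F) :=
      (h2.clm_apply hL hF).congr (hLF.mono fun _ h => h.symm)
    obtain ⟨a, ha⟩ := h2.exists_leading hF h3
    refine ⟨k, a, ?_, ha.isBigO (hF.sub (contDiff_sub_pow_smul z₀ k a).contDiffAt)⟩
    rintro rfl
    exact h1 (by simpa using ha)

theorem tendsto_inv_pow_smul_zero {k m : ℕ} (hkm : k < m)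
    (hF : F =O[𝓝 z₀] fun w => ‖w - z₀‖ ^ m) :
    Tendsto (fun w => ((w - z₀) ^ k)⁻¹ • F w) (𝓝[≠] z₀) (𝓝 0) := by
  obtain ⟨C, hC, h⟩ := hF.exists_pos
  have hlim : Tendsto (fun w : ℂ => C * ‖w - z₀‖ ^ (m - k)) (𝓝[≠] z₀) (𝓝 0) := by
    have c : Continuous fun w : ℂ => C * ‖w - z₀‖ ^ (m - k) := by fun_prop
    have := c.tendsto z₀
    simp only [sub_self, norm_zero, zero_pow (Nat.sub_ne_zero_of_lt hkm), mul_zero] at this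
    exact this.mono_left nhdsWithin_le_nhds
  refine squeeze_zero_norm' ?_ hlim
  filter_upwards [nhdsWithin_le_nhds h.bound, self_mem_nhdsWithin] with w hw hne
  have hpos : 0 < ‖w - z₀‖ := norm_pos_iff.2 (sub_ne_zero.2 hne)
  rw [Real.norm_of_nonneg (by positivity)] at hw
  rw [norm_smul, norm_inv, norm_pow, inv_mul_le_iff₀ (by positivity)]
  refine hw.trans (le_of_eq ?_)
  rw [mul_left_comm, ← pow_add, Nat.add_sub_cancel' hkm.le]

theorem tendsto_leading {a : E}
    (h : (fun w => F w - (w - z₀) ^ k • a) =O[𝓝 z₀] fun w => ‖w - z₀‖ ^ (k + 1)) :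
    Tendsto (fun w => ((w - z₀) ^ k)⁻¹ • F w) (𝓝[≠] z₀) (𝓝 a) := by
  have h1 := (tendsto_inv_pow_smul_zero k.lt_succ_self h).add_const a
  rw [zero_add] at h1
  refine h1.congr' ?_
  filter_upwards [self_mem_nhdsWithin] with w hw
  rw [smul_sub, inv_smul_smul₀ (pow_ne_zero _ (sub_ne_zero.2 hw)), sub_add_cancel]

theorem eventually_ne_zero_of_leading {a : E} (ha : a ≠ 0)
    (h : (fun w => F w - (w - z₀) ^ k • a) =O[𝓝 z₀] fun w => ‖w - z₀‖ ^ (k + 1)) :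
    ∀ᶠ w in 𝓝[≠] z₀, F w ≠ 0 := by
  filter_upwards [(tendsto_leading h).eventually_ne ha] with w hw h0
  exact hw (by rw [h0, smul_zero])

/-- Dividing by `(w - z₀)^k` would otherwise give both limits `a` and `0`. This is what makes the
multiplicities of `D₂` finite. -/
theorem le_of_leading_of_isBigO {a : E} (ha : a ≠ 0)
    (h : (fun w => F w - (w - z₀) ^ k • a) =O[𝓝 z₀] fun w => ‖w - z₀‖ ^ (k + 1)) {m : ℕ}
    (hm : F =O[𝓝 z₀] fun w => ‖w - z₀‖ ^ m) : m ≤ k := by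
  by_contra hlt
  exact ha (tendsto_nhds_unique (tendsto_leading h)
    (tendsto_inv_pow_smul_zero (not_le.1 hlt) hm))

/-- On a connected open set, a non-trivial solution of `∂̄F = L F` vanishes to finite order at
every point, with a holomorphic leading term. -/
theorem exists_leading_of_preconnected [FiniteDimensional ℂ E] {U : Set ℂ}
    (hU : IsPreconnected U) (hUo : IsOpen U) {L : ℂ → E →L[ℂ] E}
    (hF : ∀ z ∈ U, ContDiffAt ℝ ∞ F z) (hL : ∀ z ∈ U, ContDiffAt ℝ ∞ L z)
    (hLF : ∀ z ∈ U, dZbar F z = L z (F z)) (hne : ∃ z ∈ U, F z ≠ 0) {z : ℂ} (hz : z ∈ U) :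
    ∃ (k : ℕ) (a : E), a ≠ 0 ∧
      (fun w => F w - (w - z) ^ k • a) =O[𝓝 z] fun w => ‖w - z‖ ^ (k + 1) := by
  have dich : ∀ z ∈ U, (∀ᶠ w in 𝓝 z, F w = 0) ∨ ∃ (k : ℕ) (a : E), a ≠ 0 ∧
      (fun w => F w - (w - z) ^ k • a) =O[𝓝 z] fun w => ‖w - z‖ ^ (k + 1) := fun z hz =>
    eventually_zero_or_leading (hF z hz) (hL z hz)
      (eventually_of_mem (hUo.mem_nhds hz) hLF)
  refine (dich z hz).resolve_left fun h0 => ?_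
  obtain ⟨z₁, hz₁, hne⟩ := hne
  -- The set where `F` vanishes locally is open by definition. It is relatively closed in `U`
  -- because a point with a leading term has a punctured neighbourhood free of zeros.
  set S : Set ℂ := {z | ∀ᶠ w in 𝓝 z, F w = 0}
  have hS : IsOpen S := isOpen_iff_mem_nhds.2 fun z hz => eventually_eventually_nhds.2 hz
  have hsub : U ⊆ S := by
    refine hU.subset_of_closure_inter_subset hS ⟨z, hz, h0⟩ fun w ⟨hw, hwU⟩ => ?_
    refine (dich w hwU).resolve_right fun ⟨k, a, ha, hk⟩ => ?_
    have h1 := eventually_nhdsWithin_iff.1 (eventually_ne_zero_of_leading ha hk)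
    have hwS : w ∉ S := fun hwS => by
      obtain ⟨x, hx, hx'⟩ := ((eventually_ne_zero_of_leading ha hk).and
        (nhdsWithin_le_nhds hwS)).exists
      exact hx hx'
    obtain ⟨x, hx, hxS⟩ := mem_closure_iff_nhds.1 hw _ h1
    exact hx (fun h => hwS (h ▸ hxS)) (show ∀ᶠ w in 𝓝 x, F w = 0 from hxS).self_of_nhds
  exact hne (show ∀ᶠ w in 𝓝 z₁, F w = 0 from hsub hz₁).self_of_nhds

end Flat

/-! ### The Hermitian adjoint -/

theorem herm_apply (v w : C21) :
    herm v w = v 0 * conj (w 0) + v 1 * conj (w 1) - v 2 * conj (w 2) := rfl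

theorem herm_sub_left (u v w : C21) : herm (u - v) w = herm u w - herm v w :=
  map_sub _ _ _

theorem herm_sub_right (u v w : C21) : herm w (u - v) = herm w u - herm w v := by
  rw [← herm_conj, herm_sub_left, map_sub, herm_conj, herm_conj]

theorem herm_zero_left (w : C21) : herm 0 w = 0 := map_zero _

theorem herm_zero_right (w : C21) : herm w 0 = 0 := by
  rw [← herm_conj, herm_zero_left, map_zero]

theorem herm_eq_zero_comm {v w : C21} : herm v w = 0 ↔ herm w v = 0 := by
  rw [← herm_conj, map_eq_zero]

theorem eq_zero_of_herm_eq_zero {w : C21} (h : ∀ v, herm v w = 0) : w = 0 := by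
  have h0 := h ![1, 0, 0]
  have h1 := h ![0, 1, 0]
  have h2 := h ![0, 0, 1]
  simp [herm_apply] at h0 h1 h2
  ext i
  fin_cases i <;> assumption

theorem ext_herm {x y : C21} (h : ∀ v, herm v x = herm v y) : x = y :=
  sub_eq_zero.1 (eq_zero_of_herm_eq_zero fun v => by rw [herm_sub_right, h, sub_self])

/-- The endomorphisms of `ℂ^{2,1}`. -/
abbrev End21 : Type := C21 →L[ℂ] C21

/-- The adjoint with respect to the Hermitian metric, as a linear map in the endomorphism. -/
noncomputable def adjLinear : End21 →ₗ[ℝ] End21 where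
  toFun A := LinearMap.toContinuousLinearMap
    -- The coordinates of the adjoint are found by pairing with the standard basis; the sign of the
    -- last one is that of the form.
    { toFun := fun w => ![herm w (A ![1, 0, 0]), herm w (A ![0, 1, 0]), -herm w (A ![0, 0, 1])]
      map_add' := fun u v => by
        ext i
        fin_cases i <;> simp [herm_add_left] <;> ring
      map_smul' := fun c v => by
        ext i
        fin_cases i <;> simp [herm_smul_left] }
  map_add' A B := by
    ext w i
    fin_cases i <;> simp [herm_add_right] <;> ring
  map_smul' c A := by
    ext w i
    have : ∀ x : C21, herm w (c • x) = c * herm w x := fun x => by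
      rw [← Complex.coe_smul, herm_smul_right, Complex.conj_ofReal]
    fin_cases i <;> simp [this]

/-- The adjoint with respect to the Hermitian metric. -/
noncomputable def adj : End21 →L[ℝ] End21 := LinearMap.toContinuousLinearMap adjLinear

theorem herm_adj (A : End21) (v w : C21) : herm (A v) w = herm v (adj A w) := by
  have hv : v = v 0 • ![1, 0, 0] + v 1 • ![0, 1, 0] + v 2 • ![0, 0, 1] := by
    ext i; fin_cases i <;> simp
  have hadj : adj A w
      = ![herm w (A ![1, 0, 0]), herm w (A ![0, 1, 0]), -herm w (A ![0, 0, 1])] := rfl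
  rw [hadj, herm_apply v]
  conv_lhs => rw [hv]
  simp only [map_add, map_smul, herm_add_left, herm_smul_left]
  simp [herm_conj]

theorem adj_eq_of_herm {A B : End21} (h : ∀ v w, herm (A v) w = herm v (B w)) : adj A = B := by
  ext1 w
  exact ext_herm fun v => by rw [← herm_adj, h]

theorem adj_adj (A : End21) : adj (adj A) = A :=
  adj_eq_of_herm fun v w => by rw [← herm_conj, ← herm_adj, herm_conj]

theorem adj_mul (A B : End21) : adj (A * B) = adj B * adj A :=
  adj_eq_of_herm fun v w => by
    rw [mul_apply_eq_comp, herm_adj, herm_adj, mul_apply_eq_comp]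

theorem adj_smul (c : ℂ) (A : End21) : adj (c • A) = conj c • adj A :=
  adj_eq_of_herm fun v w => by
    rw [smul_apply, herm_smul_left, smul_apply, herm_smul_right, Complex.conj_conj, herm_adj]

theorem adj_injective : Function.Injective adj := fun A B h => by
  rw [← adj_adj A, h, adj_adj]

theorem adj_eq_zero {A : End21} : adj A = 0 ↔ A = 0 := map_eq_zero_iff _ adj_injective

theorem dZbar_adj {F : ℂ → End21} {z : ℂ} (hF : DifferentiableAt ℝ F z) :
    dZbar (fun w => adj (F w)) z = adj (dZ F z) :=
  dZbar_conjLinear adj adj_smul hF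

/-! ### Projections onto lines -/

/-- The orthogonal projection onto the line spanned by a vector that is not null. -/
noncomputable def projVec (u : C21) : End21 :=
  LinearMap.toContinuousLinearMap ((herm u u)⁻¹ • (hermForm u).smulRight u)

theorem projVec_apply (u v : C21) : projVec u v = ((herm u u)⁻¹ * herm v u) • u := by
  simp [projVec, herm, smul_smul]

theorem lineProj_eq_projVec_rep (ℓ : P21) : lineProj ℓ = projVec ℓ.rep := rfl

theorem projVec_smul {c : ℂ} (hc : c ≠ 0) (u : C21) : projVec (c • u) = projVec u := by
  ext1 v
  rw [projVec_apply, projVec_apply, herm_smul_right, herm_smul_left, herm_smul_right, smul_smul]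
  congr 1
  have : conj c ≠ 0 := (map_ne_zero _).2 hc
  field_simp

theorem mem_submodule_iff {ℓ : P21} {v : C21} : v ∈ ℓ.submodule ↔ ∃ c : ℂ, c • ℓ.rep = v := by
  rw [ℓ.submodule_eq, Submodule.mem_span_singleton]

theorem rep_mem (ℓ : P21) : ℓ.rep ∈ ℓ.submodule := mem_submodule_iff.2 ⟨1, one_smul _ _⟩

theorem lineProj_eq_projVec {ℓ : P21} {u : C21} (hu : u ∈ ℓ.submodule) (hu0 : u ≠ 0) :
    lineProj ℓ = projVec u := by
  obtain ⟨c, rfl⟩ := mem_submodule_iff.1 hu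
  rw [lineProj_eq_projVec_rep, projVec_smul]
  rintro rfl
  simp at hu0

theorem submodule_eq_span {ℓ : P21} {u : C21} (hu : u ∈ ℓ.submodule) (hu0 : u ≠ 0) :
    ℓ.submodule = Submodule.span ℂ {u} := by
  obtain ⟨c, rfl⟩ := mem_submodule_iff.1 hu
  have hc : c ≠ 0 := by rintro rfl; simp at hu0
  rw [ℓ.submodule_eq, Submodule.span_singleton_smul_eq (IsUnit.mk0 c hc)]

theorem adj_projVec (u : C21) : adj (projVec u) = projVec u :=
  adj_eq_of_herm fun v w => by
    rw [projVec_apply, projVec_apply, herm_smul_left, herm_smul_right, map_mul, map_inv₀,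
      herm_conj, herm_conj]
    ring

theorem projVec_self {u : C21} (hu : herm u u ≠ 0) : projVec u u = u := by
  rw [projVec_apply, inv_mul_cancel₀ hu, one_smul]

theorem projVec_mul_self {u : C21} (hu : herm u u ≠ 0) : projVec u * projVec u = projVec u := by
  ext1 v
  rw [mul_apply_eq_comp, projVec_apply u v, map_smul, projVec_self hu]

/-- A line that is not null. -/
def NonNull (ℓ : P21) : Prop := herm ℓ.rep ℓ.rep ≠ 0

theorem nonNull_of_mem_CH2 {ℓ : P21} (h : ℓ ∈ CH2) : NonNull ℓ := fun h0 => by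
  have : (herm ℓ.rep ℓ.rep).re < 0 := h
  rw [h0] at this
  simp at this

theorem nonNull_of_mem_CdS2 {ℓ : P21} (h : ℓ ∈ CdS2) : NonNull ℓ := fun h0 => by
  have : 0 < (herm ℓ.rep ℓ.rep).re := h
  rw [h0] at this
  simp at this

theorem adj_lineProj (ℓ : P21) : adj (lineProj ℓ) = lineProj ℓ := adj_projVec _

theorem lineProj_mul_self {ℓ : P21} (h : NonNull ℓ) : lineProj ℓ * lineProj ℓ = lineProj ℓ :=
  projVec_mul_self h

theorem lineProj_apply_mem (ℓ : P21) (v : C21) : lineProj ℓ v ∈ ℓ.submodule := by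
  rw [lineProj_eq_projVec_rep, projVec_apply]
  exact Submodule.smul_mem _ _ (rep_mem ℓ)

theorem lineProj_of_mem {ℓ : P21} (h : NonNull ℓ) {v : C21} (hv : v ∈ ℓ.submodule) :
    lineProj ℓ v = v := by
  obtain ⟨c, rfl⟩ := mem_submodule_iff.1 hv
  rw [map_smul, lineProj_eq_projVec_rep, projVec_self h]

theorem lineProj_injOn {ℓ ℓ' : P21} (h : NonNull ℓ) (h' : NonNull ℓ')
    (e : lineProj ℓ = lineProj ℓ') : ℓ = ℓ' := by
  refine Projectivization.submodule_injective (le_antisymm (fun v hv => ?_) fun v hv => ?_)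
  · rw [← lineProj_of_mem h hv, e]
    exact lineProj_apply_mem _ _
  · rw [← lineProj_of_mem h' hv, ← e]
    exact lineProj_apply_mem _ _

/-- Two endomorphisms that factor through a line agree if they agree on a generator. -/
theorem eq_zero_of_mul_lineProj {ℓ : P21} {X : End21} (hX : X * lineProj ℓ = X)
    (h : X ℓ.rep = 0) : X = 0 := by
  ext1 v
  rw [← hX, mul_apply_eq_comp, lineProj_eq_projVec_rep, projVec_apply, map_smul, h]
  simp

theorem mk_rep_smul {v : C21} (hv : v ≠ 0) :
    ∃ c : ℂ, c ≠ 0 ∧ (Projectivization.mk ℂ v hv).rep = c • v := by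
  obtain ⟨a, ha⟩ := Projectivization.exists_smul_eq_mk_rep ℂ v hv
  exact ⟨a, a.ne_zero, ha.symm⟩

theorem herm_self_re_smul (c : ℂ) (v : C21) :
    (herm (c • v) (c • v)).re = ‖c‖ ^ 2 * (herm v v).re := by
  rw [herm_smul_left, herm_smul_right, ← mul_assoc, Complex.mul_conj, Complex.normSq_eq_norm_sq,
    Complex.re_ofReal_mul]

theorem mem_CH2_of_mem_submodule {ℓ : P21} (hℓ : ℓ ∈ CH2) {v : C21} (hv : v ∈ ℓ.submodule)
    (hv0 : v ≠ 0) : (herm v v).re < 0 := by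
  obtain ⟨c, rfl⟩ := mem_submodule_iff.1 hv
  have hc : c ≠ 0 := by rintro rfl; simp at hv0
  rw [herm_self_re_smul]
  exact mul_neg_of_pos_of_neg (by positivity) hℓ

theorem mk_mem_CdS2 {v : C21} (hv : v ≠ 0) (h : 0 < (herm v v).re) :
    Projectivization.mk ℂ v hv ∈ CdS2 := by
  obtain ⟨c, hc, e⟩ := mk_rep_smul hv
  change 0 < (herm (Projectivization.mk ℂ v hv).rep (Projectivization.mk ℂ v hv).rep).re
  rw [e, herm_self_re_smul]
  positivity

/-- The orthogonal complement of a negative line is positive definite. -/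
theorem herm_self_pos_of_orthogonal {r v : C21} (hr : (herm r r).re < 0) (hv : v ≠ 0)
    (h : herm v r = 0) : 0 < (herm v v).re := by
  have key : ∀ u : C21, (herm u u).re = ‖u 0‖ ^ 2 + ‖u 1‖ ^ 2 - ‖u 2‖ ^ 2 := by
    intro u
    simp only [herm_apply, Complex.mul_conj, Complex.normSq_eq_norm_sq]
    norm_cast
  rw [key] at hr ⊢
  rw [herm_apply] at h
  -- Orthogonality bounds the product of the third coordinates by the others. With `⟨v, v⟩ ≤ 0` and
  -- `⟨r, r⟩ < 0`, Cauchy–Schwarz then forces `v 2 = 0`, and so `v = 0`.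
  have h1 : ‖v 2‖ * ‖r 2‖ ≤ ‖v 0‖ * ‖r 0‖ + ‖v 1‖ * ‖r 1‖ := by
    have : v 2 * conj (r 2) = v 0 * conj (r 0) + v 1 * conj (r 1) := by linear_combination -h
    have h2 := norm_add_le (v 0 * conj (r 0)) (v 1 * conj (r 1))
    rw [← this] at h2
    simpa only [norm_mul, Complex.norm_conj] using h2
  by_contra hle
  rw [not_lt] at hle
  have p0 := norm_nonneg (v 0)
  have p1 := norm_nonneg (v 1)
  have p2 := norm_nonneg (v 2)
  have q0 := norm_nonneg (r 0)
  have q1 := norm_nonneg (r 1)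
  have q2 := norm_nonneg (r 2)
  have hcs : (‖v 0‖ * ‖r 0‖ + ‖v 1‖ * ‖r 1‖) ^ 2
      ≤ (‖v 0‖ ^ 2 + ‖v 1‖ ^ 2) * (‖r 0‖ ^ 2 + ‖r 1‖ ^ 2) := by
    nlinarith [sq_nonneg (‖v 0‖ * ‖r 1‖ - ‖v 1‖ * ‖r 0‖)]
  have h3 : (‖v 2‖ * ‖r 2‖) ^ 2 ≤ (‖v 0‖ * ‖r 0‖ + ‖v 1‖ * ‖r 1‖) ^ 2 :=
    pow_le_pow_left₀ (by positivity) h1 2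
  have hv2 : ‖v 2‖ ^ 2 = 0 := by
    by_contra hne
    have hpos : 0 < ‖v 2‖ ^ 2 := lt_of_le_of_ne (sq_nonneg _) (Ne.symm hne)
    have h4 : (‖v 0‖ ^ 2 + ‖v 1‖ ^ 2) * (‖r 0‖ ^ 2 + ‖r 1‖ ^ 2)
        ≤ ‖v 2‖ ^ 2 * (‖r 0‖ ^ 2 + ‖r 1‖ ^ 2) := by
      gcongr
      linarith
    have h5 : ‖v 2‖ ^ 2 * (‖r 0‖ ^ 2 + ‖r 1‖ ^ 2) < ‖v 2‖ ^ 2 * ‖r 2‖ ^ 2 := by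
      gcongr
      linarith
    rw [mul_pow] at h3
    linarith
  have hv0 : ‖v 0‖ ^ 2 = 0 := le_antisymm (by nlinarith [sq_nonneg ‖v 1‖]) (sq_nonneg _)
  have hv1 : ‖v 1‖ ^ 2 = 0 := le_antisymm (by nlinarith [sq_nonneg ‖v 0‖]) (sq_nonneg _)
  refine hv (funext fun i => ?_)
  fin_cases i
  · simpa using hv0
  · simpa using hv1
  · simpa using hv2

/-- Three mutually orthogonal lines that are not null span `ℂ^{2,1}`. -/
theorem projVec_add_projVec_add_projVec {u v w : C21} (hu : herm u u ≠ 0) (hv : herm v v ≠ 0)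
    (hw : herm w w ≠ 0) (huv : herm u v = 0) (huw : herm u w = 0) (hvw : herm v w = 0) :
    projVec u + projVec v + projVec w = 1 := by
  have hvu := herm_eq_zero_comm.1 huv
  have hwu := herm_eq_zero_comm.1 huw
  have hwv := herm_eq_zero_comm.1 hvw
  have li : LinearIndependent ℂ ![u, v, w] := by
    rw [Fintype.linearIndependent_iff]
    intro g hg
    simp only [Fin.sum_univ_three, Matrix.cons_val_zero, Matrix.cons_val_one,
      Matrix.cons_val] at hg
    have h0 := congrArg (fun x => herm x u) hg
    have h1 := congrArg (fun x => herm x v) hg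
    have h2 := congrArg (fun x => herm x w) hg
    simp only [herm_add_left, herm_smul_left, herm_zero_left, huv, huw, hvw, hvu, hwu, hwv,
      mul_zero, add_zero, zero_add, mul_eq_zero, hu, hv, hw, or_false] at h0 h1 h2
    intro i
    fin_cases i <;> assumption
  let b := basisOfLinearIndependentOfCardEqFinrank li (by simp)
  have hb : ∀ i, b i = ![u, v, w] i := fun i => by simp [b]
  have : ((projVec u + projVec v + projVec w : End21) : C21 →ₗ[ℂ] C21)
      = ((1 : End21) : C21 →ₗ[ℂ] C21) := by
    refine b.ext fun i => ?_
    rw [hb]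
    fin_cases i <;>
      simp [projVec_apply, huv, huw, hvw, hvu, hwu, hwv, hu, hv, hw]
  exact ContinuousLinearMap.coe_injective this

/-! ### Smoothness of maps into the projective plane -/

theorem isOpenEmbedding_unitDisc_coe : Topology.IsOpenEmbedding ((↑) : 𝔻 → ℂ) :=
  Metric.isOpen_ball.isOpenEmbedding_subtypeVal

theorem map_coe_nhds (z : 𝔻) : map ((↑) : 𝔻 → ℂ) (𝓝 z) = 𝓝 (z : ℂ) :=
  isOpenEmbedding_unitDisc_coe.map_nhds_eq z

theorem eventually_nhds_coe {z : 𝔻} {p : ℂ → Prop} :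
    (∀ᶠ w in 𝓝 (z : ℂ), p w) ↔ ∀ᶠ w : 𝔻 in 𝓝 z, p w := by
  rw [← map_coe_nhds, eventually_map]

theorem eventually_punctured_nhds_coe {z : 𝔻} {p : ℂ → Prop} :
    (∀ᶠ w in 𝓝[≠] (z : ℂ), p w) ↔ ∀ᶠ w : 𝔻 in 𝓝[≠] z, p w := by
  rw [eventually_nhdsWithin_iff, eventually_nhdsWithin_iff, eventually_nhds_coe]
  simp only [Set.mem_compl_iff, Set.mem_singleton_iff, Complex.UnitDisc.coe_inj]

theorem projAlong_coe (φ : 𝔻 → P21) (z : 𝔻) : projAlong φ z = lineProj (φ z) := by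
  rw [projAlong, dif_pos z.norm_lt_one, Complex.UnitDisc.mk_coe]

theorem projAlong_mul_self {φ : 𝔻 → P21} (hφ : ∀ z, NonNull (φ z)) (w : ℂ) :
    projAlong φ w * projAlong φ w = projAlong φ w := by
  unfold projAlong
  split_ifs
  · exact lineProj_mul_self (hφ _)
  · exact zero_mul _

theorem adj_projAlong (φ : 𝔻 → P21) (w : ℂ) : adj (projAlong φ w) = projAlong φ w := by
  unfold projAlong
  split_ifs
  · exact adj_lineProj _
  · exact map_zero _

section Bilinear

variable {E F G : Type*} [NormedAddCommGroup E] [NormedSpace ℂ E] [NormedAddCommGroup F]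
  [NormedSpace ℂ F] [NormedAddCommGroup G] [NormedSpace ℂ G]

theorem contDiffAt_clm_apply {L : ℂ → E →L[ℂ] F} {v : ℂ → E} {z : ℂ} {n : WithTop ℕ∞}
    (hL : ContDiffAt ℝ n L z) (hv : ContDiffAt ℝ n v z) :
    ContDiffAt ℝ n (fun w => L w (v w)) z :=
  (((ContinuousLinearMap.restrictScalarsL ℂ E F ℝ ℝ).contDiff.contDiffAt.comp z hL).clm_apply
    hv :)

theorem contDiffAt_clm_comp (B : E →L[ℂ] F →L[ℂ] G) {u : ℂ → E} {z : ℂ} {n : WithTop ℕ∞}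
    (hu : ContDiffAt ℝ n u z) : ContDiffAt ℝ n (fun w => B (u w)) z :=
  (B.restrictScalars ℝ).contDiff.contDiffAt.comp z hu

theorem contDiffAt_bilin (B : E →L[ℂ] F →L[ℂ] G) {u : ℂ → E} {v : ℂ → F} {z : ℂ}
    {n : WithTop ℕ∞} (hu : ContDiffAt ℝ n u z) (hv : ContDiffAt ℝ n v z) :
    ContDiffAt ℝ n (fun w => B (u w) (v w)) z :=
  contDiffAt_clm_apply (contDiffAt_clm_comp B hu) hv

end Bilinear

/-- The conjugate linear map `w ↦ ⟨·, w⟩`. -/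
noncomputable def hermDual : C21 →L[ℝ] (C21 →L[ℂ] ℂ) :=
  LinearMap.toContinuousLinearMap
    { toFun := fun w => LinearMap.toContinuousLinearMap (hermForm w)
      map_add' := fun u v => by
        ext1 x
        exact herm_add_right u v x
      map_smul' := fun c v => by
        ext1 x
        change herm x (c • v) = c • herm x v
        rw [← Complex.coe_smul, herm_smul_right, Complex.conj_ofReal]
        rfl }

theorem contDiffAt_herm {u v : ℂ → C21} {z : ℂ} {n : WithTop ℕ∞} (hu : ContDiffAt ℝ n u z)
    (hv : ContDiffAt ℝ n v z) : ContDiffAt ℝ n (fun w => herm (u w) (v w)) z :=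
  contDiffAt_clm_apply (hermDual.contDiff.contDiffAt.comp z hv) hu

theorem contDiffAt_projVec {u : ℂ → C21} {z : ℂ} {n : WithTop ℕ∞} (hu : ContDiffAt ℝ n u z)
    (h0 : herm (u z) (u z) ≠ 0) : ContDiffAt ℝ n (fun w => projVec (u w)) z := by
  have h1 : ContDiffAt ℝ n (fun w => (herm (u w) (u w))⁻¹ •
      ContinuousLinearMap.smulRightL ℂ C21 C21 (hermDual (u w)) (u w)) z :=
    ((contDiffAt_herm hu hu).inv h0).smul
      (contDiffAt_bilin _ (hermDual.contDiff.contDiffAt.comp z hu) hu)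
  exact h1

theorem contDiffAt_projAlong {φ : 𝔻 → P21} {z : 𝔻} (hφ : NonNull (φ z)) {n : WithTop ℕ∞}
    {σ : ℂ → C21} (hσ : ContDiffAt ℝ n σ z)
    (h : ∀ᶠ w : 𝔻 in 𝓝 z, σ w ≠ 0 ∧ σ w ∈ (φ w).submodule) :
    ContDiffAt ℝ n (projAlong φ) z := by
  obtain ⟨h0, hm⟩ := h.self_of_nhds
  have hz : herm (σ z) (σ z) ≠ 0 := by
    obtain ⟨c, hc⟩ := mem_submodule_iff.1 hm
    have hc0 : c ≠ 0 := by
      rintro rfl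
      exact h0 (by rw [← hc, zero_smul])
    rw [← hc, herm_smul_left, herm_smul_right]
    exact mul_ne_zero hc0 (mul_ne_zero ((map_ne_zero _).2 hc0) hφ)
  refine (contDiffAt_projVec hσ hz).congr_of_eventuallyEq ?_
  refine eventually_nhds_coe.2 (h.mono fun w hw => ?_)
  rw [projAlong_coe, lineProj_eq_projVec hw.2 hw.1]

/-- Projections replace local lifts by a single function with values in a fixed vector space. In one
direction the projection is a smooth function of the lift; in the other, projecting a fixed
generator of `φ z` gives a lift near `z`. -/
theorem isContDiff_iff {φ : 𝔻 → P21} (hφ : ∀ z, NonNull (φ z)) {n : WithTop ℕ∞} :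
    IsContDiff n φ ↔ ∀ z : 𝔻, ContDiffAt ℝ n (projAlong φ) z := by
  refine ⟨fun h z => ?_, fun h z => ?_⟩
  · obtain ⟨σ, hσ, hm⟩ := h z
    exact contDiffAt_projAlong (hφ z) hσ hm
  · have hc : ContDiffAt ℝ n (fun w => projAlong φ w (φ z).rep) z :=
      contDiffAt_clm_apply (h z) contDiffAt_const
    refine ⟨fun w => projAlong φ w (φ z).rep, hc, ?_⟩
    have h0 : projAlong φ z (φ z).rep ≠ 0 := by
      rw [projAlong_coe, lineProj_of_mem (hφ z) (rep_mem _)]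
      exact (φ z).rep_nonzero
    filter_upwards [eventually_nhds_coe.1 (hc.continuousAt.eventually_ne h0)] with w hw
    refine ⟨hw, ?_⟩
    rw [projAlong_coe]
    exact lineProj_apply_mem _ _

/-! ### Composition of endomorphisms -/

theorem end_mul_neg (A B : End21) : A * -B = -(A * B) := mul_neg A B

theorem end_neg_mul (A B : End21) : -A * B = -(A * B) := neg_mul A B

theorem end_mul_smul (c : ℂ) (A B : End21) : A * (c • B) = c • (A * B) := by
  ext1 v
  exact map_smul A c (B v)

theorem end_smul_mul (c : ℂ) (A B : End21) : (c • A) * B = c • (A * B) := rfl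

section Ring

variable {𝔸 : Type*} [Ring 𝔸] {P D A a : 𝔸}

/-- Multiply the Leibniz rule for `P² = P` by `P` on the left. -/
theorem idem_deriv_zero (hP : P * P = P) (hD : D * P + P * D = D) : P * D * P = 0 := by
  have h := congrArg (fun x => P * x) hD
  simp only [mul_add, ← mul_assoc, hP] at h
  simpa using h

/-- A derivation `D` of a projection `P` acts on `A = (1 - P) A P` by a commutator up to its
part in `(1 - P) · P`. -/
theorem deriv_eq_of_homPart_eq_zero (h1 : a * P + A * D = a) (h2 : D * A + P * a = 0)
    (h3 : (1 - P) * a * P = 0) (h4 : A * P = A) : a = A * D - D * A := by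
  have h5 : a * P = P * a * P := by rwa [sub_mul, sub_mul, one_mul, sub_eq_zero] at h3
  have h6 : P * a = -(D * A) := eq_neg_of_add_eq_zero_right h2
  calc a = P * a * P + A * D := by rw [← h5, h1]
    _ = A * D - D * A := by rw [h6, neg_mul, mul_assoc, h4]; abel

/-- The counterpart for `A` in `P · (1 - P)`: here `h1` and `h2` are the differentiated forms of `P
A = A` and `A P = 0`, and `h3` is the harmonic equation for the `T''` part. -/
theorem deriv_eq_of_homPart'_eq_zero (h1 : D * A + P * a = a) (h2 : a * P + A * D = 0)
    (h3 : P * a * (1 - P) = 0) (h4 : P * A = A) : a = D * A - A * D := by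
  have h5 : P * a = P * (a * P) := by rwa [mul_sub, mul_one, sub_eq_zero, mul_assoc] at h3
  have h6 : a * P = -(A * D) := eq_neg_of_add_eq_zero_left h2
  calc a = D * A + P * (a * P) := by rw [← h5, h1]
    _ = D * A - A * D := by rw [h6, mul_neg, ← mul_assoc, h4]; abel

end Ring

/-! ### First derivatives of a family of projections -/

section Projections

variable {φ : 𝔻 → P21} {z : ℂ}

theorem dZ_projAlong (hφ : ∀ z, NonNull (φ z)) (hd : DifferentiableAt ℝ (projAlong φ) z) :
    dZ (projAlong φ) z * projAlong φ z + projAlong φ z * dZ (projAlong φ) z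
      = dZ (projAlong φ) z := by
  rw [← dZ_mul hd hd]
  exact dZ_congr (.of_forall (projAlong_mul_self hφ))

theorem dZbar_projAlong (hφ : ∀ z, NonNull (φ z)) (hd : DifferentiableAt ℝ (projAlong φ) z) :
    dZbar (projAlong φ) z * projAlong φ z + projAlong φ z * dZbar (projAlong φ) z
      = dZbar (projAlong φ) z := by
  rw [← dZbar_mul hd hd]
  exact dZbar_congr (.of_forall (projAlong_mul_self hφ))

theorem adj_dZ_projAlong (hd : DifferentiableAt ℝ (projAlong φ) z) :
    adj (dZ (projAlong φ) z) = dZbar (projAlong φ) z := by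
  rw [← dZbar_adj hd]
  exact dZbar_congr (.of_forall (adj_projAlong φ))

theorem adj_dZbar_projAlong (hd : DifferentiableAt ℝ (projAlong φ) z) :
    adj (dZbar (projAlong φ) z) = dZ (projAlong φ) z := by
  rw [← adj_dZ_projAlong hd, adj_adj]

theorem homPart_eq {P D : End21} (hP : P * P = P) (hD : D * P + P * D = D) :
    homPart P D = D * P := by
  rw [homPart, sub_mul, sub_mul, one_mul, idem_deriv_zero hP hD, sub_zero]

theorem homPart'_eq {P D : End21} (hP : P * P = P) (hD : D * P + P * D = D) :
    homPart' P D = P * D := by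
  rw [homPart', mul_sub, mul_one, idem_deriv_zero hP hD, sub_zero]

theorem delPrime_eq (hφ : ∀ z, NonNull (φ z)) (hd : DifferentiableAt ℝ (projAlong φ) z) :
    delPrime φ z = dZ (projAlong φ) z * projAlong φ z :=
  homPart_eq (projAlong_mul_self hφ z) (dZ_projAlong hφ hd)

theorem delbarPrime_eq (hφ : ∀ z, NonNull (φ z)) (hd : DifferentiableAt ℝ (projAlong φ) z) :
    delbarPrime φ z = dZbar (projAlong φ) z * projAlong φ z :=
  homPart_eq (projAlong_mul_self hφ z) (dZbar_projAlong hφ hd)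

theorem delSecond_eq (hφ : ∀ z, NonNull (φ z)) (hd : DifferentiableAt ℝ (projAlong φ) z) :
    delSecond φ z = -(projAlong φ z * dZ (projAlong φ) z) := by
  rw [delSecond, homPart'_eq (projAlong_mul_self hφ z) (dZ_projAlong hφ hd)]

/-- The differential of `P` along `Z` is adjoint to the one along `Z̄`. This transfers to `∂̄f'` the
zeros and the leading terms of `∂f''`, for which a `∂̄` equation is available. -/
theorem adj_delSecond (hφ : ∀ z, NonNull (φ z)) (hd : DifferentiableAt ℝ (projAlong φ) z) :
    adj (delSecond φ z) = -delbarPrime φ z := by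
  rw [delSecond_eq hφ hd, map_neg, adj_mul, adj_projAlong, adj_dZ_projAlong hd,
    delbarPrime_eq hφ hd]

theorem delSecond_eq_zero_iff (hφ : ∀ z, NonNull (φ z))
    (hd : DifferentiableAt ℝ (projAlong φ) z) : delSecond φ z = 0 ↔ delbarPrime φ z = 0 := by
  rw [← adj_eq_zero, adj_delSecond hφ hd, neg_eq_zero]

variable (φ z) in
theorem mul_projAlong_of_homPart (hφ : ∀ z, NonNull (φ z)) (X : End21) :
    homPart (projAlong φ z) X * projAlong φ z = homPart (projAlong φ z) X ∧
    projAlong φ z * homPart (projAlong φ z) X = 0 := by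
  have h := projAlong_mul_self hφ z
  constructor
  · rw [homPart, mul_assoc _ _ (projAlong φ z), h]
  · rw [homPart, mul_assoc, ← mul_assoc, mul_sub, h, mul_one, sub_self, zero_mul]

variable (φ z) in
theorem mul_projAlong_of_homPart' (hφ : ∀ z, NonNull (φ z)) (X : End21) :
    projAlong φ z * homPart' (projAlong φ z) X = homPart' (projAlong φ z) X ∧
    homPart' (projAlong φ z) X * projAlong φ z = 0 := by
  have h := projAlong_mul_self hφ z
  constructor
  · rw [homPart', mul_assoc, ← mul_assoc, h]
  · rw [homPart', mul_assoc, sub_mul, h, one_mul, sub_self, mul_zero]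

theorem contDiffAt_homPart {P X : ℂ → End21} {n : WithTop ℕ∞} (hP : ContDiffAt ℝ n P z)
    (hX : ContDiffAt ℝ n X z) : ContDiffAt ℝ n (fun w => homPart (P w) (X w)) z :=
  ((contDiffAt_const.sub hP).mul hX).mul hP

theorem contDiffAt_homPart' {P X : ℂ → End21} {n : WithTop ℕ∞} (hP : ContDiffAt ℝ n P z)
    (hX : ContDiffAt ℝ n X z) : ContDiffAt ℝ n (fun w => homPart' (P w) (X w)) z :=
  (hP.mul hX).mul (contDiffAt_const.sub hP)

theorem contDiffAt_delPrime (h : ContDiffAt ℝ ∞ (projAlong φ) z) :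
    ContDiffAt ℝ ∞ (delPrime φ) z := contDiffAt_homPart h (contDiffAt_dZ_infty h)

theorem contDiffAt_delbarPrime (h : ContDiffAt ℝ ∞ (projAlong φ) z) :
    ContDiffAt ℝ ∞ (delbarPrime φ) z := contDiffAt_homPart h (contDiffAt_dZbar_infty h)

theorem contDiffAt_delSecond (h : ContDiffAt ℝ ∞ (projAlong φ) z) :
    ContDiffAt ℝ ∞ (delSecond φ) z := (contDiffAt_homPart' h (contDiffAt_dZ_infty h)).neg

theorem dPrime_eq (φ : 𝔻 → P21) (z X : ℂ) :
    dPrime φ z X = X • delPrime φ z + conj X • delbarPrime φ z := by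
  rw [dPrime, fderiv_eq_dZ_add_dZbar, delPrime, delbarPrime]
  simp only [homPart, mul_add, add_mul, end_mul_smul, end_smul_mul]

end Projections

/-! ### The structure equations of a minimal map -/

/-- The structure equations of a branched minimal map in terms of `P = π_φ`. -/
structure StructureEquations (φ : 𝔻 → P21) : Prop where
  neg : ∀ z, φ z ∈ CH2
  smooth : ∀ z : 𝔻, ContDiffAt ℝ ∞ (projAlong φ) z
  dZbar_delPrime : ∀ z : 𝔻, dZbar (delPrime φ) z
    = delPrime φ z * dZbar (projAlong φ) z - dZbar (projAlong φ) z * delPrime φ z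
  dZbar_delSecond : ∀ z : 𝔻, dZbar (delSecond φ) z
    = dZbar (projAlong φ) z * delSecond φ z - delSecond φ z * dZbar (projAlong φ) z
  conformal : ∀ z : 𝔻, delSecond φ z * delPrime φ z = 0

namespace StructureEquations

variable {φ : 𝔻 → P21}

theorem nonNull (h : StructureEquations φ) (z : 𝔻) : NonNull (φ z) := nonNull_of_mem_CH2 (h.neg z)

theorem differentiableAt (h : StructureEquations φ) (z : 𝔻) : DifferentiableAt ℝ (projAlong φ) z :=
  (h.smooth z).differentiableAt (by simp)

end StructureEquations

/-- `⟨X r, ∂̄φ'(Z̄) r⟩ = -⟨∂φ''(Z) X r, r⟩` vanishes only if `∂φ''(Z) X` vanishes. -/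
theorem tangentMetric_delbarPrime_eq_zero_iff {φ : 𝔻 → P21} (hφ : ∀ z, NonNull (φ z)) {z : 𝔻}
    (hd : DifferentiableAt ℝ (projAlong φ) z) {X : End21} (hX : X * projAlong φ z = X) :
    tangentMetric (φ z) X (delbarPrime φ z) = 0 ↔ delSecond φ z * X = 0 := by
  set r := (φ z).rep
  have hr : herm r r ≠ 0 := hφ z
  have hre : (herm r r).re ≠ 0 := by
    intro h0
    apply hr
    apply Complex.ext h0
    have := congrArg Complex.im (herm_conj r r)
    simp only [Complex.conj_im] at this
    simp only [Complex.zero_im]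
    linarith
  have e : herm (X r) (delbarPrime φ z r) = -herm ((delSecond φ z * X) r) r := by
    have : delbarPrime φ z r = -adj (delSecond φ z) r := by
      rw [adj_delSecond hφ hd, neg_apply, neg_neg]
    rw [this, mul_apply_eq_comp, ← neg_one_smul ℂ, herm_smul_right, ← herm_adj]
    simp
  have hS : projAlong φ z * delSecond φ z = delSecond φ z := by
    rw [delSecond, end_mul_neg, (mul_projAlong_of_homPart' φ z hφ _).1]
  rw [tangentMetric, div_eq_zero_iff, e]
  have : ((|(herm r r).re| : ℝ) : ℂ) ≠ 0 := by exact_mod_cast abs_ne_zero.2 hre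
  rw [or_iff_left this, neg_eq_zero]
  constructor
  · intro h0
    refine eq_zero_of_mul_lineProj (ℓ := φ z) ?_ ?_
    · rw [← projAlong_coe, mul_assoc, hX]
    · have hm : (delSecond φ z * X) r ∈ (φ z).submodule := by
        rw [← hS, mul_assoc, mul_apply_eq_comp, projAlong_coe]
        exact lineProj_apply_mem _ _
      obtain ⟨c, hc⟩ := mem_submodule_iff.1 hm
      change (delSecond φ z * X) r = 0
      rw [← hc, herm_smul_left] at h0
      rw [← hc, (mul_eq_zero.1 h0).resolve_right hr, zero_smul]
  · intro h0
    rw [h0]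
    exact herm_zero_left _

/-- Harmonicity kills one block of `∂̄` of `∂f'` and of `∂f''`; differentiating the block relations
`A P = A`, `P A = 0` and `P S = S`, `S P = 0` determines the rest, and the result is a commutator
with `∂̄P`. Conformality becomes `∂f'' ∂f' = 0` because `∂̄f'` is minus the adjoint of `∂f''`. -/
theorem IsBranchedMinimal.structureEquations {f : 𝔻 → CH2} (hf : IsBranchedMinimal f) :
    StructureEquations (fun w => (f w : P21)) := by
  set φ : 𝔻 → P21 := fun w => (f w : P21)
  have hN : ∀ z, NonNull (φ z) := fun z => nonNull_of_mem_CH2 (f z).2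
  have hs := (isContDiff_iff hN).1 hf.smooth
  have hd : ∀ z : 𝔻, DifferentiableAt ℝ (projAlong φ) z := fun z =>
    (hs z).differentiableAt (by simp)
  refine ⟨fun z => (f z).2, hs, fun z => ?_, fun z => ?_, fun z => ?_⟩
  · have hA : DifferentiableAt ℝ (delPrime φ) z :=
      (contDiffAt_delPrime (hs z)).differentiableAt (by simp)
    have h1 : dZbar (delPrime φ) z * projAlong φ z + delPrime φ z * dZbar (projAlong φ) z
        = dZbar (delPrime φ) z := by
      rw [← dZbar_mul hA (hd z)]
      exact dZbar_congr (.of_forall fun w => (mul_projAlong_of_homPart φ w hN _).1)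
    have h2 : dZbar (projAlong φ) z * delPrime φ z + projAlong φ z * dZbar (delPrime φ) z
        = 0 := by
      rw [← dZbar_mul (hd z) hA, ← dZbar_const (0 : End21) (z : ℂ)]
      exact dZbar_congr (.of_forall fun w => (mul_projAlong_of_homPart φ w hN _).2)
    have h3 := (hf.harmonic z).1
    have h4 : delPrime φ z * projAlong φ z = delPrime φ z :=
      (mul_projAlong_of_homPart φ z hN _).1
    rw [homPart, ← projAlong_coe φ] at h3
    exact deriv_eq_of_homPart_eq_zero h1 h2 h3 h4
  · have hS : DifferentiableAt ℝ (delSecond φ) z :=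
      (contDiffAt_delSecond (hs z)).differentiableAt (by simp)
    have e1 : ∀ w, projAlong φ w * delSecond φ w = delSecond φ w := fun w => by
      rw [delSecond, end_mul_neg, (mul_projAlong_of_homPart' φ w hN _).1]
    have e2 : ∀ w, delSecond φ w * projAlong φ w = 0 := fun w => by
      rw [delSecond, end_neg_mul, (mul_projAlong_of_homPart' φ w hN _).2, neg_zero]
    have h1 : dZbar (projAlong φ) z * delSecond φ z + projAlong φ z * dZbar (delSecond φ) z
        = dZbar (delSecond φ) z := by
      rw [← dZbar_mul (hd z) hS]
      exact dZbar_congr (.of_forall e1)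
    have h2 : dZbar (delSecond φ) z * projAlong φ z + delSecond φ z * dZbar (projAlong φ) z
        = 0 := by
      rw [← dZbar_mul hS (hd z), ← dZbar_const (0 : End21) (z : ℂ)]
      exact dZbar_congr (.of_forall e2)
    have h3 := (hf.harmonic z).2
    rw [homPart', ← projAlong_coe φ] at h3
    have h4 := e1 z
    exact deriv_eq_of_homPart'_eq_zero h1 h2 h3 h4
  · exact (tangentMetric_delbarPrime_eq_zero_iff hN (hd z)
      (mul_projAlong_of_homPart φ z hN _).1).1 (hf.conformal z)

/-! ### The `∂̄`-Gauss transform -/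

theorem eq_of_eventually_eq_punctured {X : Type*} [TopologicalSpace X] [T2Space X]
    {F G : ℂ → X} {z : ℂ} (hF : ContinuousAt F z) (hG : ContinuousAt G z)
    (h : ∀ᶠ w in 𝓝[≠] z, F w = G w) : F z = G z :=
  tendsto_nhds_unique (hF.tendsto.mono_left nhdsWithin_le_nhds)
    ((hG.tendsto.mono_left nhdsWithin_le_nhds).congr' (h.mono fun _ h => h.symm))

theorem lineProj_apply_eq_zero_iff {ℓ : P21} (h : NonNull ℓ) {v : C21} :
    lineProj ℓ v = 0 ↔ herm v ℓ.rep = 0 := by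
  rw [lineProj_eq_projVec_rep, projVec_apply, smul_eq_zero, or_iff_left ℓ.rep_nonzero,
    mul_eq_zero, or_iff_right (inv_ne_zero h)]

theorem mem_ball_of_unitDisc (z : 𝔻) : (z : ℂ) ∈ Metric.ball (0 : ℂ) 1 :=
  mem_ball_zero_iff.2 z.norm_lt_one

theorem exists_coe_of_mem_ball {w : ℂ} (hw : w ∈ Metric.ball (0 : ℂ) 1) : ∃ z : 𝔻, (z : ℂ) = w :=
  ⟨Complex.UnitDisc.mk w (mem_ball_zero_iff.1 hw), rfl⟩

namespace StructureEquations

variable {φ : 𝔻 → P21}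

theorem delPrime_mul (h : StructureEquations φ) (w : ℂ) :
    delPrime φ w * projAlong φ w = delPrime φ w :=
  (mul_projAlong_of_homPart φ w h.nonNull _).1

theorem mul_delPrime (h : StructureEquations φ) (w : ℂ) :
    projAlong φ w * delPrime φ w = 0 :=
  (mul_projAlong_of_homPart φ w h.nonNull _).2

theorem delbarPrime_mul (h : StructureEquations φ) (w : ℂ) :
    delbarPrime φ w * projAlong φ w = delbarPrime φ w :=
  (mul_projAlong_of_homPart φ w h.nonNull _).1

theorem mul_delbarPrime (h : StructureEquations φ) (w : ℂ) :
    projAlong φ w * delbarPrime φ w = 0 :=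
  (mul_projAlong_of_homPart φ w h.nonNull _).2

theorem mul_delSecond (h : StructureEquations φ) (w : ℂ) :
    projAlong φ w * delSecond φ w = delSecond φ w := by
  rw [delSecond, end_mul_neg, (mul_projAlong_of_homPart' φ w h.nonNull _).1]

theorem delSecond_mul (h : StructureEquations φ) (w : ℂ) :
    delSecond φ w * projAlong φ w = 0 := by
  rw [delSecond, end_neg_mul, (mul_projAlong_of_homPart' φ w h.nonNull _).2, neg_zero]

theorem contDiffAt_mulLeft (h : StructureEquations φ) (z : 𝔻) :
    ContDiffAt ℝ ∞ (fun w => ContinuousLinearMap.compL ℂ C21 C21 C21 (dZbar (projAlong φ) w)) z :=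
  contDiffAt_clm_comp (ContinuousLinearMap.compL ℂ C21 C21 C21)
    (contDiffAt_dZbar_infty (h.smooth z))

theorem contDiffAt_mulRight (h : StructureEquations φ) (z : 𝔻) :
    ContDiffAt ℝ ∞ (fun w => (ContinuousLinearMap.compL ℂ C21 C21 C21).flip (dZbar (projAlong φ) w)) z :=
  contDiffAt_clm_comp (ContinuousLinearMap.compL ℂ C21 C21 C21).flip
    (contDiffAt_dZbar_infty (h.smooth z))

/-- The structure equation is `∂̄F = L F` on the connected disc, with `L` the commutator with `∂̄P`,
left minus right multiplication. Non-triviality passes from `∂̄f'` to its adjoint. -/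
theorem leading_delSecond (h : StructureEquations φ) (hne : ∃ z : 𝔻, delbarPrime φ z ≠ 0)
    (z : 𝔻) : ∃ (k : ℕ) (a : End21), a ≠ 0 ∧
      (fun w => delSecond φ w - (w - z) ^ k • a) =O[𝓝 (z : ℂ)] fun w => ‖w - z‖ ^ (k + 1) := by
  refine exists_leading_of_preconnected (U := Metric.ball 0 1)
    (L := fun w => ContinuousLinearMap.compL ℂ C21 C21 C21 (dZbar (projAlong φ) w)
      - (ContinuousLinearMap.compL ℂ C21 C21 C21).flip (dZbar (projAlong φ) w))
    (convex_ball 0 1).isPreconnected Metric.isOpen_ball (fun w hw => ?_) (fun w hw => ?_)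
    (fun w hw => ?_) ?_ (mem_ball_of_unitDisc z)
  · obtain ⟨w, rfl⟩ := exists_coe_of_mem_ball hw
    exact contDiffAt_delSecond (h.smooth w)
  · obtain ⟨w, rfl⟩ := exists_coe_of_mem_ball hw
    exact (h.contDiffAt_mulLeft w).sub (h.contDiffAt_mulRight w)
  · obtain ⟨w, rfl⟩ := exists_coe_of_mem_ball hw
    exact h.dZbar_delSecond w
  · obtain ⟨w, hw⟩ := hne
    exact ⟨w, mem_ball_of_unitDisc w,
      (delSecond_eq_zero_iff h.nonNull (h.differentiableAt w)).not.2 hw⟩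

theorem leading_delPrime (h : StructureEquations φ) (hne : ∃ z : 𝔻, delPrime φ z ≠ 0)
    (z : 𝔻) : ∃ (k : ℕ) (a : End21), a ≠ 0 ∧
      (fun w => delPrime φ w - (w - z) ^ k • a) =O[𝓝 (z : ℂ)] fun w => ‖w - z‖ ^ (k + 1) := by
  refine exists_leading_of_preconnected (U := Metric.ball 0 1)
    (L := fun w => (ContinuousLinearMap.compL ℂ C21 C21 C21).flip (dZbar (projAlong φ) w)
      - ContinuousLinearMap.compL ℂ C21 C21 C21 (dZbar (projAlong φ) w))
    (convex_ball 0 1).isPreconnected Metric.isOpen_ball (fun w hw => ?_) (fun w hw => ?_)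
    (fun w hw => ?_) ?_ (mem_ball_of_unitDisc z)
  · obtain ⟨w, rfl⟩ := exists_coe_of_mem_ball hw
    exact contDiffAt_delPrime (h.smooth w)
  · obtain ⟨w, rfl⟩ := exists_coe_of_mem_ball hw
    exact (h.contDiffAt_mulRight w).sub (h.contDiffAt_mulLeft w)
  · obtain ⟨w, rfl⟩ := exists_coe_of_mem_ball hw
    exact h.dZbar_delPrime w
  · obtain ⟨w, hw⟩ := hne
    exact ⟨w, mem_ball_of_unitDisc w, hw⟩

theorem eventually_delPrime_ne_zero (h : StructureEquations φ)
    (hne : ∃ z : 𝔻, delPrime φ z ≠ 0) (z : 𝔻) : ∀ᶠ w : 𝔻 in 𝓝[≠] z, delPrime φ w ≠ 0 := by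
  obtain ⟨k, a, ha, hO⟩ := h.leading_delPrime hne z
  exact eventually_punctured_nhds_coe.1 (eventually_ne_zero_of_leading ha hO)

theorem eventually_delSecond_ne_zero (h : StructureEquations φ)
    (hne : ∃ z : 𝔻, delbarPrime φ z ≠ 0) (z : 𝔻) :
    ∀ᶠ w : 𝔻 in 𝓝[≠] z, delSecond φ w ≠ 0 := by
  obtain ⟨k, a, ha, hO⟩ := h.leading_delSecond hne z
  exact eventually_punctured_nhds_coe.1 (eventually_ne_zero_of_leading ha hO)

theorem eventually_delbarPrime_ne_zero (h : StructureEquations φ)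
    (hne : ∃ z : 𝔻, delbarPrime φ z ≠ 0) (z : 𝔻) :
    ∀ᶠ w : 𝔻 in 𝓝[≠] z, delbarPrime φ w ≠ 0 :=
  (h.eventually_delSecond_ne_zero hne z).mono fun w hw =>
    (delSecond_eq_zero_iff h.nonNull (h.differentiableAt w)).not.1 hw

/-- Near a zero, `∂̄φ'(Z̄)` can be rescaled to have a non-zero limit. -/
theorem exists_rescaled_limit (h : StructureEquations φ) (hne : ∃ z : 𝔻, delbarPrime φ z ≠ 0)
    (z : 𝔻) : ∃ (b : End21) (c : ℂ → ℂ), b ≠ 0 ∧ (∀ w ≠ (z : ℂ), c w ≠ 0 ∧ ContinuousAt c w) ∧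
      Tendsto (fun w => c w • delbarPrime φ w) (𝓝[≠] (z : ℂ)) (𝓝 b) ∧
      (delbarPrime φ z ≠ 0 → b = delbarPrime φ z) := by
  by_cases hz : delbarPrime φ z = 0
  · obtain ⟨k, a, ha, hO⟩ := h.leading_delSecond hne z
    -- Taking adjoints conjugates scalars, so `∂̄f'` has leading term `-conj ((w - z)^k) • adj a`;
    -- the multiplier inverts this scalar.
    refine ⟨adj a, fun w => -conj (((w - z) ^ k)⁻¹), fun h0 => ha (adj_eq_zero.1 h0),
      fun w hw => ⟨?_, ?_⟩, ?_, fun h0 => absurd hz h0⟩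
    · rw [neg_ne_zero, map_ne_zero]
      exact inv_ne_zero (pow_ne_zero _ (sub_ne_zero.2 hw))
    · refine (Complex.continuous_conj.continuousAt.comp (ContinuousAt.inv₀ ?_ ?_)).neg
      · fun_prop
      · exact pow_ne_zero _ (sub_ne_zero.2 hw)
    · refine ((adj.continuous.tendsto a).comp (tendsto_leading hO)).congr' ?_
      filter_upwards [nhdsWithin_le_nhds (Metric.isOpen_ball.mem_nhds (mem_ball_of_unitDisc z))]
        with w hw
      obtain ⟨w, rfl⟩ := exists_coe_of_mem_ball hw
      rw [Function.comp_apply, adj_smul, adj_delSecond h.nonNull (h.differentiableAt w), smul_neg]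
      exact (neg_smul (R := ℂ) _ _).symm
  · refine ⟨delbarPrime φ z, fun _ => 1, hz, fun _ _ => ⟨one_ne_zero, continuousAt_const⟩, ?_,
      fun _ => rfl⟩
    simp only [one_smul]
    exact (contDiffAt_delbarPrime (h.smooth z)).continuousAt.tendsto.mono_left nhdsWithin_le_nhds

/-- The block relations of `∂̄f'` are closed conditions and pass to the limit, so `b` still maps `f
z` into its orthogonal complement. -/
theorem rescaled_limit_mul (h : StructureEquations φ) {z : 𝔻} {b : End21} {c : ℂ → ℂ}
    (hb : Tendsto (fun w => c w • delbarPrime φ w) (𝓝[≠] (z : ℂ)) (𝓝 b)) :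
    b * projAlong φ z = b ∧ projAlong φ z * b = 0 := by
  have hP : Tendsto (projAlong φ) (𝓝[≠] (z : ℂ)) (𝓝 (projAlong φ z)) :=
    (h.smooth z).continuousAt.tendsto.mono_left nhdsWithin_le_nhds
  constructor
  · refine tendsto_nhds_unique (hb.mul hP) (hb.congr fun w => ?_)
    rw [end_smul_mul, h.delbarPrime_mul]
  · refine tendsto_nhds_unique (hP.mul hb) (tendsto_const_nhds.congr fun w => ?_)
    rw [end_mul_smul, h.mul_delbarPrime]
    exact (smul_zero (A := End21) (c w)).symm

end StructureEquations

theorem range_eq_span {ℓ : P21} {X : End21} (hX : X * lineProj ℓ = X) :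
    LinearMap.range (X : C21 →ₗ[ℂ] C21) = Submodule.span ℂ {X ℓ.rep} := by
  refine le_antisymm ?_ ?_
  · rintro _ ⟨v, rfl⟩
    have e : X v = X (lineProj ℓ v) := by rw [← mul_apply_eq_comp, hX]
    rw [ContinuousLinearMap.coe_coe, e, lineProj_eq_projVec_rep, projVec_apply, map_smul]
    exact Submodule.smul_mem _ _ (Submodule.mem_span_singleton_self _)
  · rw [Submodule.span_singleton_le_iff_mem]
    exact ⟨ℓ.rep, rfl⟩

/-- The line at `z` is spanned by the rescaled limit `b z` applied to a generator of `f z`. This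
vector is non-zero and orthogonal to a negative line, so it is positive. -/
theorem exists_isDelbarGaussTransform {f : 𝔻 → CH2}
    (h : StructureEquations (fun w => (f w : P21)))
    (hne : ∃ z : 𝔻, delbarPrime (fun w => (f w : P21)) z ≠ 0) :
    ∃ φ₂ : 𝔻 → CdS2, IsDelbarGaussTransform f φ₂ := by
  set φ : 𝔻 → P21 := fun w => (f w : P21) with hφ
  choose b c hb0 hc hlim hbz using h.exists_rescaled_limit hne
  have hbr : ∀ z, b z (φ z).rep ≠ 0 := fun z h0 => hb0 z <| by
    refine eq_zero_of_mul_lineProj (ℓ := φ z) ?_ h0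
    rw [← projAlong_coe]
    exact (h.rescaled_limit_mul (hlim z)).1
  have hpos : ∀ z, 0 < (herm (b z (φ z).rep) (b z (φ z).rep)).re := fun z => by
    refine herm_self_pos_of_orthogonal (h.neg z) (hbr z) ?_
    rw [← lineProj_apply_eq_zero_iff (h.nonNull z), ← projAlong_coe, ← mul_apply_eq_comp,
      (h.rescaled_limit_mul (hlim z)).2]
    rfl
  have hrange : ∀ z : 𝔻, delbarPrime φ z ≠ 0 →
      LinearMap.range (delbarPrime φ z : C21 →ₗ[ℂ] C21)
        = (Projectivization.mk ℂ _ (hbr z)).submodule := by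
    intro z hz
    rw [Projectivization.submodule_mk, hbz z hz]
    exact range_eq_span (by rw [← projAlong_coe, h.delbarPrime_mul])
  refine ⟨fun z => ⟨Projectivization.mk ℂ _ (hbr z), mk_mem_CdS2 _ (hpos z)⟩, fun z => ?_, hrange⟩
  set r := (φ z).rep
  -- A continuous lift near `z`: the rescaled `∂̄f'` applied to the fixed vector `r`, completed at
  -- `z` by its limit.
  set σ : ℂ → C21 := Function.update (fun w => c z w • delbarPrime φ w r) z (b z r) with hσ
  have hσz : ContinuousAt σ z := by
    rw [continuousAt_update_same]
    exact ((ContinuousLinearMap.apply ℂ C21 r).continuous.tendsto _).comp (hlim z)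
  refine ⟨σ, contDiffAt_zero.2 ⟨Metric.ball 0 1,
    Metric.isOpen_ball.mem_nhds (mem_ball_of_unitDisc z), fun w hw => ?_⟩, ?_⟩
  · refine ContinuousAt.continuousWithinAt ?_
    by_cases hwz : w = z
    · rw [hwz]
      exact hσz
    · rw [continuousAt_update_of_ne hwz]
      obtain ⟨w, rfl⟩ := exists_coe_of_mem_ball hw
      exact (hc z w hwz).2.smul
        ((contDiffAt_delbarPrime (h.smooth w)).continuousAt.clm_apply continuousAt_const)
  · have h0 : σ z ≠ 0 := by
      rw [hσ, Function.update_self]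
      exact hbr z
    filter_upwards [eventually_nhds_coe.1 (hσz.eventually_ne h0),
      eventually_nhdsWithin_iff.1 (h.eventually_delbarPrime_ne_zero hne z)] with w hw hw'
    refine ⟨hw, ?_⟩
    by_cases hwz : w = z
    · rw [hwz, hσ, Function.update_self]
      exact Submodule.mem_span_singleton_self _
    · rw [← hrange w (hw' hwz), hσ,
        Function.update_of_ne (by rwa [ne_eq, Complex.UnitDisc.coe_inj])]
      exact Submodule.smul_mem _ _ ⟨r, rfl⟩

theorem continuousAt_projAlong_of_isContDiff_zero {φ : 𝔻 → CdS2}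
    (hφ : IsContDiff 0 (fun z => (φ z : P21))) (z : 𝔻) :
    ContinuousAt (projAlong (fun z => (φ z : P21))) z :=
  ((isContDiff_iff fun z => nonNull_of_mem_CdS2 (φ z).2).1 hφ z).continuousAt

/-- Two transforms agree off the isolated zeros of `∂̄f'`, hence everywhere by continuity of their
projections. -/
theorem IsDelbarGaussTransform.unique {f : 𝔻 → CH2}
    (h : StructureEquations (fun w => (f w : P21)))
    (hne : ∃ z : 𝔻, delbarPrime (fun w => (f w : P21)) z ≠ 0) {φ₂ φ₂' : 𝔻 → CdS2}
    (h₂ : IsDelbarGaussTransform f φ₂) (h₂' : IsDelbarGaussTransform f φ₂') : φ₂ = φ₂' := by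
  funext z
  refine Subtype.ext (lineProj_injOn (nonNull_of_mem_CdS2 (φ₂ z).2)
    (nonNull_of_mem_CdS2 (φ₂' z).2) ?_)
  have := eq_of_eventually_eq_punctured (continuousAt_projAlong_of_isContDiff_zero h₂.1 z)
    (continuousAt_projAlong_of_isContDiff_zero h₂'.1 z)
    (eventually_punctured_nhds_coe.2 ((h.eventually_delbarPrime_ne_zero hne z).mono
      fun w hw => ?_))
  · rwa [projAlong_coe, projAlong_coe] at this
  · rw [projAlong_coe, projAlong_coe]
    congr 1
    exact Projectivization.submodule_injective ((h₂.2 w hw).symm.trans (h₂'.2 w hw))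

/-! ### Vanishing cubic differential and holomorphicity -/

/-- A continuous family of lines that is holomorphic off a point is smooth at the point. -/
theorem contDiffAt_projAlong_of_punctured {ψ : 𝔻 → P21} (hψ : ∀ z, NonNull (ψ z)) {z : 𝔻}
    (hc : ContinuousAt (projAlong ψ) z)
    (h : ∀ᶠ w in 𝓝[≠] (z : ℂ), DifferentiableAt ℝ (projAlong ψ) w ∧
      dZbar (projAlong ψ) w * projAlong ψ w = 0) : ContDiffAt ℝ ∞ (projAlong ψ) z := by
  set u := (ψ z).rep
  obtain ⟨i, hi⟩ : ∃ i, u i ≠ 0 := Function.ne_iff.1 (ψ z).rep_nonzero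
  set τ : ℂ → C21 := fun w => projAlong ψ w u with hτ
  have hτc : ContinuousAt τ z := hc.clm_apply continuousAt_const
  have hτic : ContinuousAt (fun w => τ w i) z := (continuous_apply i).continuousAt.comp hτc
  have hτz : τ z = u := by
    rw [hτ]
    simp only [projAlong_coe]
    exact lineProj_of_mem (hψ z) (rep_mem _)
  have hne : ∀ᶠ w in 𝓝 (z : ℂ), τ w i ≠ 0 := hτic.eventually_ne (by rwa [hτz])
  -- Normalising one coordinate to `1` singles out a holomorphic lift: `∂̄τ` lies in the line, so
  -- `∂̄τ = c τ` at each point, and the quotient by `τ i` loses the factor `c`.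
  set σ : ℂ → C21 := fun w => (τ w i)⁻¹ • τ w with hσ
  have hdiff : ∀ᶠ w in 𝓝[≠] (z : ℂ), DifferentiableAt ℂ σ w := by
    filter_upwards [h, nhdsWithin_le_nhds hne.eventually_nhds,
      nhdsWithin_le_nhds (Metric.isOpen_ball.mem_nhds (mem_ball_of_unitDisc z))]
      with w ⟨hd, hw⟩ hτw hwD
    obtain ⟨w, rfl⟩ := exists_coe_of_mem_ball hwD
    have hτd : DifferentiableAt ℝ τ w :=
      ((ContinuousLinearMap.apply ℂ C21 u).restrictScalars ℝ).differentiableAt.comp (w : ℂ) hd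
    have hτid : DifferentiableAt ℝ (fun x => τ x i) w :=
      ((ContinuousLinearMap.proj (R := ℂ) (φ := fun _ : Fin 3 => ℂ) i).restrictScalars
        ℝ).differentiableAt.comp (w : ℂ) hτd
    have hσd : DifferentiableAt ℝ σ w := (hτid.inv hτw.self_of_nhds).smul hτd
    have hdτ : dZbar τ w = dZbar (projAlong ψ) w u :=
      dZbar_clm (ContinuousLinearMap.apply ℂ C21 u) hd
    have hdτi : dZbar (fun x => τ x i) w = dZbar τ w i :=
      dZbar_clm (ContinuousLinearMap.proj (R := ℂ) (φ := fun _ : Fin 3 => ℂ) i) hτd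
    have hτ0 : τ w ≠ 0 := fun h0 => hτw.self_of_nhds (by rw [h0]; rfl)
    have hmem : dZbar τ w ∈ (ψ w).submodule := by
      have e := dZbar_projAlong hψ hd
      rw [hw, zero_add] at e
      rw [hdτ, ← e, mul_apply_eq_comp, projAlong_coe]
      exact lineProj_apply_mem _ _
    have hτm : τ w ∈ (ψ w).submodule := by
      simp only [hτ, projAlong_coe]
      exact lineProj_apply_mem _ _
    rw [submodule_eq_span hτm hτ0, Submodule.mem_span_singleton] at hmem
    obtain ⟨c, hcτ⟩ := hmem
    refine differentiableAt_of_dZbar_eq_zero hσd ?_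
    have e : τ =ᶠ[𝓝 (w : ℂ)] fun x => τ x i • σ x :=
      hτw.mono fun x hx => by simp only [hσ]; rw [smul_inv_smul₀ hx]
    have e2 := dZbar_congr e
    have es : τ w = τ w i • σ w := e.self_of_nhds
    rw [dZbar_smul hτid hσd, hdτi, ← hcτ, Pi.smul_apply, smul_eq_mul, mul_smul,
      ← es, left_eq_add] at e2
    exact (smul_eq_zero.1 e2).resolve_left hτw.self_of_nhds
  -- Removable singularity: the lift is continuous at `z` and holomorphic around it.
  have han : AnalyticAt ℂ σ z :=
    Complex.analyticAt_of_differentiable_on_punctured_nhds_of_continuousAt hdiff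
      ((hτic.inv₀ (by rwa [hτz])).smul hτc)
  refine contDiffAt_projAlong (hψ z) (han.contDiffAt.restrict_scalars ℝ) ?_
  filter_upwards [eventually_nhds_coe.1 hne] with w hw
  refine ⟨smul_ne_zero (inv_ne_zero hw) fun h0 => hw (by rw [h0]; rfl), ?_⟩
  refine Submodule.smul_mem _ _ ?_
  simp only [hτ, projAlong_coe]
  exact lineProj_apply_mem _ _

/-- Here `P`, `R`, `T` project onto an orthogonal frame, `D`, `D'` are the `Z` and `Z̄` derivatives
of `P`, and `R₁`, `R₂` those of `R`. Split `R₁ R` and `R₂ R` along the frame: the `R` component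
vanishes by idempotence, the `T` component by `t₁`, `t₂`, and the `P` component comes from
differentiating `P R = 0`. -/
theorem deriv_projection_of_orthogonal {𝔸 : Type*} [Ring 𝔸] {P R T D D' R₁ R₂ : 𝔸}
    (h1 : P + R + T = 1) (hR : R * R = R) (hR₁ : R₁ * R + R * R₁ = R₁)
    (hR₂ : R₂ * R + R * R₂ = R₂) (hPR : P * R = 0) (hD' : D' * P + P * D' = D')
    (hD : D * P + P * D = D) (hPD' : P * D' * R = 0) (hPD : P * D * R = P * D)
    (c₁ : D * R + P * R₁ = 0) (c₂ : D' * R + P * R₂ = 0) (t₁ : T * R₁ = 0) (t₂ : T * R₂ = 0) :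
    R₂ * R = 0 ∧ R₁ * R = -(P * D) := by
  have e : ∀ x : 𝔸, x = P * x + R * x + T * x := fun x => by
    rw [← add_mul, ← add_mul, h1, one_mul]
  have e₁ : P * R₁ = -(D * R) := eq_neg_of_add_eq_zero_right c₁
  have e₂ : P * R₂ = -(D' * R) := eq_neg_of_add_eq_zero_right c₂
  have d : D * R = P * D := by
    calc D * R = (D * P + P * D) * R := by rw [hD]
      _ = D * (P * R) + P * D * R := by rw [add_mul, mul_assoc]
      _ = P * D := by rw [hPR, hPD, mul_zero, zero_add]
  have d' : D' * R = 0 := by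
    calc D' * R = (D' * P + P * D') * R := by rw [hD']
      _ = D' * (P * R) + P * D' * R := by rw [add_mul, mul_assoc]
      _ = 0 := by rw [hPR, hPD', mul_zero, zero_add]
  constructor
  · rw [e (R₂ * R), ← mul_assoc, ← mul_assoc, ← mul_assoc, e₂, d', idem_deriv_zero hR hR₂, t₂]
    simp
  · rw [e (R₁ * R), ← mul_assoc, ← mul_assoc, ← mul_assoc, e₁, d, idem_deriv_zero hR hR₁, t₁,
      neg_mul, hPD]
    simp

namespace StructureEquations

variable {f : 𝔻 → CH2} {φ₂ : 𝔻 → CdS2}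

theorem delbarPrime_rep_ne_zero {φ : 𝔻 → P21} (h : StructureEquations φ) {z : 𝔻}
    (hz : delbarPrime φ z ≠ 0) : delbarPrime φ z (φ z).rep ≠ 0 := fun h0 =>
  hz (eq_zero_of_mul_lineProj (ℓ := φ z) (by rw [← projAlong_coe, h.delbarPrime_mul]) h0)

theorem delPrime_rep_ne_zero {φ : 𝔻 → P21} (h : StructureEquations φ) {z : 𝔻}
    (hz : delPrime φ z ≠ 0) : delPrime φ z (φ z).rep ≠ 0 := fun h0 =>
  hz (eq_zero_of_mul_lineProj (ℓ := φ z) (by rw [← projAlong_coe, h.delPrime_mul]) h0)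

theorem projAlong_gauss_eq (h : StructureEquations (fun w => (f w : P21)))
    (h₂ : IsDelbarGaussTransform f φ₂) {z : 𝔻}
    (hz : delbarPrime (fun w => (f w : P21)) z ≠ 0) :
    projAlong (fun w => (φ₂ w : P21)) z
      = projVec (delbarPrime (fun w => (f w : P21)) z (f z : P21).rep) := by
  rw [projAlong_coe]
  refine lineProj_eq_projVec ?_ (h.delbarPrime_rep_ne_zero hz)
  rw [← h₂.2 z hz]
  exact ⟨_, rfl⟩

/-- `π_{φ₂}` and `∂φ''(Z)` have the same kernel. -/
theorem projAlong_gauss_mul_eq_zero_iff (h : StructureEquations (fun w => (f w : P21)))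
    (h₂ : IsDelbarGaussTransform f φ₂) {z : 𝔻}
    (hz : delbarPrime (fun w => (f w : P21)) z ≠ 0) (X : End21) :
    projAlong (fun w => (φ₂ w : P21)) z * X = 0
      ↔ delSecond (fun w => (f w : P21)) z * X = 0 := by
  set φ : 𝔻 → P21 := fun w => (f w : P21) with hφ
  set r := (φ z).rep
  have hu0 : delbarPrime φ z r ≠ 0 := h.delbarPrime_rep_ne_zero hz
  have hu : herm (delbarPrime φ z r) (delbarPrime φ z r) ≠ 0 := by
    intro h0
    have := herm_self_pos_of_orthogonal (h.neg z) hu0 ?_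
    · rw [h0] at this
      simp at this
    · rw [← lineProj_apply_eq_zero_iff (h.nonNull z), ← projAlong_coe, ← mul_apply_eq_comp,
        h.mul_delbarPrime]
      rfl
  have hB : delbarPrime φ z r = -adj (delSecond φ z) r := by
    rw [adj_delSecond h.nonNull (h.differentiableAt z), neg_apply, neg_neg]
  have key : ∀ v, projAlong (fun w => (φ₂ w : P21)) z v = 0 ↔ delSecond φ z v = 0 := by
    intro v
    rw [projAlong_gauss_eq h h₂ hz, projVec_apply, smul_eq_zero, or_iff_left hu0, mul_eq_zero,
      or_iff_right (inv_ne_zero hu)]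
    change herm v (delbarPrime φ z r) = 0 ↔ _
    have hl := lineProj_apply_eq_zero_iff (h.nonNull z) (v := delSecond φ z v)
    rw [← projAlong_coe, ← mul_apply_eq_comp, h.mul_delSecond] at hl
    rw [hB, ← neg_one_smul ℂ, herm_smul_right, ← herm_adj, mul_eq_zero, or_iff_right (by simp)]
    exact hl.symm
  constructor
  · intro h0
    ext1 v
    exact (key _).1 (congrArg (fun Y : End21 => Y v) h0)
  · intro h0
    ext1 v
    exact (key _).2 (congrArg (fun Y : End21 => Y v) h0)

theorem contDiffAt_projAlong_gauss (h : StructureEquations (fun w => (f w : P21)))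
    (h₂ : IsDelbarGaussTransform f φ₂) {z : 𝔻}
    (hz : delbarPrime (fun w => (f w : P21)) z ≠ 0) :
    ContDiffAt ℝ ∞ (projAlong (fun w => (φ₂ w : P21))) z := by
  have hB := contDiffAt_delbarPrime (h.smooth z)
  have hσ : ContDiffAt ℝ ∞ (fun w => delbarPrime (fun w => (f w : P21)) w (f z : P21).rep) z :=
    contDiffAt_clm_apply hB contDiffAt_const
  refine contDiffAt_projAlong (φ := fun w => (φ₂ w : P21)) (nonNull_of_mem_CdS2 (φ₂ z).2) hσ ?_
  filter_upwards [eventually_nhds_coe.1 (hB.continuousAt.eventually_ne hz),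
    eventually_nhds_coe.1 (hσ.continuousAt.eventually_ne (h.delbarPrime_rep_ne_zero hz))]
    with w hw hw'
  refine ⟨hw', ?_⟩
  rw [← h₂.2 w hw]
  exact ⟨_, rfl⟩

theorem eventually_delbarPrime_ne (h : StructureEquations (fun w => (f w : P21))) {z : 𝔻}
    (hz : delbarPrime (fun w => (f w : P21)) z ≠ 0) :
    ∀ᶠ w in 𝓝 (z : ℂ), ∃ x : 𝔻, (x : ℂ) = w ∧ delbarPrime (fun w => (f w : P21)) x ≠ 0 := by
  filter_upwards [(contDiffAt_delbarPrime (h.smooth z)).continuousAt.eventually_ne hz,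
    Metric.isOpen_ball.mem_nhds (mem_ball_of_unitDisc z)] with w hw hD
  obtain ⟨w, rfl⟩ := exists_coe_of_mem_ball hD
  exact ⟨w, rfl, hw⟩

/-- `π_{φ₂} π_f = 0`, `π_{φ₂} ∂f' = 0` and `∂f'' π_{φ₂} = ∂f''`. -/
theorem gauss_relations (h : StructureEquations (fun w => (f w : P21)))
    (h₂ : IsDelbarGaussTransform f φ₂) {z : 𝔻}
    (hz : delbarPrime (fun w => (f w : P21)) z ≠ 0) :
    projAlong (fun w => (φ₂ w : P21)) z * projAlong (fun w => (f w : P21)) z = 0 ∧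
    projAlong (fun w => (f w : P21)) z * projAlong (fun w => (φ₂ w : P21)) z = 0 ∧
    projAlong (fun w => (φ₂ w : P21)) z * delPrime (fun w => (f w : P21)) z = 0 ∧
    delSecond (fun w => (f w : P21)) z * projAlong (fun w => (φ₂ w : P21)) z
      = delSecond (fun w => (f w : P21)) z := by
  have key := h.projAlong_gauss_mul_eq_zero_iff h₂ hz
  have a1 := (key _).2 (h.delSecond_mul z)
  refine ⟨a1, ?_, (key _).2 (h.conformal z), ?_⟩
  · have := congrArg adj a1
    rwa [adj_mul, adj_projAlong, adj_projAlong, map_zero] at this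
  · have e := (key (1 - projAlong (fun w => (φ₂ w : P21)) z)).1 ?_
    · rw [mul_sub, mul_one, sub_eq_zero] at e
      exact e.symm
    · rw [mul_sub, mul_one, projAlong_mul_self fun z => nonNull_of_mem_CdS2 (φ₂ z).2, sub_self]

/-- Pairing with `∂̄f'` detects the component along `φ₂`. The factor `1 - P` in the connexion
disappears because `∂f'' P = 0`. -/
theorem cubicQ_eq_zero_iff (h : StructureEquations (fun w => (f w : P21)))
    (h₂ : IsDelbarGaussTransform f φ₂) {z : 𝔻}
    (hz : delbarPrime (fun w => (f w : P21)) z ≠ 0) :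
    cubicQ f z = 0 ↔ projAlong (fun w => (φ₂ w : P21)) z
      * (dZ (delPrime (fun w => (f w : P21))) z * projAlong (fun w => (f w : P21)) z) = 0 := by
  rw [h.projAlong_gauss_mul_eq_zero_iff h₂ hz, cubicQ, ← projAlong_coe (fun w => (f w : P21)),
    tangentMetric_delbarPrime_eq_zero_iff h.nonNull (h.differentiableAt z)
      (mul_projAlong_of_homPart _ _ h.nonNull _).1, homPart, mul_assoc, ← mul_assoc (delSecond _ _),
    mul_sub, mul_one, h.delSecond_mul, sub_zero]

/-- The derivatives of the relation `π_{φ₂} ∂f' = 0`. -/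
theorem deriv_gauss_mul_delPrime (h : StructureEquations (fun w => (f w : P21)))
    (h₂ : IsDelbarGaussTransform f φ₂) {z : 𝔻}
    (hz : delbarPrime (fun w => (f w : P21)) z ≠ 0) :
    dZ (projAlong (fun w => (φ₂ w : P21))) z * delPrime (fun w => (f w : P21)) z
      + projAlong (fun w => (φ₂ w : P21)) z * dZ (delPrime (fun w => (f w : P21))) z = 0 ∧
    dZbar (projAlong (fun w => (φ₂ w : P21))) z * delPrime (fun w => (f w : P21)) z
      + projAlong (fun w => (φ₂ w : P21)) z * dZbar (delPrime (fun w => (f w : P21))) z = 0 := by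
  have hR : DifferentiableAt ℝ (projAlong (fun w => (φ₂ w : P21))) z :=
    (h.contDiffAt_projAlong_gauss h₂ hz).differentiableAt (by simp)
  have hA : DifferentiableAt ℝ (delPrime (fun w => (f w : P21))) z :=
    (contDiffAt_delPrime (h.smooth z)).differentiableAt (by simp)
  have e : (fun w => projAlong (fun w => (φ₂ w : P21)) w * delPrime (fun w => (f w : P21)) w)
      =ᶠ[𝓝 (z : ℂ)] fun _ => 0 := by
    filter_upwards [h.eventually_delbarPrime_ne hz] with w ⟨x, hx, hx'⟩
    rw [← hx]
    exact (h.gauss_relations h₂ hx').2.2.1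
  rw [← dZ_mul hR hA, ← dZbar_mul hR hA, dZ_congr e, dZbar_congr e, dZ_const, dZbar_const]
  exact ⟨rfl, rfl⟩

theorem deriv_mul_gauss (h : StructureEquations (fun w => (f w : P21)))
    (h₂ : IsDelbarGaussTransform f φ₂) {z : 𝔻}
    (hz : delbarPrime (fun w => (f w : P21)) z ≠ 0) :
    dZ (projAlong (fun w => (f w : P21))) z * projAlong (fun w => (φ₂ w : P21)) z
      + projAlong (fun w => (f w : P21)) z * dZ (projAlong (fun w => (φ₂ w : P21))) z = 0 ∧
    dZbar (projAlong (fun w => (f w : P21))) z * projAlong (fun w => (φ₂ w : P21)) z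
      + projAlong (fun w => (f w : P21)) z * dZbar (projAlong (fun w => (φ₂ w : P21))) z = 0 := by
  have hR : DifferentiableAt ℝ (projAlong (fun w => (φ₂ w : P21))) z :=
    (h.contDiffAt_projAlong_gauss h₂ hz).differentiableAt (by simp)
  have hP := h.differentiableAt z
  have e : (fun w => projAlong (fun w => (f w : P21)) w * projAlong (fun w => (φ₂ w : P21)) w)
      =ᶠ[𝓝 (z : ℂ)] fun _ => 0 := by
    filter_upwards [h.eventually_delbarPrime_ne hz] with w ⟨x, hx, hx'⟩
    rw [← hx]
    exact (h.gauss_relations h₂ hx').2.1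
  rw [← dZ_mul hP hR, ← dZbar_mul hP hR, dZ_congr e, dZbar_congr e, dZ_const, dZbar_const]
  exact ⟨rfl, rfl⟩

/-- With `R = π_{φ₂}`, holomorphicity is `(Z̄R) R = 0`, with adjoint `R (ZR) = 0`. Hence `ZR = (ZR)
R` kills `∂f'`, and differentiating `R ∂f' = 0` leaves `R Z(∂f') = 0`. At a zero of `∂̄f'` the
coefficient `Q` vanishes by its definition. -/
theorem cubicQ_eq_zero_of_holomorphic (h : StructureEquations (fun w => (f w : P21)))
    (h₂ : IsDelbarGaussTransform f φ₂) (hol : ∀ z : 𝔻, delbarPrime (fun w => (φ₂ w : P21)) z = 0)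
    (z : 𝔻) : cubicQ f z = 0 := by
  by_cases hz : delbarPrime (fun w => (f w : P21)) z = 0
  · rw [cubicQ, hz, tangentMetric]
    change herm _ 0 / _ = 0
    rw [herm_zero_right, zero_div]
  · rw [h.cubicQ_eq_zero_iff h₂ hz]
    have hN : ∀ z, NonNull ((fun w => (φ₂ w : P21)) z) := fun z => nonNull_of_mem_CdS2 (φ₂ z).2
    have hR : DifferentiableAt ℝ (projAlong (fun w => (φ₂ w : P21))) z :=
      (h.contDiffAt_projAlong_gauss h₂ hz).differentiableAt (by simp)
    have e1 := hol z
    rw [delbarPrime_eq hN hR] at e1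
    have e2 := congrArg adj e1
    rw [adj_mul, adj_projAlong, adj_dZbar_projAlong hR, map_zero] at e2
    have e3 := dZ_projAlong hN hR
    rw [e2, add_zero] at e3
    have e4 := (h.deriv_gauss_mul_delPrime h₂ hz).1
    rw [← e3, mul_assoc, (h.gauss_relations h₂ hz).2.2.1, mul_zero, zero_add] at e4
    rw [← mul_assoc, e4, zero_mul]

/-- Where `∂f'` and `∂̄f'` do not vanish and `Q = 0`, the Gauss transform is holomorphic with
differential `∂f''`. -/
theorem gauss_deriv_of_cubicQ_eq_zero (h : StructureEquations (fun w => (f w : P21)))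
    (h₂ : IsDelbarGaussTransform f φ₂) {z : 𝔻}
    (hz : delbarPrime (fun w => (f w : P21)) z ≠ 0) (hz' : delPrime (fun w => (f w : P21)) z ≠ 0)
    (hQ : cubicQ f z = 0) :
    dZbar (projAlong (fun w => (φ₂ w : P21))) z * projAlong (fun w => (φ₂ w : P21)) z = 0 ∧
    dZ (projAlong (fun w => (φ₂ w : P21))) z * projAlong (fun w => (φ₂ w : P21)) z
      = delSecond (fun w => (f w : P21)) z := by
  set φ : 𝔻 → P21 := fun w => (f w : P21) with hφ
  set ψ : 𝔻 → P21 := fun w => (φ₂ w : P21) with hψ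
  set r := (φ z).rep with hr
  have hN : ∀ z, NonNull (ψ z) := fun z => nonNull_of_mem_CdS2 (φ₂ z).2
  have hR : DifferentiableAt ℝ (projAlong ψ) z :=
    (h.contDiffAt_projAlong_gauss h₂ hz).differentiableAt (by simp)
  have hP := h.differentiableAt z
  obtain ⟨hRP, hPR, hRA, hSR⟩ := h.gauss_relations h₂ hz
  have orth : ∀ {X : End21}, projAlong φ z * X = 0 → herm (X r) r = 0 := fun {X} hX => by
    rw [← lineProj_apply_eq_zero_iff (h.nonNull z), ← projAlong_coe, ← mul_apply_eq_comp, hX]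
    rfl
  have hrA := orth (h.mul_delPrime z)
  have hrB := orth (h.mul_delbarPrime z)
  have ne : ∀ {v : C21}, v ≠ 0 → herm v r = 0 → herm v v ≠ 0 := fun {v} hv hvr h0 => by
    have := herm_self_pos_of_orthogonal (h.neg z) hv hvr
    rw [h0] at this
    simp at this
  have hA0 := ne (h.delPrime_rep_ne_zero hz') hrA
  have hB0 := ne (h.delbarPrime_rep_ne_zero hz) hrB
  have hRe : projAlong ψ z = projVec (delbarPrime φ z r) := h.projAlong_gauss_eq h₂ hz
  have hPe : projAlong φ z = projVec r := by rw [projAlong_coe, lineProj_eq_projVec_rep]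
  have hAB : herm (delbarPrime φ z r) (delPrime φ z r) = 0 := by
    have e : projAlong ψ z (delPrime φ z r) = 0 := by
      rw [← mul_apply_eq_comp, hRA]
      rfl
    rw [hRe, projVec_apply, smul_eq_zero, or_iff_left (h.delbarPrime_rep_ne_zero hz),
      mul_eq_zero, or_iff_right (inv_ne_zero hB0)] at e
    exact herm_eq_zero_comm.1 e
  set T := projVec (delPrime φ z r) with hT
  have h1 : projAlong φ z + projAlong ψ z + T = 1 := by
    rw [hRe, hPe]
    exact projVec_add_projVec_add_projVec (h.nonNull z) hB0 hA0 (herm_eq_zero_comm.1 hrB)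
      (herm_eq_zero_comm.1 hrA) hAB
  -- An endomorphism killing the image of `∂f'` has an adjoint with values orthogonal to that image.
  have hXT : ∀ {X : End21}, X * delPrime φ z = 0 → T * adj X = 0 := fun {X} hX => by
    have e : X * T = 0 := by
      ext1 v
      rw [mul_apply_eq_comp, hT, projVec_apply, map_smul, ← mul_apply_eq_comp, hX]
      exact smul_zero _
    have := congrArg adj e
    rwa [adj_mul, map_zero, hT, adj_projVec] at this
  obtain ⟨c₁, c₂⟩ := h.deriv_mul_gauss h₂ hz
  obtain ⟨k₁, k₂⟩ := h.deriv_gauss_mul_delPrime h₂ hz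
  have hQ' := (h.cubicQ_eq_zero_iff h₂ hz).1 hQ
  have hD := dZ_projAlong h.nonNull hP
  have hD' := dZbar_projAlong h.nonNull hP
  have hA := delPrime_eq h.nonNull hP
  -- This is where `Q = 0` enters. After the adjoint below it says that the `Z̄` derivative of `R`
  -- has no component along the image of `∂f'`.
  have t₁ : dZ (projAlong ψ) z * delPrime φ z = 0 := by
    have e := congrArg (fun x => x * projAlong φ z) k₁
    simp only [add_mul, zero_mul] at e
    rwa [mul_assoc, mul_assoc, h.delPrime_mul, hQ', add_zero] at e
  -- This follows from the structure equation: `R [A, ∂̄P] = -R (∂̄P) A`, while `(∂̄P) A = P (∂̄P)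
  -- A` and `R P = 0`.
  have t₂ : dZbar (projAlong ψ) z * delPrime φ z = 0 := by
    have e : projAlong ψ z * dZbar (delPrime φ) z = 0 := by
      rw [h.dZbar_delPrime, mul_sub, ← mul_assoc, hRA, zero_mul, zero_sub, neg_eq_zero, ← hD',
        add_mul, mul_assoc, h.mul_delPrime, mul_zero, zero_add, ← mul_assoc, ← mul_assoc, hRP,
        zero_mul, zero_mul]
    rwa [e, add_zero] at k₂
  have hT₁ := hXT t₁
  have hT₂ := hXT t₂
  rw [adj_dZ_projAlong hR] at hT₁
  rw [adj_dZbar_projAlong hR] at hT₂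
  -- The adjoint of `R ∂f' = 0`.
  have hPD' : projAlong φ z * dZbar (projAlong φ) z * projAlong ψ z = 0 := by
    rw [hA, ← mul_assoc] at hRA
    have e := congrArg adj hRA
    rw [adj_mul, adj_mul, adj_projAlong, adj_projAlong, adj_dZ_projAlong hP, map_zero] at e
    rw [mul_assoc, e]
  have hS := delSecond_eq h.nonNull hP
  have hPD : projAlong φ z * dZ (projAlong φ) z * projAlong ψ z
      = projAlong φ z * dZ (projAlong φ) z := by
    rw [hS, end_neg_mul] at hSR
    exact neg_injective hSR
  obtain ⟨e₁, e₂⟩ := deriv_projection_of_orthogonal h1 (projAlong_mul_self hN z)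
    (dZ_projAlong hN hR) (dZbar_projAlong hN hR) hPR hD' hD hPD' hPD c₁ c₂ hT₂ hT₁
  exact ⟨e₁, e₂.trans hS.symm⟩

end StructureEquations

/-! ### The Gauss transform of a map with vanishing cubic differential -/

namespace StructureEquations

variable {f : 𝔻 → CH2} {φ₂ : 𝔻 → CdS2}

/-- The identities hold off the isolated zeros of `∂f'` and `∂̄f'`. The removable singularity
argument makes `φ₂` smooth there, and then both sides extend by continuity. -/
theorem gauss_of_cubicQ_eq_zero (h : StructureEquations (fun w => (f w : P21)))
    (h₂ : IsDelbarGaussTransform f φ₂) (hB : ∃ z : 𝔻, delbarPrime (fun w => (f w : P21)) z ≠ 0)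
    (hA : ∃ z : 𝔻, delPrime (fun w => (f w : P21)) z ≠ 0) (hQ : ∀ z, cubicQ f z = 0) (z : 𝔻) :
    ContDiffAt ℝ ∞ (projAlong (fun w => (φ₂ w : P21))) z ∧
    delbarPrime (fun w => (φ₂ w : P21)) z = 0 ∧
    delPrime (fun w => (φ₂ w : P21)) z = delSecond (fun w => (f w : P21)) z := by
  set φ : 𝔻 → P21 := fun w => (f w : P21) with hφ
  set ψ : 𝔻 → P21 := fun w => (φ₂ w : P21) with hψ
  have hN : ∀ z, NonNull (ψ z) := fun z => nonNull_of_mem_CdS2 (φ₂ z).2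
  have key : ∀ᶠ w : 𝔻 in 𝓝[≠] z, DifferentiableAt ℝ (projAlong ψ) w ∧
      dZbar (projAlong ψ) w * projAlong ψ w = 0 ∧
      dZ (projAlong ψ) w * projAlong ψ w = delSecond φ w := by
    filter_upwards [h.eventually_delbarPrime_ne_zero hB z, h.eventually_delPrime_ne_zero hA z]
      with w hw hw'
    exact ⟨(h.contDiffAt_projAlong_gauss h₂ hw).differentiableAt (by simp),
      h.gauss_deriv_of_cubicQ_eq_zero h₂ hw hw' (hQ w)⟩
  rw [← eventually_punctured_nhds_coe (p := fun w => DifferentiableAt ℝ (projAlong ψ) w ∧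
      dZbar (projAlong ψ) w * projAlong ψ w = 0 ∧
      dZ (projAlong ψ) w * projAlong ψ w = delSecond φ w)] at key
  have hs : ContDiffAt ℝ ∞ (projAlong ψ) z :=
    contDiffAt_projAlong_of_punctured hN ((isContDiff_iff hN).1 h₂.1 z).continuousAt
      (key.mono fun w hw => ⟨hw.1, hw.2.1⟩)
  refine ⟨hs, ?_, ?_⟩
  · refine eq_of_eventually_eq_punctured (contDiffAt_delbarPrime hs).continuousAt
      (continuousAt_const (y := (0 : End21))) (key.mono fun w hw => ?_)
    rw [delbarPrime_eq hN hw.1, hw.2.1]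
  · refine eq_of_eventually_eq_punctured (contDiffAt_delPrime hs).continuousAt
      (contDiffAt_delSecond (h.smooth z)).continuousAt (key.mono fun w hw => ?_)
    rw [delPrime_eq hN hw.1, hw.2.2]

theorem isHolomorphic_gauss (h : StructureEquations (fun w => (f w : P21)))
    (h₂ : IsDelbarGaussTransform f φ₂) (hB : ∃ z : 𝔻, delbarPrime (fun w => (f w : P21)) z ≠ 0)
    (hA : ∃ z : 𝔻, delPrime (fun w => (f w : P21)) z ≠ 0) (hQ : ∀ z, cubicQ f z = 0) :
    IsHolomorphic (fun w => (φ₂ w : P21)) :=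
  ⟨(isContDiff_iff fun z => nonNull_of_mem_CdS2 (φ₂ z).2).2 fun z =>
    (h.gauss_of_cubicQ_eq_zero h₂ hB hA hQ z).1, fun z =>
    (h.gauss_of_cubicQ_eq_zero h₂ hB hA hQ z).2.1⟩

/-- Here `dφ₂'(X) = X • ∂f''`, so branch points are the isolated zeros of `∂f''`. Elsewhere the
induced metric is `|X|²` times a negative number, because `∂f''` takes values in the negative line
`f z`. -/
theorem isTimelike_gauss (h : StructureEquations (fun w => (f w : P21)))
    (h₂ : IsDelbarGaussTransform f φ₂) (hB : ∃ z : 𝔻, delbarPrime (fun w => (f w : P21)) z ≠ 0)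
    (hA : ∃ z : 𝔻, delPrime (fun w => (f w : P21)) z ≠ 0) (hQ : ∀ z, cubicQ f z = 0) :
    IsTimelike φ₂ := by
  set φ : 𝔻 → P21 := fun w => (f w : P21) with hφ
  set ψ : 𝔻 → P21 := fun w => (φ₂ w : P21) with hψ
  have hd : ∀ (z : 𝔻) X, dPrime ψ z X = X • delSecond φ z := fun z X => by
    obtain ⟨-, e₁, e₂⟩ := h.gauss_of_cubicQ_eq_zero h₂ hB hA hQ z
    rw [dPrime_eq, e₁, e₂]
    exact (congrArg _ (smul_zero (A := End21) (conj X))).trans (add_zero _)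
  refine ⟨fun z => ?_, fun z hz X hX => ?_⟩
  · filter_upwards [h.eventually_delSecond_ne_zero hB z] with w hw hb
    refine hw ?_
    have := hb 1
    rwa [hd, one_smul] at this
  · have hS : delSecond φ z ≠ 0 := fun h0 => hz fun X => by
      rw [hd, h0]
      exact smul_zero (A := End21) X
    have hSm : delSecond φ z * lineProj (ψ z) = delSecond φ z := by
      rw [← (h.gauss_of_cubicQ_eq_zero h₂ hB hA hQ z).2.2, ← projAlong_coe]
      exact (mul_projAlong_of_homPart ψ z (fun z => nonNull_of_mem_CdS2 (φ₂ z).2) _).1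
    have hr : delSecond φ z (ψ z).rep ≠ 0 := fun h0 => hS (eq_zero_of_mul_lineProj hSm h0)
    have hm : delSecond φ z (ψ z).rep ∈ (φ z).submodule := by
      rw [← h.mul_delSecond z, mul_apply_eq_comp, projAlong_coe]
      exact lineProj_apply_mem _ _
    have hneg := mem_CH2_of_mem_submodule (h.neg z) hm hr
    have hpos : 0 < |(herm (ψ z).rep (ψ z).rep).re| := abs_pos.2 (φ₂ z).2.ne'
    rw [inducedMetric, hd, tangentMetric, Complex.div_ofReal_re, smul_apply, herm_self_re_smul]
    exact div_neg_of_neg_of_pos (mul_neg_of_pos_of_neg (by positivity) hneg) hpos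

theorem branchOrder_gauss (h : StructureEquations (fun w => (f w : P21)))
    (h₂ : IsDelbarGaussTransform f φ₂) (hB : ∃ z : 𝔻, delbarPrime (fun w => (f w : P21)) z ≠ 0)
    (hA : ∃ z : 𝔻, delPrime (fun w => (f w : P21)) z ≠ 0) (hQ : ∀ z, cubicQ f z = 0) (z : 𝔻) :
    branchOrder (fun w => (φ₂ w : P21)) z = complexPointOrder f z := by
  have e : delPrime (fun w => (φ₂ w : P21)) =ᶠ[𝓝 (z : ℂ)] delSecond (fun w => (f w : P21)) :=
    eventually_nhds_coe.2 (.of_forall fun w => (h.gauss_of_cubicQ_eq_zero h₂ hB hA hQ w).2.2)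
  unfold branchOrder complexPointOrder vanishingOrder
  congr! 3
  exact Asymptotics.isBigO_congr e .rfl

theorem complexPointOrder_ne_top (h : StructureEquations (fun w => (f w : P21)))
    (hB : ∃ z : 𝔻, delbarPrime (fun w => (f w : P21)) z ≠ 0) (z : 𝔻) :
    complexPointOrder f z ≠ ⊤ := by
  obtain ⟨k, a, ha, hk⟩ := h.leading_delSecond hB z
  refine ne_top_of_le_ne_top (ENat.natCast_ne_top k) (iSup₂_le fun n hn => ?_)
  exact_mod_cast le_of_leading_of_isBigO ha hk hn

end StructureEquations

/-! ### Equivariance -/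

/-- An element of `U(2,1)` as an endomorphism. -/
noncomputable def toEnd (g : U21) : End21 :=
  LinearMap.toContinuousLinearMap ((g : C21 ≃ₗ[ℂ] C21) : C21 →ₗ[ℂ] C21)

theorem toEnd_mul (g g' : U21) : toEnd g * toEnd g' = toEnd (g * g') := rfl

theorem toEnd_one : toEnd 1 = 1 := rfl

theorem toEnd_inv_apply (g : U21) (v : C21) : toEnd g⁻¹ (toEnd g v) = v := by
  rw [← mul_apply_eq_comp, toEnd_mul, inv_mul_cancel, toEnd_one]
  rfl

theorem toEnd_inv_apply' (g : U21) (v : C21) : toEnd g (toEnd g⁻¹ v) = v := by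
  rw [← mul_apply_eq_comp, toEnd_mul, mul_inv_cancel, toEnd_one]
  rfl

theorem herm_toEnd (g : U21) (v w : C21) : herm (toEnd g v) (toEnd g w) = herm v w := g.2 v w

theorem submodule_smul (g : U21) (ℓ : P21) :
    ((g : PU21) • ℓ).submodule = ℓ.submodule.map (toEnd g : C21 →ₗ[ℂ] C21) := by
  induction ℓ using Projectivization.ind with
  | h v hv =>
    change ((g : C21 ≃ₗ[ℂ] C21) • Projectivization.mk ℂ v hv).submodule = _
    rw [Projectivization.smul_mk, Projectivization.submodule_mk, Projectivization.submodule_mk,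
      Submodule.map_span, Set.image_singleton]
    rfl

theorem toEnd_mem_smul (g : U21) {ℓ : P21} {v : C21} (hv : v ∈ ℓ.submodule) :
    toEnd g v ∈ ((g : PU21) • ℓ).submodule := by
  rw [submodule_smul]
  exact ⟨v, hv, rfl⟩

theorem toEnd_ne_zero (g : U21) {v : C21} (hv : v ≠ 0) : toEnd g v ≠ 0 := fun h => by
  apply hv
  rw [← toEnd_inv_apply g v, h, map_zero]

theorem lineProj_smul (g : U21) (ℓ : P21) :
    lineProj ((g : PU21) • ℓ) = toEnd g * lineProj ℓ * toEnd g⁻¹ := by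
  rw [lineProj_eq_projVec (toEnd_mem_smul g (rep_mem ℓ)) (toEnd_ne_zero g ℓ.rep_nonzero)]
  ext1 v
  rw [mul_apply_eq_comp, mul_apply_eq_comp, lineProj_eq_projVec_rep, projVec_apply, projVec_apply,
    map_smul, herm_toEnd, ← herm_toEnd g (toEnd g⁻¹ v), toEnd_inv_apply']

theorem smul_mem_CdS2 (x : PU21) {ℓ : P21} (hℓ : ℓ ∈ CdS2) : x • ℓ ∈ CdS2 := by
  obtain ⟨g, rfl⟩ := QuotientGroup.mk_surjective x
  obtain ⟨c, hc⟩ := mem_submodule_iff.1 (toEnd_mem_smul g (rep_mem ℓ))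
  have h1 : 0 < (herm (toEnd g ℓ.rep) (toEnd g ℓ.rep)).re := by
    rw [herm_toEnd]
    exact hℓ
  rw [← hc, herm_self_re_smul] at h1
  exact pos_of_mul_pos_right h1 (by positivity)

section Equivariance

variable {φ : 𝔻 → P21} {g : U21} {T : 𝔻 → 𝔻} {F : ℂ → ℂ}

/-- Precomposition with a holomorphic map that is intertwined with `g ∈ U(2,1)`. -/
theorem delbarPrime_of_equivariant (hφ : ∀ z, NonNull (φ z))
    (hd : ∀ z : 𝔻, DifferentiableAt ℝ (projAlong φ) z)
    (hF : DifferentiableOn ℂ F (Metric.ball 0 1)) (hT : ∀ z : 𝔻, (T z : ℂ) = F z)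
    (hφT : ∀ z, φ (T z) = (g : PU21) • φ z) (z : 𝔻) :
    conj (deriv F z) • delbarPrime φ (T z) = toEnd g * delbarPrime φ z * toEnd g⁻¹ := by
  have hF' : HasDerivAt F (deriv F z) z :=
    (hF.differentiableAt (Metric.isOpen_ball.mem_nhds (mem_ball_of_unitDisc z))).hasDerivAt
  have hP : ∀ w : 𝔻, projAlong φ (F w) = toEnd g * projAlong φ w * toEnd g⁻¹ := fun w => by
    rw [← hT, projAlong_coe, hφT, lineProj_smul, projAlong_coe]
  have e : (fun w => projAlong φ (F w)) =ᶠ[𝓝 (z : ℂ)]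
      fun w => toEnd g * projAlong φ w * toEnd g⁻¹ :=
    eventually_nhds_coe.2 (.of_forall hP)
  have e1 := dZbar_comp_holomorphic hF' (by rw [← hT]; exact hd (T z))
  rw [dZbar_congr e, dZbar_mul (u := fun w => toEnd g * projAlong φ w) ((differentiableAt_const _).mul (hd z)) (differentiableAt_const _),
    dZbar_mul (differentiableAt_const _) (hd z), dZbar_const, dZbar_const, zero_mul, zero_add,
    mul_zero, add_zero, ← hT] at e1
  have hgg : toEnd g⁻¹ * toEnd g = 1 := by rw [toEnd_mul, inv_mul_cancel, toEnd_one]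
  have e2 : projAlong φ (T z) = toEnd g * projAlong φ z * toEnd g⁻¹ := by rw [hT, hP]
  rw [delbarPrime_eq hφ (hd _), delbarPrime_eq hφ (hd _), ← end_smul_mul, ← e1, e2]
  simp only [mul_assoc]
  rw [← mul_assoc (toEnd g⁻¹) (toEnd g), hgg, one_mul]

end Equivariance

variable {f : 𝔻 → CH2} {φ₂ : 𝔻 → CdS2}

/-- The differential `∂̄f'` at `T z` is, up to the scalar `conj (F' z)`, the conjugate by `g` of the
one at `z`, so `g⁻¹` carries the image line at `T z` to the one at `z`. -/
theorem IsDelbarGaussTransform.comp_equivariant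
    (h : StructureEquations (fun w => (f w : P21))) (h₂ : IsDelbarGaussTransform f φ₂)
    {g : U21} {T : 𝔻 → 𝔻} {F : ℂ → ℂ} (hF : DifferentiableOn ℂ F (Metric.ball 0 1))
    (hT : ∀ z : 𝔻, (T z : ℂ) = F z) (hfT : ∀ z, (f (T z) : P21) = (g : PU21) • (f z : P21))
    {φ₂' : 𝔻 → CdS2}
    (hφ' : ∀ z, (φ₂' z : P21) = ((g⁻¹ : U21) : PU21) • (φ₂ (T z) : P21)) :
    IsDelbarGaussTransform f φ₂' := by
  have hFc : ∀ z : 𝔻, ContinuousAt F z := fun z =>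
    (hF.differentiableAt (Metric.isOpen_ball.mem_nhds (mem_ball_of_unitDisc z))).continuousAt
  refine ⟨fun z => ?_, fun z hz => ?_⟩
  · obtain ⟨σ, hσ, hm⟩ := h₂.1 (T z)
    have hTc : ContinuousAt T z := by
      rw [isOpenEmbedding_unitDisc_coe.isInducing.continuousAt_iff]
      exact ((hFc z).comp (f := ((↑) : 𝔻 → ℂ)) Complex.UnitDisc.continuous_coe.continuousAt).congr
        (.of_forall fun w => (hT w).symm)
    have hFR : ContDiffAt ℝ 0 F z := by
      have := (hF.contDiffOn (n := 0) Metric.isOpen_ball).contDiffAt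
        (Metric.isOpen_ball.mem_nhds (mem_ball_of_unitDisc z))
      exact this.restrict_scalars ℝ
    refine ⟨fun w => toEnd g⁻¹ (σ (F w)), contDiffAt_clm_apply contDiffAt_const
      (ContDiffAt.comp (z : ℂ) (by rwa [← hT]) hFR), ?_⟩
    filter_upwards [hTc.eventually hm] with w hw
    rw [← hT]
    refine ⟨toEnd_ne_zero _ hw.1, ?_⟩
    rw [hφ']
    exact toEnd_mem_smul _ hw.2
  · set φ : 𝔻 → P21 := fun w => (f w : P21)
    have e := delbarPrime_of_equivariant h.nonNull h.differentiableAt hF hT hfT z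
    have e' : delbarPrime φ z
        = toEnd g⁻¹ * (conj (deriv F z) • delbarPrime φ (T z)) * toEnd g := by
      rw [e]
      have hgg : toEnd g⁻¹ * toEnd g = 1 := by rw [toEnd_mul, inv_mul_cancel, toEnd_one]
      simp only [mul_assoc]
      rw [hgg, mul_one, ← mul_assoc, hgg, one_mul]
    -- The derivative of `F` cannot vanish where `∂̄f'` does not, by the transformation rule itself.
    have hc : conj (deriv F z) ≠ 0 := fun h0 => hz (by
      rw [e', h0]
      exact (congrArg (fun X => toEnd g⁻¹ * X * toEnd g) (zero_smul ℂ (delbarPrime φ (T z)))).trans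
        (by simp))
    have hTz : delbarPrime φ (T z) ≠ 0 := fun h0 => hz (by
      rw [e', h0]
      exact (congrArg (fun X => toEnd g⁻¹ * X * toEnd g)
        (smul_zero (A := End21) (conj (deriv F z)))).trans (by simp))
    rw [hφ', submodule_smul, ← h₂.2 (T z) hTz]
    ext v
    constructor
    · rintro ⟨u, rfl⟩
      refine ⟨_, ⟨conj (deriv F z) • toEnd g u, rfl⟩, ?_⟩
      change toEnd g⁻¹ (delbarPrime φ (T z) (conj (deriv F z) • toEnd g u)) = delbarPrime φ z u
      rw [e', map_smul]
      rfl
    · rintro ⟨_, ⟨u, rfl⟩, rfl⟩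
      refine ⟨toEnd g⁻¹ ((conj (deriv F z))⁻¹ • u), ?_⟩
      change delbarPrime φ z _ = toEnd g⁻¹ (delbarPrime φ (T z) u)
      rw [e', mul_apply_eq_comp, mul_apply_eq_comp, smul_apply, toEnd_inv_apply', map_smul,
        map_smul, map_smul, smul_inv_smul₀ hc]

/-- Translating `φ₂` by `γ` and then back by `ρ γ` gives another Gauss transform of the same `f`;
uniqueness identifies the two. -/
theorem IsDelbarGaussTransform.isEquivariant {Γ : Type*} [Group Γ] {δ : Γ →* Equiv.Perm 𝔻}
    (hδ : IsFuchsian δ) {ρ : Γ →* PU21} (h : StructureEquations (fun w => (f w : P21)))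
    (hB : ∃ z : 𝔻, delbarPrime (fun w => (f w : P21)) z ≠ 0)
    (hequiv : IsEquivariant δ ρ (fun z => (f z : P21))) (h₂ : IsDelbarGaussTransform f φ₂) :
    IsEquivariant δ ρ (fun z => (φ₂ z : P21)) := by
  intro γ z
  obtain ⟨F, hF, hT⟩ := hδ.holomorphic γ
  obtain ⟨g, hg⟩ := QuotientGroup.mk_surjective (ρ γ)
  have h₂' : IsDelbarGaussTransform f fun w =>
      ⟨((g⁻¹ : U21) : PU21) • (φ₂ (δ γ w) : P21), smul_mem_CdS2 _ (φ₂ _).2⟩ :=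
    h₂.comp_equivariant h hF hT (fun w => by rw [hg]; exact hequiv γ w) fun _ => rfl
  have e := congrArg (fun ψ : 𝔻 → CdS2 => (ψ z : P21)) (h₂'.unique h hB h₂)
  change ((g⁻¹ : U21) : PU21) • (φ₂ (δ γ z) : P21) = (φ₂ z : P21) at e
  change (φ₂ (δ γ z) : P21) = ρ γ • (φ₂ z : P21)
  rw [← e, ← hg, QuotientGroup.mk_inv, smul_inv_smul]

end CHMinimal

/-! ### Conclusion -/

theorem mainTheorem10 {Γ : Type*} [Group Γ]
    (δ : Γ →* Equiv.Perm Complex.UnitDisc) (hδ : CHMinimal.IsFuchsian δ)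
    (ρ : Γ →* CHMinimal.PU21)
    (f : Complex.UnitDisc → CHMinimal.CH2)
    (hf : CHMinimal.IsBranchedMinimal f)
    (hequiv : CHMinimal.IsEquivariant δ ρ (fun z => (f z : CHMinimal.P21)))
    (hhol : ¬ CHMinimal.IsHolomorphic (fun z => (f z : CHMinimal.P21)))
    (hanti : ¬ CHMinimal.IsAntiholomorphic (fun z => (f z : CHMinimal.P21))) :
    (∃! φ₂ : Complex.UnitDisc → CHMinimal.CdS2, CHMinimal.IsDelbarGaussTransform f φ₂) ∧
    ∀ φ₂ : Complex.UnitDisc → CHMinimal.CdS2, CHMinimal.IsDelbarGaussTransform f φ₂ →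
      ((∀ z, CHMinimal.cubicQ f z = 0) ↔
        (CHMinimal.IsTimelike φ₂ ∧
          CHMinimal.IsEquivariant δ ρ (fun z => (φ₂ z : CHMinimal.P21)) ∧
          CHMinimal.IsHolomorphic (fun z => (φ₂ z : CHMinimal.P21)))) ∧
      ((∀ z, CHMinimal.cubicQ f z = 0) →
        ∀ z, CHMinimal.branchOrder (fun w => (φ₂ w : CHMinimal.P21)) z =
            CHMinimal.complexPointOrder f z ∧
          CHMinimal.complexPointOrder f z ≠ ⊤) := by
  have h := hf.structureEquations
  -- The two exclusions on `f` say that `∂̄f'` and `∂f'` are not identically zero, the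
  -- non-triviality that unique continuation needs.
  have hB : ∃ z : 𝔻, CHMinimal.delbarPrime (fun w => (f w : CHMinimal.P21)) z ≠ 0 := by
    by_contra! h0
    exact hhol ⟨hf.smooth, h0⟩
  have hA : ∃ z : 𝔻, CHMinimal.delPrime (fun w => (f w : CHMinimal.P21)) z ≠ 0 := by
    by_contra! h0
    exact hanti ⟨hf.smooth, h0⟩
  obtain ⟨φ, hφ⟩ := CHMinimal.exists_isDelbarGaussTransform h hB
  refine ⟨⟨φ, hφ, fun ψ hψ => hψ.unique h hB hφ⟩, fun φ₂ h₂ => ⟨⟨fun hQ => ?_, fun H => ?_⟩,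
    fun hQ z => ?_⟩⟩
  · exact ⟨h.isTimelike_gauss h₂ hB hA hQ, h₂.isEquivariant hδ h hB hequiv,
      h.isHolomorphic_gauss h₂ hB hA hQ⟩
  · exact h.cubicQ_eq_zero_of_holomorphic h₂ H.2.2.2
  · exact ⟨h.branchOrder_gauss h₂ hB hA hQ z, h.complexPointOrder_ne_top hB z⟩
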